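/- Let $g=3$ and let $\mathbb T$ be the bilayer Cayley tree with splitting number $g$: two copies (layers) of the Cayley tree of degree $g+1=4$, with a rung joining the two copies of every vertex, so that every site has degree $d=g+2=5$ and carries a spin $5/2$. For a finite set of sites the AKLT Hamiltonian is $H=\sum_{e} P_e$, the sum over the edges $e=\{x,y\}$ inside the set of the orthogonal projections $P_e$ onto the subspace where the spins at $x$ and $y$ have total spin $5$. Let $T_n$ be the set of the sites whose tree vertex has distance at most $n$ from the root. A finite-volume ground state is a density matrix $\rho_n$ on $T_n$ with $H_{T_n}\rho_n=0$; an infinite-volume ground state is a weak limit $\omega(A)=\lim_n \operatorname{tr}(\rho_n A)$ ($A$ any local observable) of finite-volume ground states $\rho_n$ on $T_n$. Let $\partial T_n$ be the set of the tree vertices at distance $n+1$ from the root; each stands for a pair of dangling legs of $T_n$, one per layer. The valence-bond map $V_n$ from $(\mathbb C^2\otimes\mathbb C^2)^{\otimes\partial T_n}$ to the spins on $T_n$ puts a singlet on every edge inside $T_n$ and projects the five spins $\tfrac12$ at each site onto their symmetric subspace. A boundary condition $B_n\in (M_2\otimes M_2)^{\otimes\partial T_n}$ gives the state $\rho_n(B_n)=V_nB_nV_n^*/\operatorname{tr}(V_nB_nV_n^*)$.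 Let $\tilde{\mathbb F}:(M_2\otimes M_2)^{\otimes 3}\to M_2\otimes M_2$ be the transfer operator of one bilayer node (a rung with its two sites, three ingoing and one outgoing pair of legs, singlets on the rung and on the outgoing legs): $\tilde{\mathbb F}(Y)=4\,\mathbb F(Y)/\operatorname{tr}\mathbb F(Y)$, $\mathbb F(Y)=\sum_k W_kYW_k^*$, the sum over the physical basis of the two sites. With $\sigma_1,\sigma_2,\sigma_3$ the Pauli matrices and $\sigma_i'=-\sigma_i$ (spins in the second layer are measured with reversed sign), let $$B(x_1,x_2,x_3)=1\otimes 1+x_1\sum_i(\sigma_i\otimes 1+1\otimes\sigma_i')+x_2\sum_{i\ne j}\sigma_i\otimes\sigma_j'+x_3\sum_i\sigma_i\otimes\sigma_i'.$$ **Theorem.** There are real numbers $x_1,x_2,x_3$ with $|x_1-0.2716|,\ |x_2-0.0546|,\ |x_3-0.1534|<5\cdot10^{-5}$ such that, for $\mathbf x_\pm=[\pm x_1,x_2,x_3]$: 1. $\tilde{\mathbb F}(B(\mathbf x_\pm)^{\otimes 3})=B(\mathbf x_\mp)$. 2. For all $n$ and both signs, $\rho_n(B(\mathbf x_\pm)^{\otimes\partial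 T_n})$ is a finite-volume ground state. 3. The sequences of boundary conditions $B(\pm(-1)^nx_1,x_2,x_3)^{\otimes\partial T_n}$ have weak limits $\omega_\pm$, which are infinite-volume ground states and are Néel ordered: there is $s>0$ such that $\omega_\pm(S^i_v)=\pm\varepsilon(v)\,s$ for every site $v$ and $i=1,2,3$. Here $S^i_v$ is the $i$-th component of the spin at $v$, and $\varepsilon(v)=1$ on the sublattice of the bipartite graph $\mathbb T$ that contains the first-layer root and $\varepsilon(v)=-1$ on the other one. In particular, the AKLT Hamiltonian on the bilayer Cayley tree with $g=3$ does not have a unique infinite-volume ground state. -/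

import Mathlib

open Filter Topology
open scoped ComplexOrder Kronecker

namespace AKLT

/-! ### The bilayer Cayley tree with splitting number `g` -/

/-- Vertices of the Cayley tree of degree `g + 1`: reduced words over `g + 1` letters, that is,
words without two equal consecutive letters. The edges of the tree are properly coloured by the
letters: the neighbour of the word `w` along colour `c` is `c :: w`, or the tail of `w` if `c` is
the first letter of `w`. The root is the empty word. -/
abbrev Word (g : ℕ) : Type := {w : List (Fin (g + 1)) // w.IsChain (· ≠ ·)}

/-- The distance of a vertex from the root. -/
def Word.length {g : ℕ} (w : Word g) : ℕ := w.1.length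

/-- The neighbour of `w` on the way to the root (the root is sent to itself). -/
def Word.parent {g : ℕ} (w : Word g) : Word g := ⟨w.1.tail, w.2.tail⟩

/-- The Cayley tree in which every vertex has degree `g + 1`. -/
def cayleyTree (g : ℕ) : SimpleGraph (Word g) :=
  SimpleGraph.fromRel fun u v => ∃ c, v.1 = c :: u.1

/-- Sites of the bilayer tree: a vertex of the Cayley tree and a layer
(`false` is the first layer, `true` the second). -/
abbrev Site (g : ℕ) : Type := Word g × Bool

/-- The bilayer Cayley tree: two copies of the Cayley tree of degree `g + 1`, with a rung between
the two copies of every vertex. Every site has degree `g + 2`. -/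
def bilayerTree (g : ℕ) : SimpleGraph (Site g) :=
  (cayleyTree g).boxProd (⊤ : SimpleGraph Bool)

/-- The vertices of the Cayley tree at distance `n` from the root. -/
def sphere (g n : ℕ) : Finset (Word g) :=
  (Finset.univ.image
    (List.ofFn : (Fin n → Fin (g + 1)) → List (Fin (g + 1)))).subtype _

theorem mem_sphere {g n : ℕ} {w : Word g} : w ∈ sphere g n ↔ w.length = n := by
  simp only [sphere, Finset.mem_subtype, Finset.mem_image, Finset.mem_univ, true_and, Word.length]
  constructor
  · rintro ⟨f, hf⟩
    rw [← hf, List.length_ofFn]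
  · rintro rfl
    exact ⟨w.1.get, List.ofFn_get _⟩

/-- The vertices of the Cayley tree at distance at most `n` from the root. -/
def ball (g n : ℕ) : Finset (Word g) :=
  (Finset.range (n + 1)).biUnion (sphere g)

theorem mem_ball {g n : ℕ} {w : Word g} : w ∈ ball g n ↔ w.length ≤ n := by
  simp [ball, mem_sphere]

/-- The sites of the `n`-layer bilayer tree `T_n`. -/
def volume (g n : ℕ) : Finset (Site g) := ball g n ×ˢ Finset.univ

/-! ### Spins -/

/-- Configurations of the finite set `Λ` of sites. As every site has degree `d = g + 2`, it carries
the spin `d / 2`, with the basis `Fin (d + 1)`; the basis vector `k` has `S^z`-eigenvalue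
`k - d / 2`. -/
abbrev Cfg {g : ℕ} (Λ : Finset (Site g)) : Type := Λ → Fin (g + 3)

/-- The algebra of observables of the finite set `Λ` of sites. -/
abbrev Obs {g : ℕ} (Λ : Finset (Site g)) : Type := Matrix (Cfg Λ) (Cfg Λ) ℂ

/-- The raising operator `S^+` of the spin `d / 2`: the matrix element from `k` to `k + 1` is
`√((k + 1) (d - k))`. -/
noncomputable def raising (d : ℕ) : Matrix (Fin (d + 1)) (Fin (d + 1)) ℂ := fun k l =>
  if (k : ℕ) = (l : ℕ) + 1 then ((Real.sqrt (((l : ℝ) + 1) * ((d : ℝ) - (l : ℝ))) : ℝ) : ℂ) else 0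

/-- The spin matrices `S^x, S^y, S^z` of the spin `d / 2`. -/
noncomputable def spin (d : ℕ) : Fin 3 → Matrix (Fin (d + 1)) (Fin (d + 1)) ℂ :=
  ![(1 / 2 : ℂ) • (raising d + (raising d).conjTranspose),
    (1 / (2 * Complex.I) : ℂ) • (raising d - (raising d).conjTranspose),
    Matrix.diagonal fun k => (k : ℂ) - (d : ℂ) / 2]

/-- The operator that acts as `A` on the site `v` and as the identity on the other sites. -/
def siteOp {g : ℕ} {Λ : Finset (Site g)} (v : Λ) (A : Matrix (Fin (g + 3)) (Fin (g + 3)) ℂ) :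
    Obs Λ := fun s t =>
  if ∀ u, u ≠ v → s u = t u then A (s v) (t v) else 0

/-- An observable of `Λ` as an observable of the larger set `Λ'`: the operator `A ⊗ 1`. -/
def extend {g : ℕ} {Λ Λ' : Finset (Site g)} (h : Λ ⊆ Λ') (A : Obs Λ) : Obs Λ' := fun s t =>
  if ∀ u : Λ', (u : Site g) ∉ Λ → s u = t u then
    A (fun v => s ⟨v, h v.2⟩) (fun v => t ⟨v, h v.2⟩) else 0

/-! ### The Hamiltonian and its ground states -/

/-- The Casimir operator `(S_x + S_y)²` of the two sites `x` and `y`. -/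
noncomputable def casimir {g : ℕ} {Λ : Finset (Site g)} (x y : Λ) : Obs Λ :=
  ∑ i : Fin 3, (siteOp x (spin (g + 2) i) + siteOp y (spin (g + 2) i)) ^ 2

/-- The AKLT projector of the edge between `x` and `y`: the orthogonal projection onto the subspace
in which the two spins `d / 2` couple to the maximal total spin `d`, where `d = g + 2`, that is,
onto the eigenspace of `(S_x + S_y)²` with the eigenvalue `d (d + 1)`. -/
noncomputable def edgeProj {g : ℕ} {Λ : Finset (Site g)} (x y : Λ) : Obs Λ :=
  Matrix.toEuclideanLin.symm
    ((Module.End.eigenspace (Matrix.toEuclideanLin (casimir x y))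
      (((g : ℂ) + 2) * ((g : ℂ) + 3))).starProjection : EuclideanSpace ℂ (Cfg Λ) →ₗ[ℂ] _)

open Classical in
/-- The AKLT Hamiltonian of a finite set of sites: the sum of the projectors of all edges inside
`Λ`. The sum runs over ordered pairs of neighbours, so each edge is counted twice, whence the
factor `1 / 2`. -/
noncomputable def hamiltonian {g : ℕ} (Λ : Finset (Site g)) : Obs Λ :=
  (1 / 2 : ℂ) • ∑ x : Λ, ∑ y : Λ, if (bilayerTree g).Adj x y then edgeProj x y else 0

/-- The density matrix `ρ` is a finite-volume ground state: it is supported on the kernel of the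
(nonnegative, frustration-free) Hamiltonian. -/
structure IsFiniteVolumeGroundState {g : ℕ} {Λ : Finset (Site g)} (ρ : Obs Λ) : Prop where
  posSemidef : ρ.PosSemidef
  trace_eq_one : ρ.trace = 1
  hamiltonian_mul : hamiltonian Λ * ρ = 0

/-- A state of the infinite system, given by its expectations of all local observables. -/
abbrev InfState (g : ℕ) : Type := ∀ Λ : Finset (Site g), Obs Λ → ℂ

/-- `ω` is the weak limit of the finite-volume states `ρ n` of the trees `T_n`:
`ω(A) = lim tr (ρ n (A ⊗ 1))` for every local observable `A`. -/
def IsWeakLimit {g : ℕ} (ρ : ∀ n, Obs (volume g n)) (ω : InfState g) : Prop :=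
  ∀ (Λ : Finset (Site g)) (A : Obs Λ),
    Tendsto (fun n => if h : Λ ⊆ volume g n then (ρ n * extend h A).trace else 0)
      atTop (𝓝 (ω Λ A))

/-- `ω` is an infinite-volume ground state: a weak limit of finite-volume ground states. -/
def IsGroundState {g : ℕ} (ω : InfState g) : Prop :=
  ∃ ρ : ∀ n, Obs (volume g n), (∀ n, IsFiniteVolumeGroundState (ρ n)) ∧ IsWeakLimit ρ ω

/-- The AKLT Hamiltonian on the bilayer Cayley tree with splitting number `g` has a unique
infinite-volume ground state. -/
def HasUniqueGroundState (g : ℕ) : Prop :=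
  ∃! ω : InfState g, IsGroundState ω

/-! ### Valence bonds, boundary conditions, and the transfer operator -/

/-- The Pauli matrices `σ₁, σ₂, σ₃`; the first basis vector is spin up. -/
def pauli : Fin 3 → Matrix (Fin 2) (Fin 2) ℂ :=
  ![!![0, 1; 1, 0], !![0, -Complex.I; Complex.I, 0], !![1, 0; 0, -1]]

/-- The singlet `S = |↑⟩⟨↓| - |↓⟩⟨↑|`. -/
def singlet : Matrix (Fin 2) (Fin 2) ℂ := !![0, 1; -1, 0]

/-- The matrix elements of the intertwiner from the spins `1 / 2` on the legs `ι` of a site to the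
spin `|ι| / 2` of the site: the basis vector `k` is the normalized symmetric state with `k` ups. -/
noncomputable def symAmp {ι : Type} [Fintype ι] (k : ℕ) (q : ι → Fin 2) : ℂ :=
  if (Finset.univ.filter fun i => q i = 0).card = k then
    ((1 / Real.sqrt ((Fintype.card ι).choose k) : ℝ) : ℂ) else 0

/-- The state space of the two spins `1 / 2`, one in each layer, on an edge of the Cayley tree. -/
abbrev Pair : Type := Fin 2 × Fin 2

/-- The tensor power `M ⊗ ⋯ ⊗ M` with factors indexed by `ι`. -/
def tensorPow (ι : Type) [Fintype ι] (M : Matrix Pair Pair ℂ) :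
    Matrix (ι → Pair) (ι → Pair) ℂ := fun a b => ∏ i, M (a i) (b i)

/-- The operator of a node (a rung with its two sites) of the bilayer tree for the physical basis
vectors `k, l` of its two sites. It maps the `g` ingoing pairs of spins `1 / 2` to the outgoing
pair. The legs of a site are the rung, the outgoing leg and the `g` ingoing legs; the rung carries
a singlet, and so does each outgoing leg. -/
noncomputable def nodeOp (g : ℕ) (k l : Fin (g + 3)) : Matrix Pair (Fin g → Pair) ℂ :=
  fun out inn => ∑ r : Pair, ∑ o : Pair,
    singlet r.1 r.2 * (singlet out.1 o.1 * singlet out.2 o.2) *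
      (symAmp (k : ℕ) (Fin.cons r.1 (Fin.cons o.1 fun i => (inn i).1) : Fin (g + 2) → Fin 2) *
       symAmp (l : ℕ) (Fin.cons r.2 (Fin.cons o.2 fun i => (inn i).2) : Fin (g + 2) → Fin 2))

/-- The unnormalized bilayer transfer operator `Y ↦ ∑ W Y W*`, the sum over the physical basis. -/
noncomputable def transferUnnormalized (g : ℕ) (Y : Matrix (Fin g → Pair) (Fin g → Pair) ℂ) :
    Matrix Pair Pair ℂ :=
  ∑ k : Fin (g + 3), ∑ l : Fin (g + 3), nodeOp g k l * Y * (nodeOp g k l).conjTranspose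

/-- The bilayer transfer operator, normalized such that the coefficient of `1 ⊗ 1` in the output
is `1`. -/
noncomputable def transfer (g : ℕ) (Y : Matrix (Fin g → Pair) (Fin g → Pair) ℂ) :
    Matrix Pair Pair ℂ :=
  (4 / (transferUnnormalized g Y).trace) • transferUnnormalized g Y

/-- The boundary condition
`B(x) = 1⊗1 + x₁ ∑ᵢ (σᵢ⊗1 + 1⊗σᵢ') + x₂ ∑_{i≠j} σᵢ⊗σⱼ' + x₃ ∑ᵢ σᵢ⊗σᵢ'`, where `σᵢ' = -σᵢ`: the
two sites of a rung belong to different sublattices, and the spins of the second layer are taken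
with the opposite sign. -/
noncomputable def boundaryOp (x₁ x₂ x₃ : ℝ) : Matrix Pair Pair ℂ :=
  1 + (x₁ : ℂ) • ∑ i, (pauli i ⊗ₖ 1 + 1 ⊗ₖ (-pauli i))
    + (x₂ : ℂ) • ∑ i, ∑ j, (if i ≠ j then pauli i ⊗ₖ (-pauli j) else 0)
    + (x₃ : ℂ) • ∑ i, pauli i ⊗ₖ (-pauli i)

/-- The legs of a site: `none` is the rung, `some c` is the edge of colour `c` in the layer. -/
abbrev Leg (g : ℕ) : Type := Option (Fin (g + 1))

/-- The boundary `∂T_n` of the `n`-layer tree: the vertices at distance `n + 1`. Each of them stands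
for the pair of dangling legs (one in each layer) that point from `T_n` to it. -/
abbrev Boundary (g n : ℕ) : Type := sphere g (n + 1)

/-- The valence-bond map of `T_n`, from the dangling legs to the physical spins: every site is the
symmetric product of the spins `1 / 2` on its legs, every edge inside `T_n` carries a singlet, and
the dangling legs are those of the argument. The colour of the edge from a non-root vertex `w` to
its parent is the first letter of `w`, so `w.1.head?` is the corresponding leg at both ends. -/
noncomputable def vbsMap (g n : ℕ) : Matrix (Cfg (volume g n)) (Boundary g n → Pair) ℂ :=
  fun s b => ∑ q : volume g n → Leg g → Fin 2,
    let q' : Site g → Leg g → Fin 2 := fun v => if h : v ∈ volume g n then q ⟨v, h⟩ else 0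
    (∏ v, symAmp (s v : ℕ) (q v)) *
    (∏ w ∈ ball g n, singlet (q' (w, false) none) (q' (w, true) none)) *
    (∏ w ∈ ball g n with w.length ≠ 0, ∏ layer : Bool,
      singlet (q' (w.parent, layer) w.1.head?) (q' (w, layer) w.1.head?)) *
    (if ∀ w : Boundary g n, (q' (w.1.parent, false) w.1.1.head?,
        q' (w.1.parent, true) w.1.1.head?) = b w then 1 else 0)

/-- The finite-volume state of `T_n` with the boundary condition `B`:
`ρ = V B V* / tr (V B V*)`, where `V` is the valence-bond map. -/
noncomputable def boundaryState (g n : ℕ)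
    (B : Matrix (Boundary g n → Pair) (Boundary g n → Pair) ℂ) : Obs (volume g n) :=
  ((vbsMap g n * B * (vbsMap g n).conjTranspose).trace)⁻¹ •
    (vbsMap g n * B * (vbsMap g n).conjTranspose)

/-- The sublattice sign of a site: `1` on the sublattice of the root of the first layer and `-1` on
the other sublattice. -/
def sublatticeSign {g : ℕ} (v : Site g) : ℝ := (-1) ^ (v.1.length + v.2.toNat)

/-- The expectation of the `i`-th spin component at the site `v`. -/
noncomputable def magnetization {g : ℕ} (ω : InfState g) (v : Site g) (i : Fin 3) : ℂ :=
  ω {v} (siteOp ⟨v, Finset.mem_singleton_self v⟩ (spin (g + 2) i))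

end AKLT

namespace AKLT

open Matrix

/-! ### The symmetric subspace of the legs of a site -/

/-! Two facts carry the theorem: valence-bond states are annihilated by every AKLT projector, and
for suitable product boundary conditions the contraction of the outermost layer gives back the same
boundary condition with the opposite Néel sign.

Ground states. A vector of maximal total spin at two neighbouring sites, expanded in the legs, does
not change when a leg of one site is exchanged with a leg of the other (`eq_of_maximal_spin`,
`legContract_swapLegs`). The bond tensor changes sign when the two legs of a singlet are exchanged
(`bondFactor_swap_rung`, `bondFactor_swap_edge`). Their overlap therefore equals its own negative,
every projector kills the valence-bond map (`edgeProj_mul_vbsMap`), and any positive semidefinite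
product boundary condition with nonzero norm gives a ground state.

Recursion. The valence-bond map of `T_{n+1}` is that of `T_n` composed with one node operator per
boundary vertex (`vbsMap_glue`), so expectations in `T_{n+1}` are expectations in `T_n` with the
boundary matrices sent through the transfer operator (`expect_succ`). If that operator exchanges two
boundary matrices up to a positive factor and they alternate with `n`, the expectation of a local
observable is the same for all `T_n` that contain its support. The weak limits are limits of
eventually constant sequences (`trace_boundaryState_extend`). The same relation and the symmetry of
a node in its `g + 1` legs contract everything around one node, so that the magnetization becomes a
single-node quantity (`exists_expect_update`, `expect_siteOp`).

The boundary matrix. Rotation covariance turns the Néel vector from the diagonal to the third axis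
(`boundaryOp_eq_conj`). There the matrix has four independent entries, on which the transfer
operator acts by explicit cubics (`transferOp_zMat`). The exchange condition becomes three
polynomial equations for `(3 x₁², x₂, x₃)` (`transferOp_zBoundary`), solved by a Newton-type
contraction on a tiny box (`exists_swapPoly_eq_zero`). The bounds of the box give positivity of the
matrices. The magnetization is `x₁` times a polynomial with positive coefficients over positive
factors, so it is nonzero and odd in `x₁`, and the two limits differ at the root. -/

/-- The number of spins up. -/
def upCount {ι : Type} [Fintype ι] (q : ι → Fin 2) : ℕ := (Finset.univ.filter fun i => q i = 0).card

theorem symAmp_eq {ι : Type} [Fintype ι] (k : ℕ) (q : ι → Fin 2) : symAmp k q =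
    if upCount q = k then ((1 / Real.sqrt ((Fintype.card ι).choose k) : ℝ) : ℂ) else 0 := rfl

theorem upCount_le {ι : Type} [Fintype ι] (q : ι → Fin 2) : upCount q ≤ Fintype.card ι :=
  Finset.card_le_univ _

theorem upCount_comp {ι κ : Type} [Fintype ι] [Fintype κ] (q : ι → Fin 2) (e : κ ≃ ι) :
    upCount (fun i => q (e i)) = upCount q := by
  unfold upCount
  exact Finset.card_equiv e (by simp)

theorem symAmp_comp {ι κ : Type} [Fintype ι] [Fintype κ] (k : ℕ) (q : ι → Fin 2) (e : κ ≃ ι) :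
    symAmp k (fun i => q (e i)) = symAmp k q := by
  rw [symAmp_eq, symAmp_eq, upCount_comp, Fintype.card_congr e]

theorem star_symAmp {ι : Type} [Fintype ι] (k : ℕ) (q : ι → Fin 2) :
    star (symAmp k q) = symAmp k q := by
  rw [symAmp_eq]; split_ifs
  · exact Complex.conj_ofReal _
  · simp

theorem card_upCount_eq (ι : Type) [Fintype ι] [DecidableEq ι] (k : ℕ) :
    (Finset.univ.filter fun q : ι → Fin 2 => upCount q = k).card = (Fintype.card ι).choose k := by
  rw [← Finset.card_univ, ← Finset.card_powersetCard]
  refine Finset.card_bij' (fun q _ => Finset.univ.filter fun i => q i = 0)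
    (fun s _ => fun i => if i ∈ s then 0 else 1) ?_ ?_ ?_ ?_
  · intro q hq
    exact Finset.mem_powersetCard.2 ⟨Finset.subset_univ _, (Finset.mem_filter.1 hq).2⟩
  · intro s hs
    have : s.card = k := by simpa [Finset.mem_powersetCard] using hs
    refine Finset.mem_filter.2 ⟨Finset.mem_univ _, ?_⟩
    show (Finset.univ.filter _).card = k
    simpa using this
  · intro q _
    funext i
    by_cases h : q i = 0
    · simp [h]
    · simp only [Finset.mem_filter, Finset.mem_univ, true_and, h, if_false]; omega
  · intro s _; ext i; simp

/-- The isometry from the legs of a site to its spin. -/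
noncomputable def symMat (ι : Type) [Fintype ι] (d : ℕ) : Matrix (Fin (d + 1)) (ι → Fin 2) ℂ :=
  fun k q => symAmp (k : ℕ) q

theorem symAmp_mul_self {ι : Type} [Fintype ι] (k : ℕ) (q : ι → Fin 2) :
    symAmp k q * symAmp k q = if upCount q = k then ((Fintype.card ι).choose k : ℂ)⁻¹ else 0 := by
  rw [symAmp_eq]; split_ifs
  · rw [← Complex.ofReal_mul, div_mul_div_comm, Real.mul_self_sqrt (by positivity)]
    simp
  · simp

/-- A configuration of the legs overlaps only with the basis vector indexed by its number of ups.
The weight `φ` makes the formula serve both the symmetric projection and diagonal observables such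
as the third spin component. -/
theorem sum_symAmp_mul {ι : Type} [Fintype ι] {d : ℕ} (hd : Fintype.card ι = d) (φ : ℕ → ℂ)
    (q q' : ι → Fin 2) :
    ∑ k : Fin (d + 1), φ k * (symAmp (k : ℕ) q * symAmp (k : ℕ) q') =
      if upCount q = upCount q' then φ (upCount q) * ((d.choose (upCount q) : ℕ) : ℂ)⁻¹ else 0 := by
  have hq : upCount q < d + 1 := by have := upCount_le q; omega
  rw [Finset.sum_eq_single (⟨upCount q, hq⟩ : Fin (d + 1))]
  · split_ifs with h
    · have : symAmp (upCount q) q' = symAmp (upCount q) q := by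
        rw [symAmp_eq, symAmp_eq]; simp [h]
      simp only [this]
      rw [symAmp_mul_self, if_pos rfl, hd]
    · rw [symAmp_eq (upCount q) q', if_neg (fun h' => h h'.symm)]; simp
  · intro k _ hk
    rw [symAmp_eq, if_neg]; · simp
    intro h; apply hk; ext; exact h.symm
  · simp

theorem symMat_mul_transpose {ι : Type} [Fintype ι] [DecidableEq ι] {d : ℕ}
    (hd : Fintype.card ι = d) : symMat ι d * (symMat ι d)ᵀ = 1 := by
  ext k l
  rw [Matrix.mul_apply, Matrix.one_apply]
  simp only [Matrix.transpose_apply, symMat]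
  split_ifs with h
  · subst h
    simp only [symAmp_mul_self]
    rw [← Finset.sum_filter, Finset.sum_const, card_upCount_eq, nsmul_eq_mul, mul_inv_cancel₀]
    have := k.2
    exact_mod_cast (Nat.choose_pos (by omega)).ne'
  · refine Finset.sum_eq_zero fun q _ => ?_
    rw [symAmp_eq, symAmp_eq]
    by_cases h1 : upCount q = k
    · rw [if_neg (c := upCount q = l)]; · simp
      intro h2; exact h (Fin.ext (h1.symm.trans h2))
    · simp [h1]

/-- Two configurations of the legs with the same number of ups differ by a permutation. -/
theorem exists_perm_of_upCount_eq {ι : Type} [Fintype ι] [DecidableEq ι] {q p : ι → Fin 2}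
    (h : upCount q = upCount p) : ∃ e : Equiv.Perm ι, (fun i => p (e i)) = q := by
  have h0 : Fintype.card {i // q i = 0} = Fintype.card {i // p i = 0} := by
    simpa [Fintype.card_subtype, upCount] using h
  let e1 : {i // q i = 0} ≃ {i // p i = 0} := Fintype.equivOfCardEq h0
  refine ⟨e1.extendSubtype, funext fun i => ?_⟩
  by_cases hi : q i = 0
  · rw [hi]; exact e1.extendSubtype_mem i hi
  · have := e1.extendSubtype_not_mem i hi
    omega

/-- The product `symMatᵀ * symMat` averages over configurations with equally many ups, and these
classes are exactly the orbits of the permutations of the legs. -/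
theorem symMat_projection_apply {ι : Type} [Fintype ι] [DecidableEq ι] {d : ℕ}
    (hd : Fintype.card ι = d) (h : (ι → Fin 2) → ℂ)
    (hh : ∀ (e : Equiv.Perm ι) q, h (fun i => q (e i)) = h q) :
    ((symMat ι d)ᵀ * symMat ι d) *ᵥ h = h := by
  ext q
  have : ∀ p, ((symMat ι d)ᵀ * symMat ι d) q p * h p =
      if upCount p = upCount q then ((d.choose (upCount q) : ℕ) : ℂ)⁻¹ * h q else 0 := by
    intro p
    have := sum_symAmp_mul hd (fun _ => 1) q p
    simp only [one_mul] at this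
    rw [Matrix.mul_apply]
    simp only [Matrix.transpose_apply, symMat]
    rw [this]
    by_cases hq : upCount q = upCount p
    · obtain ⟨e, he⟩ := exists_perm_of_upCount_eq hq
      rw [if_pos hq, if_pos hq.symm, ← hh e p, he]
    · rw [if_neg hq, if_neg (Ne.symm hq), zero_mul]
  rw [Matrix.mulVec, dotProduct, Finset.sum_congr rfl fun p _ => this p, ← Finset.sum_filter,
    Finset.sum_const, card_upCount_eq, hd, nsmul_eq_mul, ← mul_assoc, mul_inv_cancel₀, one_mul]
  have := upCount_le q
  exact_mod_cast (Nat.choose_pos (by omega)).ne'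

/-! ### Product operators on the legs and their compression to the spin -/

/-- The tensor product of a family of matrices. -/
def tensorProd {ι : Type} [Fintype ι] {α β : Type} (M : ι → Matrix α β ℂ) :
    Matrix (ι → α) (ι → β) ℂ := fun a b => ∏ i, M i (a i) (b i)

theorem tensorProd_apply {ι : Type} [Fintype ι] {α β : Type} (M : ι → Matrix α β ℂ)
    (a : ι → α) (b : ι → β) : tensorProd M a b = ∏ i, M i (a i) (b i) := rfl

theorem tensorProd_mul {ι : Type} [Fintype ι] [DecidableEq ι] {α β γ : Type} [Fintype β]
    (M : ι → Matrix α β ℂ) (N : ι → Matrix β γ ℂ) :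
    tensorProd M * tensorProd N = tensorProd fun i => M i * N i := by
  ext a c
  simp only [Matrix.mul_apply, tensorProd, ← Finset.prod_mul_distrib]
  rw [Finset.prod_univ_sum, Fintype.piFinset_univ]

theorem tensorProd_one {ι : Type} [Fintype ι] {α : Type} [DecidableEq α] :
    tensorProd (fun _ : ι => (1 : Matrix α α ℂ)) = 1 := by
  ext a b
  rw [tensorProd, Matrix.one_apply]
  simp only [Matrix.one_apply, Finset.prod_ite_zero, Finset.prod_const_one, Finset.mem_univ,
    true_imp_iff, funext_iff]

theorem tensorProd_conjTranspose {ι : Type} [Fintype ι] {α β : Type} (M : ι → Matrix α β ℂ) :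
    (tensorProd M)ᴴ = tensorProd fun i => (M i)ᴴ := by
  ext a b; simp [tensorProd, Matrix.conjTranspose_apply]

theorem tensorProd_transpose {ι : Type} [Fintype ι] {α β : Type} (M : ι → Matrix α β ℂ) :
    (tensorProd M)ᵀ = tensorProd fun i => (M i)ᵀ := by
  ext a b; simp [tensorProd]

theorem tensorPow_eq (ι : Type) [Fintype ι] (M : Matrix Pair Pair ℂ) :
    tensorPow ι M = tensorProd fun _ => M := rfl

theorem tensorProd_smul {ι : Type} [Fintype ι] {α β : Type} (c : ι → ℂ) (M : ι → Matrix α β ℂ) :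
    tensorProd (fun i => c i • M i) = (∏ i, c i) • tensorProd M := by
  ext a b; simp [tensorProd, Finset.prod_mul_distrib]

/-- The action of a product operator on the legs, compressed to the spin of the site. -/
noncomputable def compress {ι : Type} [Fintype ι] [DecidableEq ι] (d : ℕ) (M : ι → Matrix (Fin 2) (Fin 2) ℂ) :
    Matrix (Fin (d + 1)) (Fin (d + 1)) ℂ := symMat ι d * tensorProd M * (symMat ι d)ᵀ

/-- The representation of a matrix on the spin `d / 2`. -/
noncomputable def symRep (d : ℕ) (U : Matrix (Fin 2) (Fin 2) ℂ) :
    Matrix (Fin (d + 1)) (Fin (d + 1)) ℂ := compress (ι := Fin d) d fun _ => U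

/-- A product of equal factors commutes with permutations of the legs, hence preserves the symmetric
subspace and passes through the symmetric projection. -/
theorem tensorProd_mul_symMat_transpose {ι : Type} [Fintype ι] [DecidableEq ι] {d : ℕ}
    (hd : Fintype.card ι = d) (U : Matrix (Fin 2) (Fin 2) ℂ) :
    tensorProd (fun _ : ι => U) * (symMat ι d)ᵀ =
      (symMat ι d)ᵀ * compress (ι := ι) d fun _ => U := by
  rw [compress, Matrix.mul_assoc, ← Matrix.mul_assoc (symMat ι d)ᵀ]
  ext q k
  have := symMat_projection_apply hd
    (fun q => (tensorProd (fun _ : ι => U) * (symMat ι d)ᵀ) q k) ?_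
  · exact (congrFun this q).symm
  · intro e q
    simp only [Matrix.mul_apply, tensorProd, Matrix.transpose_apply, symMat]
    refine Fintype.sum_equiv (e.symm.arrowCongr (Equiv.refl _)).symm _ _ fun p => ?_
    have h1 : ((e.symm.arrowCongr (Equiv.refl (Fin 2))).symm p) = fun i => p (e.symm i) := by
      funext i; simp [Equiv.arrowCongr]
    rw [h1, symAmp_comp]
    congr 1
    refine Fintype.prod_equiv e _ _ fun i => by simp

theorem symMat_mul_tensorProd {ι : Type} [Fintype ι] [DecidableEq ι] {d : ℕ}
    (hd : Fintype.card ι = d) (U : Matrix (Fin 2) (Fin 2) ℂ) :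
    symMat ι d * tensorProd (fun _ : ι => U) = (compress (ι := ι) d fun _ => U) * symMat ι d := by
  have := congrArg Matrix.transpose (tensorProd_mul_symMat_transpose hd Uᵀ)
  simp only [Matrix.transpose_mul, Matrix.transpose_transpose, tensorProd_transpose, compress] at this
  rw [this, compress]
  simp only [Matrix.mul_assoc]

theorem star_symMat {ι : Type} [Fintype ι] (d : ℕ) : (symMat ι d)ᴴ = (symMat ι d)ᵀ := by
  ext q k
  exact star_symAmp _ _

theorem compress_conjTranspose {ι : Type} [Fintype ι] [DecidableEq ι] {d : ℕ}
    (M : ι → Matrix (Fin 2) (Fin 2) ℂ) : (compress d M)ᴴ = compress d fun i => (M i)ᴴ := by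
  rw [compress, Matrix.conjTranspose_mul, Matrix.conjTranspose_mul, tensorProd_conjTranspose,
    star_symMat, ← star_symMat, Matrix.conjTranspose_conjTranspose, compress, Matrix.mul_assoc,
    star_symMat]

/-- Compression is not multiplicative in general. It is when one of the factors is a constant
product, because that factor moves past the symmetric projection in between. -/
theorem compress_const_mul {ι : Type} [Fintype ι] [DecidableEq ι] {d : ℕ}
    (hd : Fintype.card ι = d) (U : Matrix (Fin 2) (Fin 2) ℂ) (M : ι → Matrix (Fin 2) (Fin 2) ℂ) :
    (compress (ι := ι) d fun _ => U) * compress d M = compress d fun i => U * M i := by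
  rw [compress.eq_1 d M, ← Matrix.mul_assoc, ← Matrix.mul_assoc, ← symMat_mul_tensorProd hd,
    Matrix.mul_assoc (symMat ι d), tensorProd_mul, compress]

theorem compress_mul_const {ι : Type} [Fintype ι] [DecidableEq ι] {d : ℕ}
    (hd : Fintype.card ι = d) (U : Matrix (Fin 2) (Fin 2) ℂ) (M : ι → Matrix (Fin 2) (Fin 2) ℂ) :
    compress d M * (compress (ι := ι) d fun _ => U) = compress d fun i => M i * U := by
  rw [compress.eq_1 d M, Matrix.mul_assoc, ← tensorProd_mul_symMat_transpose hd,
    ← Matrix.mul_assoc, Matrix.mul_assoc (symMat ι d), tensorProd_mul, compress]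

theorem compress_one {ι : Type} [Fintype ι] [DecidableEq ι] {d : ℕ} (hd : Fintype.card ι = d) :
    (compress (ι := ι) d fun _ => 1) = 1 := by
  rw [compress, tensorProd_one, Matrix.mul_one, symMat_mul_transpose hd]

theorem symRep_mul (d : ℕ) (U V : Matrix (Fin 2) (Fin 2) ℂ) :
    symRep d U * symRep d V = symRep d (U * V) :=
  compress_const_mul (Fintype.card_fin d) U _

theorem symRep_one (d : ℕ) : symRep d 1 = 1 := compress_one (Fintype.card_fin d)

theorem symRep_conjTranspose (d : ℕ) (U : Matrix (Fin 2) (Fin 2) ℂ) :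
    (symRep d U)ᴴ = symRep d Uᴴ := compress_conjTranspose _

/-! ### The spin matrices in terms of the legs -/

/-- The derived representation of a matrix on the spin `d / 2`. -/
noncomputable def symDeriv (d : ℕ) (A : Matrix (Fin 2) (Fin 2) ℂ) :
    Matrix (Fin (d + 1)) (Fin (d + 1)) ℂ :=
  ∑ j : Fin d, compress d fun i => if i = j then A else 1

theorem symRep_mul_symDeriv_mul (d : ℕ) {U : Matrix (Fin 2) (Fin 2) ℂ} (hU : Uᴴ * U = 1)
    (A : Matrix (Fin 2) (Fin 2) ℂ) :
    (symRep d U)ᴴ * symDeriv d A * symRep d U = symDeriv d (Uᴴ * A * U) := by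
  rw [symDeriv, symDeriv, Finset.mul_sum, Finset.sum_mul, symRep_conjTranspose]
  refine Finset.sum_congr rfl fun j _ => ?_
  rw [symRep, symRep, compress_const_mul (Fintype.card_fin d),
    compress_mul_const (Fintype.card_fin d)]
  congr 1
  funext i
  split_ifs <;> simp [hU]

theorem symDeriv_apply (d : ℕ) (A : Matrix (Fin 2) (Fin 2) ℂ) (k l : Fin (d + 1)) :
    symDeriv d A k l = ∑ q : Fin d → Fin 2, symAmp (l : ℕ) q *
      ∑ j, ∑ a, A a (q j) * symAmp (k : ℕ) (Function.update q j a) := by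
  -- The operator is the identity on all legs but `j`, so only the configurations that agree with
  -- `q` away from `j` contribute.
  have key : ∀ (j : Fin d) (q : Fin d → Fin 2),
      ∑ p : Fin d → Fin 2, symAmp (k : ℕ) p *
        tensorProd (fun i => if i = j then A else (1 : Matrix (Fin 2) (Fin 2) ℂ)) p q =
      ∑ a, A a (q j) * symAmp (k : ℕ) (Function.update q j a) := by
    intro j q
    rw [← Finset.sum_subset (Finset.subset_univ
      (Finset.univ.image fun a => Function.update q j a))]
    · rw [Finset.sum_image]
      · refine Finset.sum_congr rfl fun a _ => ?_
        rw [mul_comm]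
        congr 1
        rw [tensorProd, Finset.prod_eq_single j]
        · simp
        · intro i _ hi; rw [if_neg hi, Function.update_of_ne hi, Matrix.one_apply_eq]
        · simp
      · intro a _ b _ hab
        simpa using congrFun hab j
    · intro p _ hp
      have : ∃ i, i ≠ j ∧ p i ≠ q i := by
        by_contra! hcon
        apply hp
        simp only [Finset.mem_image, Finset.mem_univ, true_and]
        refine ⟨p j, funext fun i => ?_⟩
        by_cases hi : i = j
        · subst hi; simp
        · simp [hi, hcon i hi]
      obtain ⟨i, hi, hpq⟩ := this
      rw [tensorProd, Finset.prod_eq_zero (Finset.mem_univ i), mul_zero]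
      simp [hi, hpq]
  simp only [symDeriv, Matrix.sum_apply, compress]
  simp only [Matrix.mul_apply, Matrix.transpose_apply, symMat, key]
  rw [Finset.sum_comm]
  refine Finset.sum_congr rfl fun q _ => ?_
  rw [← Finset.sum_mul, mul_comm]

theorem symDeriv_add (d : ℕ) (A B : Matrix (Fin 2) (Fin 2) ℂ) :
    symDeriv d (A + B) = symDeriv d A + symDeriv d B := by
  ext k l
  simp only [symDeriv_apply, Matrix.add_apply, add_mul, Finset.sum_add_distrib, mul_add]

theorem symDeriv_smul (d : ℕ) (c : ℂ) (A : Matrix (Fin 2) (Fin 2) ℂ) :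
    symDeriv d (c • A) = c • symDeriv d A := by
  ext k l
  simp only [symDeriv_apply, Matrix.smul_apply, smul_eq_mul, mul_assoc, Finset.mul_sum,
    mul_left_comm c]

theorem symDeriv_conjTranspose (d : ℕ) (A : Matrix (Fin 2) (Fin 2) ℂ) :
    (symDeriv d A)ᴴ = symDeriv d Aᴴ := by
  rw [symDeriv, Matrix.conjTranspose_sum, symDeriv]
  refine Finset.sum_congr rfl fun j _ => ?_
  rw [compress_conjTranspose]
  congr 1
  funext i
  split_ifs <;> simp

theorem upCount_update {ι : Type} [Fintype ι] [DecidableEq ι] (q : ι → Fin 2) {j : ι} (hj : q j = 1) :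
    upCount (Function.update q j 0) = upCount q + 1 := by
  unfold upCount
  rw [← Finset.card_insert_of_notMem (a := j) (by simp [hj])]
  congr 1
  ext i
  by_cases hi : i = j
  · subst hi; simp
  · simp [hi]

theorem upCount_add_downCount {d : ℕ} (q : Fin d → Fin 2) :
    upCount q + (Finset.univ.filter fun i => q i = 1).card = d := by
  have := Finset.card_filter_add_card_filter_not (s := Finset.univ) (fun i : Fin d => q i = 0)
  rw [Finset.card_univ, Fintype.card_fin] at this
  have h1 : (Finset.univ.filter fun i => q i = 1) = Finset.univ.filter fun i => ¬ q i = 0 := by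
    ext i
    simp only [Finset.mem_filter, Finset.mem_univ, true_and]
    omega
  rw [h1]
  exact this

/-- Reconciles two forms of the same matrix element: any of the `d - l` down legs can be flipped,
between symmetric states with binomial normalizations. The algebra is `(l + 1) C(d, l + 1) = (d - l)
C(d, l)`. -/
theorem sqrt_choose_succ {d l : ℕ} (h : l < d) :
    ((d : ℝ) - l) * (1 / Real.sqrt (d.choose (l + 1))) =
      Real.sqrt (((l : ℝ) + 1) * ((d : ℝ) - l)) * (1 / Real.sqrt (d.choose l)) := by
  have h1 : (0 : ℝ) < d.choose l := by exact_mod_cast Nat.choose_pos h.le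
  have h2 : (0 : ℝ) < d.choose (l + 1) := by exact_mod_cast Nat.choose_pos h
  have h3 : (0 : ℝ) < (d : ℝ) - l := by
    have : (l : ℝ) < d := by exact_mod_cast h
    linarith
  have h4 : (d.choose (l + 1) : ℝ) * (l + 1) = d.choose l * ((d : ℝ) - l) := by
    have := Nat.choose_succ_right_eq d l
    rw [← Nat.cast_sub h.le]
    exact_mod_cast this
  rw [← div_eq_mul_one_div, ← div_eq_mul_one_div, div_eq_div_iff (by positivity) (by positivity),
    ← Real.sqrt_mul (by positivity), ← sq_eq_sq₀ (by positivity) (by positivity), mul_pow,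
    Real.sq_sqrt (by positivity), Real.sq_sqrt (by positivity)]
  linear_combination (-((d : ℝ) - l)) * h4

theorem raising_eq_symDeriv (d : ℕ) : raising d = symDeriv d !![0, 1; 0, 0] := by
  ext k l
  have hq : ∀ q : Fin d → Fin 2, symAmp (l : ℕ) q * ∑ j, ∑ a : Fin 2,
      (!![0, 1; 0, 0] : Matrix (Fin 2) (Fin 2) ℂ) a (q j) *
        symAmp (k : ℕ) (Function.update q j a) =
      raising d k l * (symAmp (l : ℕ) q * symAmp (l : ℕ) q) := by
    intro q
    by_cases hl : upCount q = l
    · have h1 : ∀ j, ∑ a : Fin 2, (!![0, 1; 0, 0] : Matrix (Fin 2) (Fin 2) ℂ) a (q j) *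
          symAmp (k : ℕ) (Function.update q j a) = if q j = 1 then
            (if (k : ℕ) = l + 1 then ((1 / Real.sqrt (d.choose (l + 1)) : ℝ) : ℂ) else 0)
            else 0 := by
        intro j
        rw [Fin.sum_univ_two]
        by_cases hj : q j = 1
        · rw [if_pos hj, symAmp_eq, upCount_update q hj, hl, hj, Fintype.card_fin]
          by_cases hk : (k : ℕ) = l + 1
          · simp [hk]
          · simp [hk, Ne.symm hk]
        · have : q j = 0 := by omega
          simp [this]
      simp only [h1]
      rw [← Finset.sum_filter, Finset.sum_const, nsmul_eq_mul, raising]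
      have h2 := upCount_add_downCount q
      by_cases hk : (k : ℕ) = l + 1
      · have hlt : (l : ℕ) < d := by have := k.2; omega
        have h3 : ((Finset.univ.filter fun i => q i = 1).card : ℝ) = (d : ℝ) - l := by
          rw [← hl]; rw [eq_sub_iff_add_eq']; exact_mod_cast h2
        have h4 : ((Finset.univ.filter fun i => q i = 1).card : ℂ) *
            ((1 / Real.sqrt (d.choose (l + 1)) : ℝ) : ℂ) =
            ((Real.sqrt (((l : ℝ) + 1) * ((d : ℝ) - (l : ℝ))) : ℝ) : ℂ) * symAmp (l : ℕ) q := by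
          rw [symAmp_eq, if_pos hl, Fintype.card_fin, ← Complex.ofReal_mul,
            ← sqrt_choose_succ hlt, ← h3]
          push_cast
          rfl
        rw [if_pos hk, if_pos hk, h4]
        ring
      · simp [hk]
    · rw [symAmp_eq (l : ℕ), if_neg hl]; simp
  rw [symDeriv_apply, Finset.sum_congr rfl fun q _ => hq q, ← Finset.mul_sum]
  have := congrFun₂ (symMat_mul_transpose (Fintype.card_fin d)) l l
  rw [Matrix.mul_apply] at this
  simp only [Matrix.transpose_apply, symMat, Matrix.one_apply_eq] at this
  rw [this, mul_one]

theorem spin_two_eq_symDeriv (d : ℕ) :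
    (Matrix.diagonal fun k : Fin (d + 1) => (k : ℂ) - (d : ℂ) / 2) =
      symDeriv d ((1 / 2 : ℂ) • pauli 2) := by
  ext k l
  have hq : ∀ q : Fin d → Fin 2, symAmp (l : ℕ) q * ∑ j, ∑ a : Fin 2,
      ((1 / 2 : ℂ) • pauli 2) a (q j) * symAmp (k : ℕ) (Function.update q j a) =
      ((l : ℂ) - (d : ℂ) / 2) * (symAmp (k : ℕ) q * symAmp (l : ℕ) q) := by
    intro q
    by_cases hl : upCount q = l
    · have h1 : ∀ j, ∑ a : Fin 2, ((1 / 2 : ℂ) • pauli 2) a (q j) *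
          symAmp (k : ℕ) (Function.update q j a) =
          ((if q j = 0 then 1 / 2 else 0) + (if q j = 1 then -(1 / 2) else 0)) *
            symAmp (k : ℕ) q := by
        intro j
        rw [Fin.sum_univ_two]
        by_cases hj : q j = 1
        · have : Function.update q j 1 = q := by rw [← hj]; simp
          simp [hj, pauli, this]
        · have hj : q j = 0 := by omega
          have : Function.update q j 0 = q := by rw [← hj]; simp
          simp [hj, pauli, this]
      simp only [h1]
      rw [← Finset.sum_mul, Finset.sum_add_distrib, ← Finset.sum_filter, ← Finset.sum_filter,
        Finset.sum_const, Finset.sum_const, nsmul_eq_mul, nsmul_eq_mul]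
      have h2 : ((Finset.univ.filter fun i => q i = 1).card : ℂ) = (d : ℂ) - l := by
        rw [← hl, eq_sub_iff_add_eq']; exact_mod_cast upCount_add_downCount q
      have h3 : ((Finset.univ.filter fun i => q i = 0).card : ℂ) = l := by
        rw [← hl]; rfl
      rw [h2, h3]; ring
    · rw [symAmp_eq (l : ℕ), if_neg hl]; simp
  rw [symDeriv_apply, Finset.sum_congr rfl fun q _ => hq q, ← Finset.mul_sum]
  have := congrFun₂ (symMat_mul_transpose (Fintype.card_fin d)) k l
  rw [Matrix.mul_apply] at this
  simp only [Matrix.transpose_apply, symMat] at this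
  rw [this, Matrix.one_apply, Matrix.diagonal_apply]
  split_ifs with h
  · rw [h, mul_one]
  · rw [mul_zero]

/-- Links the explicit spin matrices to the legs: each is the sum over the legs of half a Pauli
matrix, compressed. Rotations of the legs can then be applied to spins through
`symRep_mul_symDeriv_mul`. -/
theorem spin_eq_symDeriv (d : ℕ) (i : Fin 3) : spin d i = symDeriv d ((1 / 2 : ℂ) • pauli i) := by
  have hc : (raising d)ᴴ = symDeriv d !![0, 0; 1, 0] := by
    rw [raising_eq_symDeriv, symDeriv_conjTranspose]
    congr 1
    ext a b; fin_cases a <;> fin_cases b <;> simp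
  have e1 : (1 / (2 * Complex.I) : ℂ) = -Complex.I / 2 := by
    field_simp; simp
  fin_cases i
  · simp only [spin, Fin.zero_eta, Matrix.cons_val_zero]
    rw [hc, raising_eq_symDeriv, ← symDeriv_add, ← symDeriv_smul]
    congr 2
    ext a b; fin_cases a <;> fin_cases b <;> simp [pauli]
  · simp only [spin, Fin.mk_one, Matrix.cons_val_one, Matrix.cons_val_zero]
    rw [hc, raising_eq_symDeriv, sub_eq_add_neg, ← neg_one_smul ℂ, ← symDeriv_smul,
      ← symDeriv_add, ← symDeriv_smul]
    congr 1
    rw [e1]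
    ext a b; fin_cases a <;> fin_cases b <;> simp [pauli] <;> ring
  · exact spin_two_eq_symDeriv d


/-! ### The tensor of a node -/

/-- The two physical spins of a node. -/
abbrev NodeCfg (g : ℕ) : Type := Fin (g + 3) × Fin (g + 3)

/-- The tensor of a node: the rung carries a singlet, and the other legs are those of the argument. -/
noncomputable def nodeAmp (g : ℕ) : Matrix (NodeCfg g) (Fin (g + 1) → Pair) ℂ := fun s b =>
  ∑ r : Pair, singlet r.1 r.2 *
    (symAmp (s.1 : ℕ) (Fin.cons r.1 fun i => (b i).1 : Fin (g + 2) → Fin 2) *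
     symAmp (s.2 : ℕ) (Fin.cons r.2 fun i => (b i).2 : Fin (g + 2) → Fin 2))

/-- A singlet in each of the two layers. -/
def pairSinglet : Matrix Pair Pair ℂ := singlet ⊗ₖ singlet

theorem pairSinglet_transpose : pairSingletᵀ = pairSinglet := by
  ext ⟨a, b⟩ ⟨c, d⟩
  fin_cases a <;> fin_cases b <;> fin_cases c <;> fin_cases d <;> simp [pairSinglet, singlet]

theorem pairSinglet_mul_self : pairSinglet * pairSinglet = 1 := by
  have : singlet * singlet = -1 := by
    ext a b; fin_cases a <;> fin_cases b <;> simp [singlet, Matrix.mul_apply]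
  rw [pairSinglet, ← Matrix.mul_kronecker_mul, this, ← neg_one_smul ℂ (1 : Matrix _ _ ℂ),
    Matrix.smul_kronecker, Matrix.kronecker_smul, smul_smul, Matrix.one_kronecker_one]
  simp

/-- The tensor of a node as an operator from all legs but the first to the first leg. -/
noncomputable def nodeSlice {g : ℕ} (s : NodeCfg g) : Matrix Pair (Fin g → Pair) ℂ :=
  fun o b => nodeAmp g s (Fin.cons o b)

theorem nodeOp_eq {g : ℕ} (s : NodeCfg g) : nodeOp g s.1 s.2 = pairSinglet * nodeSlice s := by
  ext out b
  rw [Matrix.mul_apply]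
  simp only [nodeOp, nodeSlice, nodeAmp, pairSinglet, Matrix.kroneckerMap_apply, Finset.mul_sum]
  rw [Finset.sum_comm]
  refine Finset.sum_congr rfl fun o _ => Finset.sum_congr rfl fun r _ => ?_
  have h1 : (fun i : Fin (g + 1) => ((Fin.cons o b : Fin (g + 1) → Pair) i).1) =
      (Fin.cons o.1 fun i => (b i).1 : Fin (g + 1) → Fin 2) := by
    funext i; refine Fin.cases ?_ (fun i => ?_) i <;> simp
  have h2 : (fun i : Fin (g + 1) => ((Fin.cons o b : Fin (g + 1) → Pair) i).2) =
      (Fin.cons o.2 fun i => (b i).2 : Fin (g + 1) → Fin 2) := by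
    funext i; refine Fin.cases ?_ (fun i => ?_) i <;> simp
  rw [h1, h2]
  ring

/-- The contraction of a node with an observable `D` and matrices `Z` on all its legs. -/
noncomputable def nodeFun {g : ℕ} (D : Matrix (NodeCfg g) (NodeCfg g) ℂ)
    (Z : Fin (g + 1) → Matrix Pair Pair ℂ) : ℂ :=
  (nodeAmp g * tensorProd Z * (nodeAmp g)ᴴ * D).trace

/-- The transfer operator of a node with an observable `D`. -/
noncomputable def transferOp {g : ℕ} (D : Matrix (NodeCfg g) (NodeCfg g) ℂ)
    (Z : Fin g → Matrix Pair Pair ℂ) : Matrix Pair Pair ℂ :=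
  ∑ s, ∑ s', D s' s • (nodeOp g s.1 s.2 * tensorProd Z * (nodeOp g s'.1 s'.2)ᴴ)

theorem transferUnnormalized_tensorProd {g : ℕ} (Z : Fin g → Matrix Pair Pair ℂ) :
    transferUnnormalized g (tensorProd Z) = transferOp 1 Z := by
  simp only [transferUnnormalized, transferOp, Matrix.one_apply, ite_smul, one_smul,
    zero_smul, Finset.sum_ite_eq', Finset.mem_univ, if_true]
  rw [Fintype.sum_prod_type]

/-- The bilinear form that joins two legs by a singlet in each layer. -/
noncomputable def pairing (Y X : Matrix Pair Pair ℂ) : ℂ :=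
  (Y * (pairSinglet * Xᵀ * pairSinglet)).trace

theorem pairing_comm (Y X : Matrix Pair Pair ℂ) : pairing Y X = pairing X Y := by
  rw [pairing, ← Matrix.trace_transpose, pairing]
  simp only [Matrix.transpose_mul, Matrix.transpose_transpose, pairSinglet_transpose]
  rw [Matrix.mul_assoc, Matrix.mul_assoc, Matrix.trace_mul_comm]
  simp only [Matrix.mul_assoc]

theorem pairing_smul_right (Y X : Matrix Pair Pair ℂ) (c : ℂ) :
    pairing Y (c • X) = c * pairing Y X := by
  simp [pairing, Matrix.trace_smul]

/-- Nondegeneracy of the pairing. Identities for `transferOp` can thus be proved for the scalar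
`nodeFun`, in which all legs play the same role. -/
theorem eq_of_pairing_eq {X X' : Matrix Pair Pair ℂ} (h : ∀ Y, pairing Y X = pairing Y X') :
    X = X' := by
  have h1 : pairSinglet * Xᵀ * pairSinglet = pairSinglet * X'ᵀ * pairSinglet :=
    Matrix.ext_iff_trace_mul_left.2 h
  have h2 := congrArg (fun M => pairSinglet * M * pairSinglet) h1
  simp only [Matrix.mul_assoc, pairSinglet_mul_self, Matrix.mul_one] at h2
  simp only [← Matrix.mul_assoc, pairSinglet_mul_self, Matrix.one_mul] at h2
  exact Matrix.transpose_injective h2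

theorem sum_comm_four {α β γ δ : Type} [Fintype α] [Fintype β] [Fintype γ] [Fintype δ]
    (f : α → β → γ → δ → ℂ) :
    ∑ a, ∑ b, ∑ c, ∑ d, f a b c d = ∑ c, ∑ d, ∑ a, ∑ b, f a b c d := by
  have h := Finset.sum_comm (s := (Finset.univ : Finset (α × β)))
    (t := (Finset.univ : Finset (γ × δ))) (f := fun x y => f x.1 x.2 y.1 y.2)
  simpa only [Fintype.sum_prod_type] using h

theorem mul_mul_conjTranspose_apply {l m n : Type} [Fintype n] (N : Matrix l n ℂ)
    (N' : Matrix m n ℂ) (Z : Matrix n n ℂ) (s : l) (s' : m) : (N * Z * N'ᴴ) s s' =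
      ∑ b, ∑ b', Z b b' * (N s b * star (N' s' b')) := by
  simp only [Matrix.mul_apply, Finset.sum_mul, Matrix.conjTranspose_apply]
  rw [Finset.sum_comm]
  exact Finset.sum_congr rfl fun b _ => Finset.sum_congr rfl fun b' _ => by ring

theorem trace_mul_eq_sum {m n : Type} [Fintype m] [Fintype n] (A : Matrix m n ℂ)
    (B : Matrix n m ℂ) : (A * B).trace = ∑ s, ∑ s', A s s' * B s' s := rfl

theorem trace_contract {m n : Type} [Fintype m] [Fintype n] (N N' : Matrix m n ℂ)
    (Z : Matrix n n ℂ) (D : Matrix m m ℂ) : (N * Z * N'ᴴ * D).trace =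
      ∑ b, ∑ b', Z b b' * ∑ s, ∑ s', D s' s * (N s b * star (N' s' b')) := by
  rw [trace_mul_eq_sum]
  simp only [mul_mul_conjTranspose_apply, Finset.sum_mul, Finset.mul_sum]
  rw [sum_comm_four]
  refine Finset.sum_congr rfl fun b _ => Finset.sum_congr rfl fun b' _ =>
    Finset.sum_congr rfl fun s _ => Finset.sum_congr rfl fun s' _ => by ring

theorem sum_fin_cons {n : ℕ} {α : Type} [Fintype α] (f : (Fin (n + 1) → α) → ℂ) :
    ∑ b, f b = ∑ o, ∑ b : Fin n → α, f (Fin.cons o b) := by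
  rw [← Fintype.sum_prod_type']
  exact (Fintype.sum_equiv (Fin.consEquiv fun _ => α) _ _ fun x => rfl).symm

/-- The transfer operator is the full contraction of a node with one leg left open. This singles out
a leg of an object that is symmetric in all its legs, which is the source of the later adjointness
relations. -/
theorem nodeFun_cons {g : ℕ} (D : Matrix (NodeCfg g) (NodeCfg g) ℂ) (Y : Matrix Pair Pair ℂ)
    (Z : Fin g → Matrix Pair Pair ℂ) :
    nodeFun D (Fin.cons Y Z : Fin (g + 1) → Matrix Pair Pair ℂ) = pairing Y (transferOp D Z) := by
  have h1 : transferOp D Z = pairSinglet *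
      (∑ s, ∑ s', D s' s • (nodeSlice s * tensorProd Z * (nodeSlice s')ᴴ)) * pairSinglet := by
    have h : pairSingletᴴ = pairSinglet := by
      ext ⟨a, b⟩ ⟨c, d⟩
      fin_cases a <;> fin_cases b <;> fin_cases c <;> fin_cases d <;> simp [pairSinglet, singlet]
    simp only [transferOp, nodeOp_eq, Matrix.conjTranspose_mul, h, Finset.mul_sum, Finset.sum_mul,
      Matrix.mul_smul, Matrix.smul_mul, Matrix.mul_assoc]
  -- The singlets that `nodeOp` puts on the outgoing legs cancel against those in the pairing.
  have h2 : ∀ T : Matrix Pair Pair ℂ, pairSinglet * (pairSinglet * T * pairSinglet)ᵀ * pairSinglet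
      = Tᵀ := by
    intro T
    rw [Matrix.transpose_mul, Matrix.transpose_mul, pairSinglet_transpose]
    simp only [Matrix.mul_assoc, pairSinglet_mul_self, Matrix.mul_one]
    rw [← Matrix.mul_assoc, pairSinglet_mul_self, Matrix.one_mul]
  rw [pairing, h1, h2, nodeFun, trace_contract, sum_fin_cons]
  simp only [sum_fin_cons (n := g)]
  rw [trace_mul_eq_sum]
  simp only [Matrix.transpose_apply, Matrix.sum_apply, Matrix.smul_apply, smul_eq_mul,
    mul_mul_conjTranspose_apply]
  refine Finset.sum_congr rfl fun o _ => ?_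
  rw [Finset.sum_comm]
  refine Finset.sum_congr rfl fun o' _ => ?_
  simp only [tensorProd_apply, Fin.prod_univ_succ, Fin.cons_zero, Fin.cons_succ, mul_assoc,
    ← Finset.mul_sum]
  congr 1
  simp only [Finset.mul_sum]
  rw [sum_comm_four]
  refine Finset.sum_congr rfl fun s _ => Finset.sum_congr rfl fun s' _ =>
    Finset.sum_congr rfl fun b _ => Finset.sum_congr rfl fun b' _ => ?_
  simp only [nodeSlice]
  ring

/-! ### Symmetries of a node -/

theorem upCount_cons {n : ℕ} (a : Fin 2) (f : Fin n → Fin 2) :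
    upCount (Fin.cons a f : Fin (n + 1) → Fin 2) = (if a = 0 then 1 else 0) + upCount f := by
  unfold upCount
  simp only [Finset.card_filter]
  rw [Fin.sum_univ_succ]
  simp

theorem symAmp_congr {ι : Type} [Fintype ι] (k : ℕ) {q q' : ι → Fin 2}
    (h : upCount q = upCount q') : symAmp k q = symAmp k q' := by
  rw [symAmp_eq, symAmp_eq, h]

theorem nodeAmp_comp {g : ℕ} (s : NodeCfg g) (b : Fin (g + 1) → Pair)
    (e : Equiv.Perm (Fin (g + 1))) : nodeAmp g s (fun i => b (e i)) = nodeAmp g s b := by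
  refine Finset.sum_congr rfl fun r _ => ?_
  congr 2
  · refine symAmp_congr _ ?_
    rw [upCount_cons, upCount_cons, upCount_comp (fun i => (b i).1) e]
  · refine symAmp_congr _ ?_
    rw [upCount_cons, upCount_cons, upCount_comp (fun i => (b i).2) e]

theorem nodeFun_comp {g : ℕ} (D : Matrix (NodeCfg g) (NodeCfg g) ℂ)
    (Z : Fin (g + 1) → Matrix Pair Pair ℂ) (e : Equiv.Perm (Fin (g + 1))) :
    nodeFun D (fun i => Z (e i)) = nodeFun D Z := by
  rw [nodeFun, nodeFun, trace_contract, trace_contract]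
  let E : (Fin (g + 1) → Pair) ≃ (Fin (g + 1) → Pair) := e.symm.arrowCongr (Equiv.refl Pair)
  have hE : ∀ b, E b = fun i => b (e i) := fun b => by funext i; simp [E, Equiv.arrowCongr]
  rw [← Equiv.sum_comp E]
  refine Finset.sum_congr rfl fun b _ => ?_
  rw [← Equiv.sum_comp E]
  refine Finset.sum_congr rfl fun b' _ => ?_
  simp only [hE, nodeAmp_comp]
  congr 1
  exact Fintype.prod_equiv e _ _ fun i => rfl

/-- The sign is that of the rung singlet. It appears twice in `nodeFun`, where it drops out, so
second-layer expectations reduce to first-layer ones. -/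
theorem nodeAmp_swap {g : ℕ} (s : NodeCfg g) (b : Fin (g + 1) → Pair) :
    nodeAmp g s.swap (fun i => (b i).swap) = -nodeAmp g s b := by
  simp only [nodeAmp, ← Finset.sum_neg_distrib]
  rw [← Equiv.sum_comp (Equiv.prodComm (Fin 2) (Fin 2))]
  refine Finset.sum_congr rfl fun r _ => ?_
  have : singlet r.2 r.1 = -singlet r.1 r.2 := by
    obtain ⟨a, b⟩ := r
    fin_cases a <;> fin_cases b <;> simp [singlet]
  simp only [Equiv.prodComm_apply, Prod.fst_swap, Prod.snd_swap, this]
  ring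

theorem nodeFun_swap {g : ℕ} (D : Matrix (NodeCfg g) (NodeCfg g) ℂ)
    (Z : Fin (g + 1) → Matrix Pair Pair ℂ) :
    nodeFun D (fun i => (Z i).submatrix Prod.swap Prod.swap) =
      nodeFun (D.submatrix Prod.swap Prod.swap) Z := by
  rw [nodeFun, nodeFun, trace_contract, trace_contract]
  let E : (Fin (g + 1) → Pair) ≃ (Fin (g + 1) → Pair) :=
    (Equiv.refl _).arrowCongr (Equiv.prodComm (Fin 2) (Fin 2))
  have hE : ∀ b, E b = fun i => (b i).swap := fun b => by funext i; simp [E, Equiv.arrowCongr]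
  rw [← Equiv.sum_comp E]
  refine Finset.sum_congr rfl fun b _ => ?_
  rw [← Equiv.sum_comp E]
  refine Finset.sum_congr rfl fun b' _ => ?_
  congr 1
  · rw [← Equiv.sum_comp (Equiv.prodComm _ _)]
    refine Finset.sum_congr rfl fun s _ => ?_
    rw [← Equiv.sum_comp (Equiv.prodComm _ _)]
    refine Finset.sum_congr rfl fun s' _ => ?_
    simp [hE, nodeAmp_swap]

/-- The representation of a matrix on the two spins of a node. -/
noncomputable def nodeRep (g : ℕ) (U : Matrix (Fin 2) (Fin 2) ℂ) :
    Matrix (NodeCfg g) (NodeCfg g) ℂ := symRep (g + 2) U ⊗ₖ symRep (g + 2) U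

/-- The action of a matrix on both spins of a pair. -/
def pairMat (U : Matrix (Fin 2) (Fin 2) ℂ) : Matrix Pair Pair ℂ := U ⊗ₖ U

/-- Acting on the dangling legs amounts to acting on all legs, since the rung singlet is invariant
under `U`; and on all legs of a site, `U` passes through the symmetrization to the physical spin. -/
theorem nodeAmp_mul_tensorProd {g : ℕ} {U : Matrix (Fin 2) (Fin 2) ℂ}
    (hU : U * singlet * Uᵀ = singlet) :
    nodeAmp g * tensorProd (ι := Fin (g + 1)) (fun _ => pairMat U) = nodeRep g U * nodeAmp g := by
  have key : ∀ (k : Fin (g + 3)) (t : Fin 2) (c : Fin (g + 1) → Fin 2),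
      ∑ r, ∑ b : Fin (g + 1) → Fin 2, symAmp (k : ℕ) (Fin.cons r b : Fin (g + 2) → Fin 2) *
        (U r t * ∏ i, U (b i) (c i)) =
      ∑ l, symRep (g + 2) U k l * symAmp (l : ℕ) (Fin.cons t c : Fin (g + 2) → Fin 2) := by
    intro k t c
    have h := congrFun₂ (symMat_mul_tensorProd (Fintype.card_fin (g + 2)) U) k
      (Fin.cons t c : Fin (g + 2) → Fin 2)
    rw [Matrix.mul_apply, Matrix.mul_apply, sum_fin_cons] at h
    simpa only [symRep, symMat, tensorProd, Fin.prod_univ_succ, Fin.cons_zero, Fin.cons_succ] using h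
  have hS : ∀ r : Pair, singlet r.1 r.2 = ∑ t : Pair, singlet t.1 t.2 * (U r.1 t.1 * U r.2 t.2) := by
    intro r
    conv_lhs => rw [← hU]
    rw [Matrix.mul_apply, Fintype.sum_prod_type_right]
    refine Finset.sum_congr rfl fun t _ => ?_
    rw [Matrix.mul_apply, Finset.sum_mul]
    refine Finset.sum_congr rfl fun t' _ => ?_
    rw [Matrix.transpose_apply]; ring
  ext s c
  rw [Matrix.mul_apply, Matrix.mul_apply]
  have hR : ∑ s', nodeRep g U s s' * nodeAmp g s' c = ∑ t : Pair, singlet t.1 t.2 *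
      ((∑ l, symRep (g + 2) U s.1 l *
          symAmp (l : ℕ) (Fin.cons t.1 fun i => (c i).1 : Fin (g + 2) → Fin 2)) *
       (∑ l, symRep (g + 2) U s.2 l *
          symAmp (l : ℕ) (Fin.cons t.2 fun i => (c i).2 : Fin (g + 2) → Fin 2))) := by
    simp only [nodeAmp, Finset.mul_sum]
    rw [Finset.sum_comm]
    refine Finset.sum_congr rfl fun t _ => ?_
    rw [Fintype.sum_prod_type_right]
    simp only [Finset.mul_sum, Finset.sum_mul]
    refine Finset.sum_congr rfl fun k _ => Finset.sum_congr rfl fun l _ => ?_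
    simp only [nodeRep, Matrix.kroneckerMap_apply]
    ring
  rw [hR]
  simp only [← key]
  rw [← Equiv.sum_comp (Equiv.arrowProdEquivProdArrow (Fin (g + 1)) (fun _ => Fin 2)
    (fun _ => Fin 2)).symm, Fintype.sum_prod_type]
  simp only [Equiv.arrowProdEquivProdArrow_symm_apply, nodeAmp, tensorProd, pairMat,
    Matrix.kroneckerMap_apply, Finset.prod_mul_distrib]
  -- Brings the product of the two single-layer sums into the order of summation of the node
  -- contraction.
  have hflat : ∀ (F G : Fin 2 → (Fin (g + 1) → Fin 2) → ℂ) (z : ℂ),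
      z * ((∑ r, ∑ b, F r b) * ∑ r, ∑ b, G r b) =
        ∑ b, ∑ b', ∑ r, ∑ r', z * (F r b * G r' b') := by
    intro F G z
    rw [Finset.sum_comm (f := F), Finset.sum_comm (f := G), Finset.sum_mul_sum, Finset.mul_sum]
    refine Finset.sum_congr rfl fun b _ => ?_
    rw [Finset.mul_sum]
    refine Finset.sum_congr rfl fun b' _ => ?_
    rw [Finset.sum_mul_sum, Finset.mul_sum]
    exact Finset.sum_congr rfl fun r _ => Finset.mul_sum _ _ _
  simp only [hflat]
  conv_rhs => rw [Finset.sum_comm]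
  refine Finset.sum_congr rfl fun b _ => ?_
  conv_rhs => rw [Finset.sum_comm]
  refine Finset.sum_congr rfl fun b' _ => ?_
  rw [Fintype.sum_prod_type, Finset.sum_mul]
  conv_rhs => rw [Finset.sum_comm]
  refine Finset.sum_congr rfl fun r _ => ?_
  rw [Finset.sum_mul]
  conv_rhs => rw [Finset.sum_comm]
  refine Finset.sum_congr rfl fun r' _ => ?_
  have hS' := hS (r, r')
  simp only at hS'
  rw [hS', Finset.sum_mul, Finset.sum_mul]
  refine Finset.sum_congr rfl fun t _ => ?_
  ring

theorem nodeFun_conj {g : ℕ} {U : Matrix (Fin 2) (Fin 2) ℂ} (hU : U * singlet * Uᵀ = singlet)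
    (D : Matrix (NodeCfg g) (NodeCfg g) ℂ) (Z : Fin (g + 1) → Matrix Pair Pair ℂ) :
    nodeFun D (fun i => pairMat U * Z i * (pairMat U)ᴴ) =
      nodeFun ((nodeRep g U)ᴴ * D * nodeRep g U) Z := by
  have h : tensorProd (fun i => pairMat U * Z i * (pairMat U)ᴴ) =
      tensorProd (ι := Fin (g + 1)) (fun _ => pairMat U) * tensorProd Z *
        (tensorProd (ι := Fin (g + 1)) (fun _ => pairMat U))ᴴ := by
    rw [tensorProd_conjTranspose, tensorProd_mul, tensorProd_mul]
  rw [nodeFun, nodeFun, h]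
  have h2 : nodeAmp g * (tensorProd (ι := Fin (g + 1)) (fun _ => pairMat U) * tensorProd Z *
        (tensorProd (ι := Fin (g + 1)) (fun _ => pairMat U))ᴴ) * (nodeAmp g)ᴴ * D =
      nodeRep g U * (nodeAmp g * tensorProd Z * (nodeAmp g)ᴴ * ((nodeRep g U)ᴴ * D)) := by
    have h3 := congrArg Matrix.conjTranspose (nodeAmp_mul_tensorProd (g := g) hU)
    rw [Matrix.conjTranspose_mul, Matrix.conjTranspose_mul] at h3
    calc _ = (nodeAmp g * tensorProd (ι := Fin (g + 1)) (fun _ => pairMat U)) * tensorProd Z *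
        ((tensorProd (ι := Fin (g + 1)) (fun _ => pairMat U))ᴴ * (nodeAmp g)ᴴ) * D := by
          simp only [Matrix.mul_assoc]
      _ = _ := by rw [h3, nodeAmp_mul_tensorProd hU]; simp only [Matrix.mul_assoc]
  rw [h2, Matrix.trace_mul_comm]
  simp only [Matrix.mul_assoc]

theorem pairMat_mul (U V : Matrix (Fin 2) (Fin 2) ℂ) : pairMat U * pairMat V = pairMat (U * V) :=
  (Matrix.mul_kronecker_mul _ _ _ _).symm

theorem pairMat_conjTranspose (U : Matrix (Fin 2) (Fin 2) ℂ) : (pairMat U)ᴴ = pairMat Uᴴ :=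
  Matrix.conjTranspose_kronecker _ _

theorem pairMat_one : pairMat 1 = 1 := Matrix.one_kronecker_one

theorem pairMat_transpose (U : Matrix (Fin 2) (Fin 2) ℂ) : (pairMat U)ᵀ = pairMat Uᵀ := rfl

theorem nodeRep_conjTranspose_mul (g : ℕ) {U : Matrix (Fin 2) (Fin 2) ℂ} (hU : Uᴴ * U = 1) :
    (nodeRep g U)ᴴ * nodeRep g U = 1 := by
  rw [nodeRep, Matrix.conjTranspose_kronecker, ← Matrix.mul_kronecker_mul, symRep_conjTranspose,
    symRep_mul, hU, symRep_one, Matrix.one_kronecker_one]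

/-- Without an observable, the rotation of the physical spins cancels by unitarity. Rotating the
ingoing legs is then undone by rotating the remaining leg the other way, which the pairing moves to
the output. -/
theorem transferOp_one_conj {g : ℕ} {U : Matrix (Fin 2) (Fin 2) ℂ}
    (hU : U * singlet * Uᵀ = singlet) (hU' : Uᴴ * U = 1) (Z : Fin g → Matrix Pair Pair ℂ) :
    transferOp 1 (fun i => pairMat U * Z i * (pairMat U)ᴴ) =
      pairMat U * transferOp 1 Z * (pairMat U)ᴴ := by
  have hU'' : U * Uᴴ = 1 := mul_eq_one_comm.1 hU'
  have hp : pairMat U * (pairMat U)ᴴ = 1 := by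
    rw [pairMat_conjTranspose, pairMat_mul, hU'', pairMat_one]
  have hS : pairMat U * pairSinglet * (pairMat U)ᵀ = pairSinglet := by
    rw [pairMat_transpose, pairMat, pairMat, pairSinglet, ← Matrix.mul_kronecker_mul,
      ← Matrix.mul_kronecker_mul, hU]
  have hS' : pairSinglet * (pairMat U)ᵀ = (pairMat U)ᴴ * pairSinglet := by
    have hp' : (pairMat U)ᴴ * pairMat U = 1 := mul_eq_one_comm.1 hp
    calc _ = (pairMat U)ᴴ * pairMat U * (pairSinglet * (pairMat U)ᵀ) := by rw [hp', Matrix.one_mul]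
      _ = (pairMat U)ᴴ * (pairMat U * pairSinglet * (pairMat U)ᵀ) := by
        simp only [Matrix.mul_assoc]
      _ = _ := by rw [hS]
  have h1 : (pairMat U)ᵀ * pairSinglet = pairSinglet * (pairMat U)ᴴ := by
    calc _ = pairSinglet * (pairSinglet * (pairMat U)ᵀ) * pairSinglet := by
          rw [← Matrix.mul_assoc pairSinglet, pairSinglet_mul_self, Matrix.one_mul]
      _ = _ := by
          rw [hS', Matrix.mul_assoc, Matrix.mul_assoc, pairSinglet_mul_self, Matrix.mul_one]
  have h2 : pairSinglet * ((pairMat U)ᴴ)ᵀ = pairMat U * pairSinglet := by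
    have h3 := congrArg Matrix.transpose hS'
    simpa only [Matrix.transpose_mul, Matrix.transpose_transpose, pairSinglet_transpose]
      using h3.symm
  refine eq_of_pairing_eq fun Y => ?_
  rw [← nodeFun_cons]
  have h : (Fin.cons Y fun i => pairMat U * Z i * (pairMat U)ᴴ : Fin (g + 1) → Matrix Pair Pair ℂ) =
      fun i => pairMat U * (Fin.cons ((pairMat U)ᴴ * Y * pairMat U) Z :
        Fin (g + 1) → Matrix Pair Pair ℂ) i * (pairMat U)ᴴ := by
    funext i
    refine Fin.cases ?_ (fun i => ?_) i
    · simp only [Fin.cons_zero]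
      calc Y = (pairMat U * (pairMat U)ᴴ) * Y * (pairMat U * (pairMat U)ᴴ) := by
            rw [hp, Matrix.one_mul, Matrix.mul_one]
        _ = _ := by simp only [Matrix.mul_assoc]
    · simp only [Fin.cons_succ]
  rw [h, nodeFun_conj hU, Matrix.mul_one, nodeRep_conjTranspose_mul g hU', nodeFun_cons, pairing,
    pairing]
  simp only [Matrix.transpose_mul]
  calc _ = ((pairMat U)ᴴ * (Y * (pairMat U * pairSinglet * (transferOp 1 Z)ᵀ * pairSinglet))).trace := by
        simp only [Matrix.mul_assoc]
    _ = (Y * (pairMat U * pairSinglet * (transferOp 1 Z)ᵀ * (pairSinglet * (pairMat U)ᴴ))).trace := by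
        rw [Matrix.trace_mul_comm]; simp only [Matrix.mul_assoc]
    _ = _ := by
        rw [← h1, ← h2]; simp only [Matrix.mul_assoc]

theorem nodeFun_smul_add {g : ℕ} (a b : ℂ) (D D' : Matrix (NodeCfg g) (NodeCfg g) ℂ)
    (Z : Fin (g + 1) → Matrix Pair Pair ℂ) :
    nodeFun (a • D + b • D') Z = a * nodeFun D Z + b * nodeFun D' Z := by
  simp [nodeFun, Matrix.mul_add, Matrix.trace_add, Matrix.trace_smul]


/-! ### The geometry of the tree -/

theorem Word.length_parent {g : ℕ} (w : Word g) : w.parent.length = w.length - 1 := by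
  simp [Word.length, Word.parent]

/-- The neighbours of a vertex that are not its parent. -/
def Word.child {g : ℕ} (w : Word g) (i : Fin g) : Word g :=
  -- At the root the default letter `0` leaves out the neighbour of colour `0`. Children enter the
  -- contraction only for boundary vertices, which have positive length; the root is treated
  -- separately.
  ⟨(w.1.headD 0).succAbove i :: w.1, by
    rw [List.isChain_cons]
    refine ⟨fun y hy => ?_, w.2⟩
    obtain ⟨l, hl⟩ := w
    cases l with
    | nil => simp at hy
    | cons a l =>
      simp only [List.head?_cons, Option.mem_def, Option.some.injEq] at hy
      subst hy
      simp⟩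

theorem Word.length_child {g : ℕ} (w : Word g) (i : Fin g) : (w.child i).length = w.length + 1 := rfl

theorem Word.parent_child {g : ℕ} (w : Word g) (i : Fin g) : (w.child i).parent = w := rfl

theorem Word.head?_child {g : ℕ} (w : Word g) (i : Fin g) :
    (w.child i).1.head? = some ((w.1.headD 0).succAbove i) := rfl

theorem Word.head?_eq {g : ℕ} {w : Word g} (h : w.length ≠ 0) : w.1.head? = some (w.1.headD 0) := by
  obtain ⟨l, hl⟩ := w
  cases l with
  | nil => exact absurd rfl h
  | cons a l => rfl

theorem mem_volume {g n : ℕ} {v : Site g} : v ∈ volume g n ↔ v.1.length ≤ n := by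
  simp [volume, mem_ball]

theorem volume_subset {g m n : ℕ} (h : m ≤ n) : volume g m ⊆ volume g n := fun _ hv =>
  mem_volume.2 ((mem_volume.1 hv).trans h)

theorem Boundary.length_eq {g n : ℕ} (w : Boundary g n) : w.1.length = n + 1 := mem_sphere.1 w.2

/-- The vertices of the boundary of `T_{n + 1}` next to a vertex of the boundary of `T_n`. -/
def Boundary.child {g n : ℕ} (w : Boundary g n) (i : Fin g) : Boundary g (n + 1) :=
  ⟨w.1.child i, mem_sphere.2 (by rw [Word.length_child, w.length_eq])⟩

theorem Boundary.child_bijective (g n : ℕ) :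
    Function.Bijective fun x : Boundary g n × Fin g => x.1.child x.2 := by
  constructor
  · rintro ⟨⟨⟨w, hw⟩, h⟩, i⟩ ⟨⟨⟨w', hw'⟩, h'⟩, i'⟩ heq
    simp only [Boundary.child, Word.child, Subtype.mk.injEq, List.cons.injEq] at heq
    obtain ⟨h1, rfl⟩ := heq
    rw [Fin.succAbove_right_injective.eq_iff] at h1
    rw [h1]
  · rintro ⟨⟨w, hw⟩, h⟩
    have hl : w.length = n + 1 + 1 := mem_sphere.1 h
    match w, hw, hl with
    | c :: a :: l, hw, hl =>
      have hca : c ≠ a := by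
        rw [List.isChain_cons_cons] at hw; exact hw.1
      obtain ⟨i, hi⟩ := Fin.exists_succAbove_eq hca
      refine ⟨⟨⟨⟨a :: l, hw.tail⟩, mem_sphere.2 (by simpa [Word.length] using hl)⟩, i⟩, ?_⟩
      simp [Boundary.child, Word.child, hi]

noncomputable def Boundary.childEquiv (g n : ℕ) : Boundary g n × Fin g ≃ Boundary g (n + 1) :=
  Equiv.ofBijective _ (Boundary.child_bijective g n)

/-- The vertices next to the root. -/
def Boundary.ofLetter {g : ℕ} (c : Fin (g + 1)) : Boundary g 0 :=
  ⟨⟨[c], by simp⟩, mem_sphere.2 rfl⟩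

theorem Boundary.ofLetter_bijective (g : ℕ) :
    Function.Bijective (Boundary.ofLetter : Fin (g + 1) → Boundary g 0) := by
  constructor
  · intro c c' h
    simpa [Boundary.ofLetter] using h
  · rintro ⟨⟨w, hw⟩, h⟩
    have hl : w.length = 1 := mem_sphere.1 h
    obtain ⟨c, rfl⟩ := List.length_eq_one_iff.1 hl
    exact ⟨c, rfl⟩

noncomputable def Boundary.letterEquiv (g : ℕ) : Fin (g + 1) ≃ Boundary g 0 :=
  Equiv.ofBijective _ (Boundary.ofLetter_bijective g)

/-! ### Decomposition of `T_{n+1}` into `T_n` and the outermost nodes -/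

/-- The configuration of the `n + 1`-layer tree composed of one of the `n`-layer tree and one of the
outermost nodes. -/
def glue {g n : ℕ} {X : Type} (q : volume g n → X) (p : Boundary g n → X × X) :
    volume g (n + 1) → X := fun v =>
  if h : (v : Site g) ∈ volume g n then q ⟨v, h⟩ else
    (fun x : X × X => bif v.1.2 then x.2 else x.1) (p ⟨v.1.1, mem_sphere.2 (by
      have h1 := mem_volume.1 v.2
      have h2 := mt mem_volume.2 h
      omega)⟩)

theorem glue_inner {g n : ℕ} {X : Type} (q : volume g n → X) (p : Boundary g n → X × X)
    {v : Site g} (hv : v ∈ volume g n) (hv' : v ∈ volume g (n + 1)) :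
    glue q p ⟨v, hv'⟩ = q ⟨v, hv⟩ := by
  simp [glue, hv]

theorem outer_mem {g n : ℕ} (w : Boundary g n) (l : Bool) :
    ((w : Word g), l) ∈ volume g (n + 1) := mem_volume.2 w.length_eq.le

theorem outer_notMem {g n : ℕ} (w : Boundary g n) (l : Bool) :
    ((w : Word g), l) ∉ volume g n := fun h => by
  have h1 := mem_volume.1 h
  have h2 := w.length_eq
  simp only at h1
  omega

theorem glue_outer {g n : ℕ} {X : Type} (q : volume g n → X) (p : Boundary g n → X × X)
    (w : Boundary g n) (l : Bool) (h : ((w : Word g), l) ∈ volume g (n + 1)) :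
    glue q p ⟨(w, l), h⟩ = bif l then (p w).2 else (p w).1 := by
  simp [glue, outer_notMem w l]

/-- The configurations of the `n + 1`-layer tree. -/
def glueEquiv (g n : ℕ) (X : Type) :
    (volume g n → X) × (Boundary g n → X × X) ≃ (volume g (n + 1) → X) where
  toFun x := glue x.1 x.2
  invFun f := (fun v => f ⟨v, volume_subset n.le_succ v.2⟩,
    fun w => (f ⟨(w, false), outer_mem w _⟩, f ⟨(w, true), outer_mem w _⟩))
  left_inv := by
    rintro ⟨q, p⟩
    refine Prod.ext (funext fun v => glue_inner q p v.2 _) (funext fun w => ?_)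
    simp only [glue_outer]
    rfl
  right_inv := by
    intro f
    funext ⟨⟨w, l⟩, hv⟩
    by_cases h : (w, l) ∈ volume g n
    · exact glue_inner _ _ h hv
    · have hw : w ∈ sphere g (n + 1) := mem_sphere.2 (by
        have h1 := mem_volume.1 hv
        have h2 := mt mem_volume.2 h
        simp only at h1 h2
        omega)
      refine (glue_outer _ _ ⟨w, hw⟩ l hv).trans ?_
      cases l <;> rfl

theorem sum_glue {g n : ℕ} {X : Type} [Fintype X] (f : (volume g (n + 1) → X) → ℂ) :
    ∑ q, f q = ∑ q, ∑ p, f (glue q p) := by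
  rw [← Fintype.sum_prod_type']
  exact (Equiv.sum_comp (glueEquiv g n X) f).symm

theorem volume_succ_bijective (g n : ℕ) : Function.Bijective
    (Sum.elim (fun v => ⟨v, volume_subset n.le_succ v.2⟩) fun x => ⟨(x.1, x.2), outer_mem x.1 x.2⟩ :
      volume g n ⊕ Boundary g n × Bool → volume g (n + 1)) := by
  constructor
  · rintro (⟨v, hv⟩ | ⟨w, l⟩) (⟨v', hv'⟩ | ⟨w', l'⟩) h
    · simp only [Sum.elim_inl, Subtype.mk.injEq] at h
      subst h; rfl
    · simp only [Sum.elim_inl, Sum.elim_inr, Subtype.mk.injEq] at h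
      subst h; exact absurd hv (outer_notMem w' l')
    · simp only [Sum.elim_inl, Sum.elim_inr, Subtype.mk.injEq] at h
      subst h; exact absurd hv' (outer_notMem w l)
    · simp only [Sum.elim_inr, Subtype.mk.injEq, Prod.mk.injEq] at h
      obtain ⟨h1, rfl⟩ := h
      rw [Subtype.ext h1]
  · rintro ⟨⟨w, l⟩, hv⟩
    by_cases h : (w, l) ∈ volume g n
    · exact ⟨Sum.inl ⟨(w, l), h⟩, rfl⟩
    · have hw : w ∈ sphere g (n + 1) := mem_sphere.2 (by
        have h1 := mem_volume.1 hv
        have h2 := mt mem_volume.2 h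
        simp only at h1 h2
        omega)
      exact ⟨Sum.inr (⟨w, hw⟩, l), rfl⟩

theorem prod_volume_succ {g n : ℕ} (f : volume g (n + 1) → ℂ) :
    ∏ v, f v = (∏ v : volume g n, f ⟨v, volume_subset n.le_succ v.2⟩) *
      ∏ w : Boundary g n, (f ⟨(w, false), outer_mem w _⟩ * f ⟨(w, true), outer_mem w _⟩) := by
  rw [← (volume_succ_bijective g n).prod_comp, Fintype.prod_sum_type, Fintype.prod_prod_type]
  congr 1
  refine Finset.prod_congr rfl fun w _ => ?_
  rw [Fintype.prod_bool, mul_comm]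
  rfl

theorem prod_ball_succ {g n : ℕ} (f : Word g → ℂ) :
    ∏ w ∈ ball g (n + 1), f w = (∏ w ∈ ball g n, f w) * ∏ w : Boundary g n, f w := by
  have h : ball g (n + 1) = (ball g n).disjUnion (sphere g (n + 1)) (by
      rw [Finset.disjoint_left]
      intro w h1 h2
      rw [mem_ball] at h1; rw [mem_sphere] at h2; omega) := by
    ext w
    rw [Finset.mem_disjUnion, mem_ball, mem_ball, mem_sphere]; omega
  rw [h, Finset.prod_disjUnion, Finset.prod_coe_sort]


/-! ### The recursion of the valence-bond map -/

/-- The legs of the sites of `T_n`, extended by an arbitrary value. -/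
def extLegs {g n : ℕ} (q : volume g n → Leg g → Fin 2) : Site g → Leg g → Fin 2 := fun v =>
  if h : v ∈ volume g n then q ⟨v, h⟩ else 0

theorem extLegs_glue_inner {g n : ℕ} (q : volume g n → Leg g → Fin 2)
    (p : Boundary g n → (Leg g → Fin 2) × (Leg g → Fin 2)) {v : Site g} (hv : v.1.length ≤ n) :
    extLegs (glue q p) v = extLegs q v := by
  have h : v ∈ volume g n := mem_volume.2 hv
  rw [extLegs, extLegs, dif_pos h, dif_pos (volume_subset n.le_succ h), glue_inner]

theorem extLegs_glue_outer {g n : ℕ} (q : volume g n → Leg g → Fin 2)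
    (p : Boundary g n → (Leg g → Fin 2) × (Leg g → Fin 2)) (w : Boundary g n) (l : Bool) :
    extLegs (glue q p) (w, l) = bif l then (p w).2 else (p w).1 := by
  rw [extLegs, dif_pos (outer_mem w l), glue_outer]

/-- The factor of the legs inside `T_n` in the valence-bond map. -/
noncomputable def bulkFactor {g n : ℕ} (s : Cfg (volume g n)) (q : volume g n → Leg g → Fin 2) : ℂ :=
  (∏ v, symAmp (s v : ℕ) (q v)) *
    (∏ w ∈ ball g n, singlet (extLegs q (w, false) none) (extLegs q (w, true) none)) *
    (∏ w ∈ ball g n with w.length ≠ 0, ∏ layer : Bool,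
      singlet (extLegs q (w.parent, layer) w.1.head?) (extLegs q (w, layer) w.1.head?))

/-- The values of the dangling legs of `T_n`. -/
def dangling {g n : ℕ} (q : volume g n → Leg g → Fin 2) (w : Boundary g n) : Pair :=
  (extLegs q (w.1.parent, false) w.1.1.head?, extLegs q (w.1.parent, true) w.1.1.head?)

theorem vbsMap_eq {g n : ℕ} (s : Cfg (volume g n)) (b : Boundary g n → Pair) :
    vbsMap g n s b = ∑ q, bulkFactor s q * if dangling q = b then 1 else 0 := by
  simp only [funext_iff]
  rfl

/-- The factor of the legs of an outermost node. -/
noncomputable def nodeFactor {g : ℕ} (w : Word g) (s : NodeCfg g) (c : Pair)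
    (p : (Leg g → Fin 2) × (Leg g → Fin 2)) : ℂ :=
  (symAmp (s.1 : ℕ) p.1 * symAmp (s.2 : ℕ) p.2) * singlet (p.1 none) (p.2 none) *
    (singlet c.1 (p.1 w.1.head?) * singlet c.2 (p.2 w.1.head?))

/-- The tree structure enters here: an outermost node is joined to the rest only through its own
pair of dangling legs of `T_n`, so the new factors form a product over the outermost nodes. -/
theorem bulkFactor_glue {g n : ℕ} (s : Cfg (volume g n)) (t : Boundary g n → NodeCfg g)
    (q : volume g n → Leg g → Fin 2) (p : Boundary g n → (Leg g → Fin 2) × (Leg g → Fin 2)) :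
    bulkFactor (glue s t) (glue q p) =
      bulkFactor s q * ∏ w, nodeFactor w.1 (t w) (dangling q w) (p w) := by
  have h1 : ∏ v, symAmp ((glue s t v : Fin (g + 3)) : ℕ) (glue q p v) = (∏ v, symAmp (s v : ℕ) (q v)) *
      ∏ w, (symAmp ((t w).1 : ℕ) (p w).1 * symAmp ((t w).2 : ℕ) (p w).2) := by
    rw [prod_volume_succ]
    refine congrArg₂ (· * ·) (Finset.prod_congr rfl fun v _ => ?_)
      (Finset.prod_congr rfl fun w _ => ?_)
    · rw [glue_inner s t v.2, glue_inner q p v.2]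
    · rw [glue_outer, glue_outer, glue_outer, glue_outer, cond_false, cond_false, cond_true,
        cond_true]
  have h2 : ∏ w ∈ ball g (n + 1), singlet (extLegs (glue q p) (w, false) none)
        (extLegs (glue q p) (w, true) none) =
      (∏ w ∈ ball g n, singlet (extLegs q (w, false) none) (extLegs q (w, true) none)) *
        ∏ w, singlet ((p w).1 none) ((p w).2 none) := by
    rw [prod_ball_succ]
    refine congrArg₂ (· * ·) (Finset.prod_congr rfl fun w hw => ?_)
      (Finset.prod_congr rfl fun w _ => ?_)
    · rw [extLegs_glue_inner _ _ (mem_ball.1 hw), extLegs_glue_inner _ _ (mem_ball.1 hw)]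
    · rw [extLegs_glue_outer, extLegs_glue_outer, cond_false, cond_true]
  have h3 : ∏ w ∈ ball g (n + 1) with w.length ≠ 0, ∏ layer : Bool,
        singlet (extLegs (glue q p) (w.parent, layer) w.1.head?)
          (extLegs (glue q p) (w, layer) w.1.head?) =
      (∏ w ∈ ball g n with w.length ≠ 0, ∏ layer : Bool,
        singlet (extLegs q (w.parent, layer) w.1.head?) (extLegs q (w, layer) w.1.head?)) *
        ∏ w : Boundary g n, (singlet (dangling q w).1 ((p w).1 w.1.1.head?) *
          singlet (dangling q w).2 ((p w).2 w.1.1.head?)) := by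
    rw [Finset.prod_filter, Finset.prod_filter, prod_ball_succ]
    refine congrArg₂ (· * ·) (Finset.prod_congr rfl fun w hw => ?_)
      (Finset.prod_congr rfl fun w _ => ?_)
    · have hw' := mem_ball.1 hw
      have hp : w.parent.length ≤ n := by rw [Word.length_parent]; omega
      have e1 : ∀ l, extLegs (glue q p) (w, l) = extLegs q (w, l) := fun l =>
        extLegs_glue_inner _ _ hw'
      have e2 : ∀ l, extLegs (glue q p) (w.parent, l) = extLegs q (w.parent, l) := fun l =>
        extLegs_glue_inner _ _ hp
      simp only [e1, e2]
    · have hl := w.length_eq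
      have hp : w.1.parent.length ≤ n := by rw [Word.length_parent]; omega
      have e2 : ∀ l, extLegs (glue q p) (w.1.parent, l) = extLegs q (w.1.parent, l) := fun l =>
        extLegs_glue_inner _ _ hp
      rw [if_pos (by omega), Fintype.prod_bool, mul_comm]
      simp only [extLegs_glue_outer, e2]
      rfl
  rw [bulkFactor, h1, h2, h3, bulkFactor]
  simp only [nodeFactor, Finset.prod_mul_distrib]
  ring

theorem dangling_glue {g n : ℕ} (q : volume g n → Leg g → Fin 2)
    (p : Boundary g n → (Leg g → Fin 2) × (Leg g → Fin 2)) (w : Boundary g n) (i : Fin g) :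
    dangling (glue q p) (w.child i) = ((p w).1 (w.1.child i).1.head?, (p w).2 (w.1.child i).1.head?) := by
  have h : (w.child i).1.parent = w.1 := Word.parent_child _ _
  simp only [dangling, h, extLegs_glue_outer]
  rfl

theorem indicator_dangling_glue {g n : ℕ} (q : volume g n → Leg g → Fin 2)
    (p : Boundary g n → (Leg g → Fin 2) × (Leg g → Fin 2)) (b : Boundary g (n + 1) → Pair) :
    (if dangling (glue q p) = b then (1 : ℂ) else 0) =
      ∏ w : Boundary g n, if (fun i => ((p w).1 (w.1.child i).1.head?,
        (p w).2 (w.1.child i).1.head?)) = (fun i => b (w.child i)) then 1 else 0 := by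
  rw [Fintype.prod_ite_zero]
  simp only [Finset.prod_const_one]
  congr 1
  rw [eq_iff_iff]
  constructor
  · rintro rfl w
    funext i
    rw [dangling_glue]
  · intro h
    funext u
    obtain ⟨⟨w, i⟩, rfl⟩ := (Boundary.child_bijective g n).2 u
    simp only [dangling_glue]
    exact congrFun (h w) i

/-- The legs of a site, given by the rung, one distinguished leg and the other ones. -/
def legEquiv {g : ℕ} (h : Fin (g + 1)) :
    Fin 2 × Fin 2 × (Fin g → Fin 2) ≃ (Leg g → Fin 2) where
  toFun x := fun c => c.elim x.1 (h.insertNth (α := fun _ => Fin 2) x.2.1 x.2.2)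
  invFun q := (q none, q (some h), fun i => q (some (h.succAbove i)))
  left_inv x := by simp
  right_inv q := by
    funext c
    cases c with
    | none => rfl
    | some c =>
      refine Fin.succAboveCases h ?_ (fun i => ?_) c <;> simp

theorem symAmp_legEquiv {g : ℕ} (k : ℕ) (h : Fin (g + 1)) (r o : Fin 2) (f : Fin g → Fin 2) :
    symAmp k (legEquiv h (r, o, f)) =
      symAmp k (Fin.cons r (Fin.cons o f) : Fin (g + 2) → Fin 2) := by
  have hc : upCount (legEquiv h (r, o, f)) =
      upCount (Fin.cons r (Fin.cons o f) : Fin (g + 2) → Fin 2) := by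
    rw [upCount_cons, upCount_cons]
    simp only [upCount, Finset.card_filter]
    rw [Fintype.sum_option, Fin.sum_univ_succAbove _ h]
    simp only [legEquiv, Equiv.coe_fn_mk, Option.elim_none, Option.elim_some,
      Fin.insertNth_apply_same, Fin.insertNth_apply_succAbove]
    rfl
  rw [symAmp_eq, symAmp_eq, hc]
  simp

/-- The legs of an outermost site split into the rung, the leg to the parent (whose colour is the
first letter) and the legs to the children. Reordering them is harmless because `symAmp` sees only
the number of ups. -/
theorem sum_nodeFactor {g n : ℕ} (w : Boundary g n) (s : NodeCfg g) (c : Pair)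
    (b : Fin g → Pair) :
    ∑ p : (Leg g → Fin 2) × (Leg g → Fin 2), nodeFactor w.1 s c p *
      (if (fun i => (p.1 (w.1.child i).1.head?, p.2 (w.1.child i).1.head?)) = b then 1 else 0) =
      nodeOp g s.1 s.2 c b := by
  set h := w.1.1.headD 0 with hh
  have hw : w.1.1.head? = some h := Word.head?_eq (by have := w.length_eq; omega)
  rw [← Equiv.sum_comp ((legEquiv h).prodCongr (legEquiv h))]
  have e1 : ∀ x : Fin 2 × Fin 2 × (Fin g → Fin 2), legEquiv h x none = x.1 := fun x => rfl
  have e2 : ∀ x : Fin 2 × Fin 2 × (Fin g → Fin 2), legEquiv h x (some h) = x.2.1 := fun x => by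
    simp [legEquiv]
  have e3 : ∀ (x : Fin 2 × Fin 2 × (Fin g → Fin 2)) i,
      legEquiv h x (some (h.succAbove i)) = x.2.2 i := fun x i => by
    simp [legEquiv]
  simp only [nodeFactor, Word.head?_child, ← hh, hw, Equiv.prodCongr_apply, Prod.map_fst,
    Prod.map_snd, e1, e2, e3]
  have hind : ∀ f f' : Fin g → Fin 2, (if (fun i => (f i, f' i)) = b then (1 : ℂ) else 0) =
      (if f = fun i => (b i).1 then 1 else 0) * if f' = fun i => (b i).2 then 1 else 0 := by
    intro f f'
    have h1 : ((fun i => (f i, f' i)) = b) ↔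
        (f = fun i => (b i).1) ∧ (f' = fun i => (b i).2) := by
      simp only [funext_iff, Prod.ext_iff, forall_and]
    simp only [h1]
    by_cases h2 : f = fun i => (b i).1 <;> by_cases h3 : f' = fun i => (b i).2 <;> simp [h2, h3]
  simp only [Fintype.sum_prod_type, symAmp_legEquiv, nodeOp, hind]
  refine Finset.sum_congr rfl fun r _ => ?_
  conv_rhs => rw [Finset.sum_comm]
  refine Finset.sum_congr rfl fun o _ => ?_
  rw [Finset.sum_eq_single (fun i => (b i).1)]
  · refine Finset.sum_congr rfl fun r' _ => Finset.sum_congr rfl fun o' _ => ?_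
    rw [Finset.sum_eq_single (fun i => (b i).2)]
    · simp only [if_true]
      ring
    · intro f' _ hf'; simp [hf']
    · simp
  · intro f _ hf; simp [hf]
  · simp

/-- The product form of `bulkFactor_glue` lets the sum over the outer legs be carried out node by
node; the values on the dangling legs of `T_n` become the summation index of the matrix product. -/
theorem vbsMap_glue {g n : ℕ} (s : Cfg (volume g n)) (t : Boundary g n → NodeCfg g)
    (b : Boundary g (n + 1) → Pair) :
    vbsMap g (n + 1) (glue s t) b =
      (vbsMap g n * tensorProd fun w => nodeOp g (t w).1 (t w).2) s (fun w i => b (w.child i)) := by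
  have h1 : ∀ q : volume g n → Leg g → Fin 2,
      ∑ p : Boundary g n → (Leg g → Fin 2) × (Leg g → Fin 2),
        bulkFactor (glue s t) (glue q p) * (if dangling (glue q p) = b then 1 else 0) =
      bulkFactor s q * ∏ w : Boundary g n,
        nodeOp g (t w).1 (t w).2 (dangling q w) (fun i => b (w.child i)) := by
    intro q
    simp only [bulkFactor_glue, indicator_dangling_glue, mul_assoc, ← Finset.prod_mul_distrib,
      ← Finset.mul_sum]
    rw [Finset.prod_congr rfl fun w _ => (sum_nodeFactor w (t w) (dangling q w)
      fun i => b (w.child i)).symm, Finset.prod_univ_sum, Fintype.piFinset_univ]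
  rw [vbsMap_eq, sum_glue, Matrix.mul_apply]
  simp only [h1, vbsMap_eq, tensorProd, Finset.sum_mul]
  rw [Finset.sum_comm]
  refine Finset.sum_congr rfl fun q _ => ?_
  rw [Finset.sum_eq_single (dangling q)]
  · simp
  · intro c _ hc; simp [hc.symm]
  · simp

theorem Word.eq_root_of_length {g : ℕ} {w : Word g} (h : w.length = 0) : w = ⟨[], List.isChain_nil⟩ :=
  Subtype.ext (List.length_eq_zero_iff.1 h)

/-- The sites of `T_0`. -/
def rootSite {g : ℕ} (l : Bool) : volume g 0 := ⟨(⟨[], List.isChain_nil⟩, l), mem_volume.2 le_rfl⟩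

/-- The configurations of `T_0`. -/
def rootEquiv (g : ℕ) (X : Type) : X × X ≃ (volume g 0 → X) where
  toFun x := fun v => bif v.1.2 then x.2 else x.1
  invFun f := (f (rootSite false), f (rootSite true))
  left_inv _ := rfl
  right_inv f := by
    funext ⟨⟨w, l⟩, hv⟩
    have : w = ⟨[], List.isChain_nil⟩ := Word.eq_root_of_length (by simpa using mem_volume.1 hv)
    subst this
    cases l <;> rfl

theorem prod_volume_zero {g : ℕ} (f : volume g 0 → ℂ) :
    ∏ v, f v = f (rootSite false) * f (rootSite true) := by
  have h : Function.Bijective (rootSite : Bool → volume g 0) := by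
    constructor
    · intro l l' h
      simpa [rootSite] using h
    · rintro ⟨⟨w, l⟩, hv⟩
      have : w = ⟨[], List.isChain_nil⟩ := Word.eq_root_of_length (by simpa using mem_volume.1 hv)
      subst this
      exact ⟨l, rfl⟩
  rw [← h.prod_comp, Fintype.prod_bool, mul_comm]

/-- Base of the recursion. The root node has no parent, so all its `g + 1` pairs of tree legs dangle
and `nodeAmp` appears instead of `nodeOp`. -/
theorem vbsMap_zero {g : ℕ} (s : NodeCfg g) (b : Boundary g 0 → Pair) :
    vbsMap g 0 (rootEquiv g _ s) b = nodeAmp g s fun c => b (Boundary.ofLetter c) := by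
  have hball : ball g 0 = {⟨[], List.isChain_nil⟩} := by
    ext w
    rw [mem_ball, Finset.mem_singleton, Nat.le_zero]
    exact ⟨Word.eq_root_of_length, fun h => by rw [h]; rfl⟩
  have hext : ∀ (x : (Leg g → Fin 2) × (Leg g → Fin 2)) (l : Bool),
      extLegs (rootEquiv g _ x) (⟨[], List.isChain_nil⟩, l) = bif l then x.2 else x.1 := by
    intro x l
    have h : ((⟨[], List.isChain_nil⟩, l) : Site g) ∈ volume g 0 := (rootSite l).2
    rw [extLegs, dif_pos h]
    rfl
  have hbulk : ∀ x : (Leg g → Fin 2) × (Leg g → Fin 2),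
      bulkFactor (rootEquiv g _ s) (rootEquiv g _ x) =
        symAmp (s.1 : ℕ) x.1 * symAmp (s.2 : ℕ) x.2 * singlet (x.1 none) (x.2 none) := by
    intro x
    rw [bulkFactor, prod_volume_zero, hball, Finset.prod_singleton, Finset.filter_singleton,
      if_neg (by simp [Word.length]), Finset.prod_empty, mul_one, hext, hext]
    rfl
  have hdang : ∀ x : (Leg g → Fin 2) × (Leg g → Fin 2),
      (if dangling (rootEquiv g _ x) = b then (1 : ℂ) else 0) =
      (if (fun c => x.1 (some c)) = fun c => (b (Boundary.ofLetter c)).1 then 1 else 0) *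
        if (fun c => x.2 (some c)) = fun c => (b (Boundary.ofLetter c)).2 then 1 else 0 := by
    intro x
    have h1 : dangling (rootEquiv g _ x) = b ↔
        ((fun c => x.1 (some c)) = fun c => (b (Boundary.ofLetter c)).1) ∧
        ((fun c => x.2 (some c)) = fun c => (b (Boundary.ofLetter c)).2) := by
      have h2 : ∀ c, dangling (rootEquiv g _ x) (Boundary.ofLetter c) =
          (x.1 (some c), x.2 (some c)) := by
        intro c
        have hp : (Boundary.ofLetter c : Boundary g 0).1.parent = ⟨[], List.isChain_nil⟩ := rfl
        simp only [dangling, hp, hext]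
        rfl
      rw [funext_iff, (Boundary.ofLetter_bijective g).2.forall]
      simp only [h2, funext_iff, Prod.ext_iff, forall_and]
    simp only [h1]
    by_cases h2 : (fun c => x.1 (some c)) = fun c => (b (Boundary.ofLetter c)).1 <;>
    by_cases h3 : (fun c => x.2 (some c)) = fun c => (b (Boundary.ofLetter c)).2 <;> simp [h2, h3]
  let E : Fin 2 × (Fin (g + 1) → Fin 2) ≃ (Leg g → Fin 2) :=
    ⟨fun x c => c.elim x.1 x.2, fun q => (q none, fun c => q (some c)), fun _ => rfl,
      fun q => by funext c; cases c <;> rfl⟩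
  have hamp : ∀ (k : ℕ) (x : Fin 2 × (Fin (g + 1) → Fin 2)),
      symAmp k (E x) = symAmp k (Fin.cons x.1 x.2 : Fin (g + 2) → Fin 2) := by
    intro k x
    have hc : upCount (E x) = upCount (Fin.cons x.1 x.2 : Fin (g + 2) → Fin 2) := by
      rw [upCount_cons]
      simp only [upCount, Finset.card_filter]
      rw [Fintype.sum_option]
      rfl
    rw [symAmp_eq, symAmp_eq, hc]
    simp
  have hE1 : ∀ x, E x none = x.1 := fun _ => rfl
  have hE2 : ∀ x, (fun c => E x (some c)) = x.2 := fun _ => rfl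
  rw [vbsMap_eq, ← Equiv.sum_comp (rootEquiv g _)]
  simp only [hbulk, hdang]
  rw [← Equiv.sum_comp (E.prodCongr E)]
  simp only [Equiv.prodCongr_apply, Prod.map_fst, Prod.map_snd, Fintype.sum_prod_type, hamp, hE1,
    hE2, nodeAmp]
  refine Finset.sum_congr rfl fun r _ => ?_
  rw [Finset.sum_eq_single (fun c => (b (Boundary.ofLetter c)).1)]
  · refine Finset.sum_congr rfl fun r' _ => ?_
    rw [Finset.sum_eq_single (fun c => (b (Boundary.ofLetter c)).2)]
    · simp only [if_true]
      ring
    · intro f' _ hf'; simp [hf']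
    · simp
  · intro f _ hf; simp [hf]
  · simp


/-! ### Expectations in the valence-bond states -/

/-- The unnormalized expectation of an observable for a product boundary condition. -/
noncomputable def expect {g n : ℕ} (A : Obs (volume g n)) (Z : Boundary g n → Matrix Pair Pair ℂ) : ℂ :=
  (vbsMap g n * tensorProd Z * (vbsMap g n)ᴴ * A).trace

/-- The values of the dangling legs of `T_{n + 1}`, grouped by the outermost nodes. -/
noncomputable def groupEquiv (g n : ℕ) (X : Type) :
    (Boundary g (n + 1) → X) ≃ (Boundary g n → Fin g → X) :=
  ((Boundary.childEquiv g n).symm.arrowCongr (Equiv.refl X)).trans (Equiv.curry _ _ _)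

theorem groupEquiv_apply {g n : ℕ} {X : Type} (b : Boundary g (n + 1) → X) :
    groupEquiv g n X b = fun w i => b (w.child i) := by
  funext w i
  simp [groupEquiv, Equiv.arrowCongr, Boundary.childEquiv]

theorem vbsMap_mul_apply_glue {g n : ℕ} (Z : Boundary g (n + 1) → Matrix Pair Pair ℂ)
    (s s' : Cfg (volume g n)) (t t' : Boundary g n → NodeCfg g) :
    (vbsMap g (n + 1) * tensorProd Z * (vbsMap g (n + 1))ᴴ) (glue s t) (glue s' t') =
      (vbsMap g n * (tensorProd fun w => nodeOp g (t w).1 (t w).2 *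
        tensorProd (fun i => Z (w.child i)) * (nodeOp g (t' w).1 (t' w).2)ᴴ) *
        (vbsMap g n)ᴴ) s s' := by
  have h1 : (tensorProd fun w : Boundary g n => nodeOp g (t w).1 (t w).2 *
        tensorProd (fun i => Z (w.child i)) * (nodeOp g (t' w).1 (t' w).2)ᴴ) =
      (tensorProd fun w : Boundary g n => nodeOp g (t w).1 (t w).2) *
        (tensorProd fun w : Boundary g n => tensorProd fun i => Z (w.child i)) *
        (tensorProd fun w : Boundary g n => nodeOp g (t' w).1 (t' w).2)ᴴ := by
    rw [tensorProd_conjTranspose, tensorProd_mul, tensorProd_mul]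
  have h2 : vbsMap g n * ((tensorProd fun w : Boundary g n => nodeOp g (t w).1 (t w).2) *
        (tensorProd fun w : Boundary g n => tensorProd fun i => Z (w.child i)) *
        (tensorProd fun w : Boundary g n => nodeOp g (t' w).1 (t' w).2)ᴴ) * (vbsMap g n)ᴴ =
      (vbsMap g n * tensorProd fun w : Boundary g n => nodeOp g (t w).1 (t w).2) *
        (tensorProd fun w : Boundary g n => tensorProd fun i => Z (w.child i)) *
        (vbsMap g n * tensorProd fun w : Boundary g n => nodeOp g (t' w).1 (t' w).2)ᴴ := by
    rw [Matrix.conjTranspose_mul]; simp only [Matrix.mul_assoc]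
  rw [h1, h2, mul_mul_conjTranspose_apply, mul_mul_conjTranspose_apply]
  refine Fintype.sum_equiv (groupEquiv g n Pair) _ _ fun b => ?_
  refine Fintype.sum_equiv (groupEquiv g n Pair) _ _ fun b' => ?_
  rw [vbsMap_glue, vbsMap_glue, groupEquiv_apply, groupEquiv_apply]
  congr 1
  rw [tensorProd_apply, ← (Boundary.child_bijective g n).prod_comp, Fintype.prod_prod_type]
  rfl

/-- With an observable that factorizes over the outermost nodes, each of these nodes can be
contracted by itself and leaves a matrix on one pair of dangling legs of `T_n`. The `D w` may
differ, so that one node can carry an observable and the others the identity. -/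
theorem expect_succ {g n : ℕ} {A : Obs (volume g n)} {A' : Obs (volume g (n + 1))}
    {D : Boundary g n → Matrix (NodeCfg g) (NodeCfg g) ℂ}
    (hA : ∀ s t s' t', A' (glue s t) (glue s' t') = A s s' * ∏ w, D w (t w) (t' w))
    (Z : Boundary g (n + 1) → Matrix Pair Pair ℂ) :
    expect A' Z = expect A fun w => transferOp (D w) fun i => Z (w.child i) := by
  let W : Boundary g n → NodeCfg g → NodeCfg g → Matrix Pair Pair ℂ := fun w a a' =>
    nodeOp g a.1 a.2 * tensorProd (fun i => Z (w.child i)) * (nodeOp g a'.1 a'.2)ᴴ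
  have h1 : (tensorProd fun w => transferOp (D w) fun i => Z (w.child i)) =
      ∑ t : Boundary g n → NodeCfg g, ∑ t' : Boundary g n → NodeCfg g,
        (∏ w, D w (t' w) (t w)) • tensorProd fun w => W w (t w) (t' w) := by
    ext c c'
    simp only [tensorProd_apply, transferOp, Matrix.sum_apply, Matrix.smul_apply, smul_eq_mul,
      ← Finset.prod_mul_distrib]
    rw [Finset.prod_univ_sum, Fintype.piFinset_univ]
    refine Finset.sum_congr rfl fun t _ => ?_
    rw [Finset.prod_univ_sum, Fintype.piFinset_univ]
  rw [expect, expect, h1, trace_mul_eq_sum, trace_mul_eq_sum]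
  simp only [sum_glue, vbsMap_mul_apply_glue, hA]
  simp only [Matrix.mul_sum, Matrix.sum_mul, Matrix.sum_apply, Finset.sum_mul, Matrix.mul_smul,
    Matrix.smul_mul, Matrix.smul_apply, smul_eq_mul]
  conv_rhs => rw [sum_comm_four]
  rw [Finset.sum_comm]
  refine Finset.sum_congr rfl fun t _ => ?_
  conv_rhs => rw [Finset.sum_comm]
  refine Finset.sum_congr rfl fun s _ => ?_
  rw [Finset.sum_comm]
  refine Finset.sum_congr rfl fun t' _ => Finset.sum_congr rfl fun s' _ => ?_
  simp only [W]
  ring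

theorem expect_zero {g : ℕ} {A : Obs (volume g 0)} {D : Matrix (NodeCfg g) (NodeCfg g) ℂ}
    (hA : ∀ s s', A (rootEquiv g _ s) (rootEquiv g _ s') = D s s')
    (Z : Boundary g 0 → Matrix Pair Pair ℂ) :
    expect A Z = nodeFun D fun c => Z (Boundary.ofLetter c) := by
  rw [expect, nodeFun, trace_contract, trace_contract]
  let E : (Boundary g 0 → Pair) ≃ (Fin (g + 1) → Pair) :=
    (Boundary.letterEquiv g).symm.arrowCongr (Equiv.refl Pair)
  have hE : ∀ b, E b = fun c => b (Boundary.ofLetter c) := fun b => by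
    funext c; simp [E, Equiv.arrowCongr, Boundary.letterEquiv]
  refine Fintype.sum_equiv E _ _ fun b => Fintype.sum_equiv E _ _ fun b' => ?_
  refine congrArg₂ (· * ·) ?_ ?_
  · rw [tensorProd_apply, ← (Boundary.ofLetter_bijective g).prod_comp, tensorProd_apply]
    simp only [hE]
  · rw [← Equiv.sum_comp (rootEquiv g _)]
    refine Finset.sum_congr rfl fun s _ => ?_
    rw [← Equiv.sum_comp (rootEquiv g _)]
    refine Finset.sum_congr rfl fun s' _ => ?_
    rw [hA, vbsMap_zero, vbsMap_zero, hE, hE]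

theorem expect_smul {g n : ℕ} (A : Obs (volume g n)) (c : Boundary g n → ℂ)
    (Z : Boundary g n → Matrix Pair Pair ℂ) :
    expect A (fun w => c w • Z w) = (∏ w, c w) * expect A Z := by
  rw [expect, tensorProd_smul]
  simp [expect, Matrix.trace_smul]

/-! ### Local observables -/

theorem prod_one_apply {ι α : Type} [Fintype ι] [DecidableEq ι] [DecidableEq α] (t t' : ι → α) :
    ∏ w, (1 : Matrix α α ℂ) (t w) (t' w) = if t = t' then 1 else 0 := by
  simp only [Matrix.one_apply, Fintype.prod_ite_zero, Finset.prod_const_one, funext_iff]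

theorem one_glue_apply {g n : ℕ} (s s' : Cfg (volume g n)) (t t' : Boundary g n → NodeCfg g) :
    (1 : Obs (volume g (n + 1))) (glue s t) (glue s' t') =
      (1 : Obs (volume g n)) s s' *
        ∏ w, (1 : Matrix (NodeCfg g) (NodeCfg g) ℂ) (t w) (t' w) := by
  have h : glue s t = glue s' t' ↔ s = s' ∧ t = t' := by
    have := (glueEquiv g n (Fin (g + 3))).injective.eq_iff (a := (s, t)) (b := (s', t'))
    rwa [Prod.mk.injEq] at this
  rw [prod_one_apply]
  simp only [Matrix.one_apply, h]
  by_cases h1 : s = s' <;> by_cases h2 : t = t' <;> simp [h1, h2]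

theorem extend_one {g : ℕ} {Λ Λ' : Finset (Site g)} (h : Λ ⊆ Λ') : extend h (1 : Obs Λ) = 1 := by
  ext s t
  rw [extend, Matrix.one_apply, Matrix.one_apply]
  by_cases hst : s = t
  · simp [hst]
  · rw [if_neg hst]
    split_ifs with h1 h2
    · exfalso
      apply hst
      funext u
      by_cases hu : (u : Site g) ∈ Λ
      · exact congrFun h2 ⟨u, hu⟩
      · exact h1 u hu
    · rfl
    · rfl

theorem extend_extend {g : ℕ} {Λ Λ' Λ'' : Finset (Site g)} (h : Λ ⊆ Λ') (h' : Λ' ⊆ Λ'')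
    (A : Obs Λ) : extend h' (extend h A) = extend (h.trans h') A := by
  ext s t
  simp only [extend]
  by_cases h1 : ∀ u : Λ'', (u : Site g) ∉ Λ → s u = t u
  · rw [if_pos h1, if_pos, if_pos]
    · exact fun u hu => h1 ⟨u, h' u.2⟩ hu
    · exact fun u hu => h1 u fun hu' => hu (h hu')
  · rw [if_neg h1]
    split_ifs with h2 h3
    · exfalso
      apply h1
      intro u hu
      by_cases hu' : (u : Site g) ∈ Λ'
      · exact h3 ⟨u, hu'⟩ hu
      · exact h2 u hu'
    · rfl
    · rfl

theorem extend_siteOp {g : ℕ} {Λ Λ' : Finset (Site g)} (h : Λ ⊆ Λ') (v : Λ)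
    (A : Matrix (Fin (g + 3)) (Fin (g + 3)) ℂ) :
    extend h (siteOp v A) = siteOp ⟨v, h v.2⟩ A := by
  ext s t
  simp only [extend, siteOp]
  by_cases h1 : ∀ u : Λ', u ≠ ⟨v, h v.2⟩ → s u = t u
  · rw [if_pos h1, if_pos, if_pos]
    · intro u hu
      exact h1 ⟨u, h u.2⟩ fun hu' => hu (Subtype.ext (by simpa using hu'))
    · intro u hu
      exact h1 u fun hu' => hu (by rw [hu']; exact v.2)
  · rw [if_neg h1]
    split_ifs with h2 h3
    · exfalso
      apply h1
      intro u hu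
      by_cases hu' : (u : Site g) ∈ Λ
      · exact h3 ⟨u, hu'⟩ fun hv => hu (Subtype.ext (by rw [← hv]))
      · exact h2 u hu'
    · rfl
    · rfl

theorem extend_glue {g n : ℕ} (A : Obs (volume g n)) (s s' : Cfg (volume g n))
    (t t' : Boundary g n → NodeCfg g) :
    extend (volume_subset n.le_succ) A (glue s t) (glue s' t') =
      A s s' * ∏ w, (1 : Matrix (NodeCfg g) (NodeCfg g) ℂ) (t w) (t' w) := by
  have h1 : (∀ u : volume g (n + 1), (u : Site g) ∉ volume g n → glue s t u = glue s' t' u) ↔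
      t = t' := by
    constructor
    · intro h
      funext w
      have e1 := h ⟨(w, false), outer_mem w _⟩ (outer_notMem w _)
      have e2 := h ⟨(w, true), outer_mem w _⟩ (outer_notMem w _)
      rw [glue_outer, glue_outer] at e1 e2
      exact Prod.ext e1 e2
    · rintro rfl u hu
      simp [glue, hu]
  have h2 : ∀ (s : Cfg (volume g n)) (t : Boundary g n → NodeCfg g),
      (fun v : volume g n => glue s t ⟨v, volume_subset n.le_succ v.2⟩) = s := fun s t => by
    funext v; exact glue_inner s t v.2 _
  rw [prod_one_apply]
  simp only [extend, h1, h2]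
  by_cases h3 : t = t' <;> simp [h3]

/-- The operator that acts on one of the two spins of a node. -/
def layerOp {g : ℕ} (l : Bool) (A : Matrix (Fin (g + 3)) (Fin (g + 3)) ℂ) :
    Matrix (NodeCfg g) (NodeCfg g) ℂ := bif l then 1 ⊗ₖ A else A ⊗ₖ 1

/-- Puts a one-site observable of the outermost layer into the product form required by
`expect_succ`. -/
theorem siteOp_glue {g n : ℕ} (w₀ : Boundary g n) (l : Bool)
    (A : Matrix (Fin (g + 3)) (Fin (g + 3)) ℂ) (s s' : Cfg (volume g n))
    (t t' : Boundary g n → NodeCfg g) :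
    siteOp ⟨(w₀, l), outer_mem w₀ l⟩ A (glue s t) (glue s' t') =
      (1 : Obs (volume g n)) s s' * ∏ w, (if w = w₀ then layerOp l A else 1) (t w) (t' w) := by
  have h1 : (∀ u : volume g (n + 1), u ≠ ⟨(w₀, l), outer_mem w₀ l⟩ →
      glue s t u = glue s' t' u) ↔ (s = s' ∧ (∀ w, w ≠ w₀ → t w = t' w)) ∧
        (bif l then (t w₀).1 else (t w₀).2) = bif l then (t' w₀).1 else (t' w₀).2 := by
    constructor
    · intro h
      refine ⟨⟨funext fun v => ?_, fun w hw => ?_⟩, ?_⟩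
      · have := h ⟨v, volume_subset n.le_succ v.2⟩ (fun hv => outer_notMem w₀ l (by
          have := congrArg Subtype.val hv
          simp only at this
          rw [← this]; exact v.2))
        rwa [glue_inner s t v.2, glue_inner s' t' v.2] at this
      · have e : ∀ l', glue s t ⟨(w, l'), outer_mem w l'⟩ = glue s' t' ⟨(w, l'), outer_mem w l'⟩ :=
          fun l' => h _ fun hv => hw (by
            simp only [Subtype.mk.injEq, Prod.mk.injEq] at hv
            exact Subtype.ext hv.1)
        have e1 := e false
        have e2 := e true
        rw [glue_outer, glue_outer] at e1 e2
        exact Prod.ext e1 e2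
      · have := h ⟨(w₀, !l), outer_mem w₀ _⟩ (by simp)
        rw [glue_outer, glue_outer] at this
        cases l <;> exact this
    · rintro ⟨⟨rfl, h2⟩, h3⟩ u hu
      by_cases hv : (u : Site g) ∈ volume g n
      · simp [glue, hv]
      · obtain ⟨x | ⟨w, l'⟩, rfl⟩ := (volume_succ_bijective g n).2 u
        · exact absurd x.2 hv
        · simp only [Sum.elim_inr, glue_outer]
          by_cases hw : w = w₀
          · subst hw
            have hl : l' ≠ l := by rintro rfl; exact hu rfl
            cases l <;> cases l' <;> first | exact absurd rfl hl | exact h3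
          · rw [h2 w hw]
  rw [siteOp, ← Finset.mul_prod_erase _ _ (Finset.mem_univ w₀), if_pos rfl]
  have h2 : ∏ w ∈ Finset.univ.erase w₀,
      (if w = w₀ then layerOp l A else (1 : Matrix (NodeCfg g) (NodeCfg g) ℂ)) (t w) (t' w) =
      if ∀ w, w ≠ w₀ → t w = t' w then 1 else 0 := by
    rw [Finset.prod_congr rfl fun w hw => by
      rw [if_neg (Finset.ne_of_mem_erase hw), Matrix.one_apply], Finset.prod_ite_zero,
      Finset.prod_const_one]
    simp only [Finset.mem_erase, Finset.mem_univ, and_true]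
  simp only [h1, h2, glue_outer, Matrix.one_apply]
  have h3 : layerOp l A (t w₀) (t' w₀) =
      if (bif l then (t w₀).1 else (t w₀).2) = (bif l then (t' w₀).1 else (t' w₀).2) then
        A (bif l then (t w₀).2 else (t w₀).1) (bif l then (t' w₀).2 else (t' w₀).1) else 0 := by
    cases l <;> simp [layerOp, Matrix.kroneckerMap_apply, Matrix.one_apply]
  rw [h3]
  by_cases e3 : (bif l then (t w₀).1 else (t w₀).2) = bif l then (t' w₀).1 else (t' w₀).2
  · by_cases e2 : s = s' ∧ ∀ w, w ≠ w₀ → t w = t' w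
    · rw [if_pos ⟨e2, e3⟩, if_pos e3, if_pos e2.1, if_pos e2.2, one_mul, mul_one]
    · rw [if_neg fun h => e2 h.1]
      by_cases e1 : s = s'
      · rw [if_neg (c := ∀ w, w ≠ w₀ → t w = t' w) fun h => e2 ⟨e1, h⟩, mul_zero, mul_zero]
      · rw [if_neg e1, zero_mul]
  · rw [if_neg fun h => e3 h.2, if_neg e3, zero_mul, mul_zero]

theorem siteOp_root {g : ℕ} (l : Bool) (A : Matrix (Fin (g + 3)) (Fin (g + 3)) ℂ)
    (s s' : NodeCfg g) :
    siteOp (rootSite l) A (rootEquiv g _ s) (rootEquiv g _ s') = layerOp l A s s' := by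
  have h1 : (∀ u : volume g 0, u ≠ rootSite l → rootEquiv g _ s u = rootEquiv g _ s' u) ↔
      (bif l then s.1 else s.2) = bif l then s'.1 else s'.2 := by
    constructor
    · intro h
      have := h (rootSite !l) (by simp [rootSite])
      cases l <;> exact this
    · rintro h ⟨⟨w, l'⟩, hv⟩ hu
      have : w = ⟨[], List.isChain_nil⟩ := Word.eq_root_of_length (by simpa using mem_volume.1 hv)
      subst this
      have hl : l' ≠ l := by rintro rfl; exact hu rfl
      cases l <;> cases l' <;> first | exact absurd rfl hl | exact h
  simp only [siteOp, h1]
  cases l <;> simp [layerOp, Matrix.kroneckerMap_apply, Matrix.one_apply, rootSite, rootEquiv]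


/-! ### Two spins of maximal total spin -/

theorem siteOp_mulVec {g : ℕ} {Λ : Finset (Site g)} (x : Λ)
    (A : Matrix (Fin (g + 3)) (Fin (g + 3)) ℂ) (ψ : Cfg Λ → ℂ) (σ : Cfg Λ) :
    (siteOp x A *ᵥ ψ) σ = ∑ k, A (σ x) k * ψ (Function.update σ x k) := by
  rw [Matrix.mulVec, dotProduct, ← Finset.sum_subset (Finset.subset_univ
      (Finset.univ.image fun k => Function.update σ x k))]
  · rw [Finset.sum_image]
    · refine Finset.sum_congr rfl fun k _ => ?_
      rw [siteOp, if_pos]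
      · simp
      · intro u hu; simp [hu]
    · intro a _ b _ hab
      simpa using congrFun hab x
  · intro τ _ hτ
    rw [siteOp, if_neg, zero_mul]
    intro h
    apply hτ
    simp only [Finset.mem_image, Finset.mem_univ, true_and]
    refine ⟨τ x, funext fun u => ?_⟩
    by_cases hu : u = x
    · subst hu; simp
    · simp [hu, h u hu]

theorem raising_star (d : ℕ) (k l : Fin (d + 1)) : star (raising d k l) = raising d k l := by
  rw [raising]; split_ifs
  · exact Complex.conj_ofReal _
  · simp

theorem spin_mul_spin (d : ℕ) (a b c e : Fin (d + 1)) :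
    ∑ i, spin d i a b * spin d i c e =
      (1 / 2 : ℂ) * (raising d a b * raising d e c + raising d b a * raising d c e) +
        (if a = b then (a : ℂ) - d / 2 else 0) * (if c = e then (c : ℂ) - d / 2 else 0) := by
  rw [Fin.sum_univ_three]
  have e1 : (1 / (2 * Complex.I) : ℂ) = -Complex.I / 2 := by field_simp; simp
  simp only [spin, Matrix.cons_val_zero, Matrix.cons_val_one, Matrix.cons_val_two, Matrix.head_cons,
    Matrix.tail_cons, Matrix.smul_apply, Matrix.add_apply, Matrix.sub_apply,
    Matrix.conjTranspose_apply, raising_star, smul_eq_mul, e1, Matrix.diagonal_apply]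
  linear_combination (1 / 4 * (raising d a b - raising d b a) * (raising d c e - raising d e c)) *
    Complex.I_sq

/-- The matrix element of the raising operator from `k` to `k + 1`. -/
noncomputable def raisingCoeff (d k : ℕ) : ℂ :=
  ((Real.sqrt (((k : ℝ) + 1) * ((d : ℝ) - k)) : ℝ) : ℂ)

theorem sum_raising_col (d : ℕ) (l : Fin (d + 1)) (f : ℕ → ℂ) :
    ∑ k : Fin (d + 1), raising d k l * f k = raisingCoeff d l * f (l + 1) := by
  by_cases hl : (l : ℕ) + 1 < d + 1
  · rw [Finset.sum_eq_single (⟨l + 1, hl⟩ : Fin (d + 1))]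
    · simp [raising, raisingCoeff]
    · intro k _ hk
      rw [raising, if_neg, zero_mul]
      intro h; exact hk (Fin.ext h)
    · simp
  -- At the top of the multiplet the coefficient vanishes, so the value of `f` beyond the range is
  -- irrelevant.
  · have hd : (l : ℕ) = d := by omega
    rw [raisingCoeff, hd, sub_self, mul_zero, Real.sqrt_zero, Complex.ofReal_zero, zero_mul]
    refine Finset.sum_eq_zero fun k _ => ?_
    rw [raising, if_neg (by omega), zero_mul]

theorem sum_raising_row (d : ℕ) (k : Fin (d + 1)) (f : ℕ → ℂ) :
    ∑ l : Fin (d + 1), raising d k l * f l =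
      if (k : ℕ) = 0 then 0 else raisingCoeff d (k - 1) * f (k - 1) := by
  split_ifs with hk
  · refine Finset.sum_eq_zero fun l _ => ?_
    rw [raising, if_neg (by omega), zero_mul]
  · rw [Finset.sum_eq_single (⟨k - 1, by omega⟩ : Fin (d + 1))]
    · rw [raising, if_pos (by simp; omega)]; rfl
    · intro l _ hl
      rw [raising, if_neg, zero_mul]
      intro h; apply hl; ext; simp; omega
    · simp

theorem raisingCoeff_sq {d k : ℕ} (h : k ≤ d) :
    raisingCoeff d k * raisingCoeff d k = ((k : ℂ) + 1) * ((d : ℂ) - k) := by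
  have h3 : (0 : ℝ) ≤ (d : ℝ) - k := by
    have : (k : ℝ) ≤ d := by exact_mod_cast h
    linarith
  rw [raisingCoeff, ← Complex.ofReal_mul, Real.mul_self_sqrt (by positivity)]
  push_cast; rfl

theorem sum_spin_sq (d : ℕ) (a e : Fin (d + 1)) :
    ∑ i, ∑ b, spin d i a b * spin d i b e =
      if a = e then ((d : ℂ) / 2) * ((d : ℂ) / 2 + 1) else 0 := by
  rw [Finset.sum_comm]
  simp only [spin_mul_spin, Finset.sum_add_distrib, ← Finset.mul_sum]
  have ha : (a : ℕ) ≤ d := Nat.lt_succ_iff.1 a.2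
  have h1 : ∑ b : Fin (d + 1), raising d a b * raising d e b =
      if a = e then (a : ℂ) * ((d : ℂ) - a + 1) else 0 := by
    have := sum_raising_row d a (fun n => if (e : ℕ) = n + 1 then raisingCoeff d n else 0)
    refine Eq.trans (Finset.sum_congr rfl fun b _ => ?_) (this.trans ?_)
    · rfl
    · by_cases hae : a = e
      · subst hae
        rw [if_pos rfl]
        by_cases h0 : (a : ℕ) = 0
        · simp [h0]
        · rw [if_neg h0, if_pos (by omega), raisingCoeff_sq (by omega), Nat.cast_sub (by omega)]
          push_cast; ring
      · rw [if_neg hae]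
        by_cases h0 : (a : ℕ) = 0
        · simp [h0]
        · rw [if_neg h0, if_neg, mul_zero]
          intro h; apply hae; ext; omega
  have h2 : ∑ b : Fin (d + 1), raising d b a * raising d b e =
      if a = e then ((a : ℂ) + 1) * ((d : ℂ) - a) else 0 := by
    have := sum_raising_col d a (fun n => if n = (e : ℕ) + 1 then raisingCoeff d e else 0)
    refine Eq.trans (Finset.sum_congr rfl fun b _ => ?_) (this.trans ?_)
    · rfl
    · by_cases hae : a = e
      · subst hae
        rw [if_pos rfl, if_pos rfl, raisingCoeff_sq ha]
      · rw [if_neg hae, if_neg, mul_zero]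
        intro h; apply hae; ext; omega
  have h3 : ∑ b : Fin (d + 1), (if a = b then (a : ℂ) - d / 2 else 0) *
      (if b = e then (b : ℂ) - d / 2 else 0) = if a = e then ((a : ℂ) - d / 2) ^ 2 else 0 := by
    rw [Finset.sum_eq_single a]
    · by_cases h : a = e <;> simp [h, sq]
    · intro b _ hb; simp [hb.symm]
    · simp
  rw [h1, h2, h3]
  split_ifs <;> ring

/-- This is `(S_x + S_y)² = S_x² + S_y² + 2 S_x · S_y`, with the single-site Casimir values from
`sum_spin_sq`. It turns the eigenvalue `d (d + 1)` into the eigenvalue `d² / 4` of `S_x · S_y`. -/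
theorem casimir_mulVec {g : ℕ} {Λ : Finset (Site g)} {x y : Λ} (hxy : x ≠ y) (ψ : Cfg Λ → ℂ)
    (σ : Cfg Λ) : (casimir x y *ᵥ ψ) σ =
      ((g : ℂ) + 2) * ((g : ℂ) + 4) / 2 * ψ σ + 2 * ∑ k, ∑ l,
        (∑ i, spin (g + 2) i (σ x) k * spin (g + 2) i (σ y) l) *
          ψ (Function.update (Function.update σ x k) y l) := by
  have h1 : ∀ (z : Λ), ∑ i, (siteOp z (spin (g + 2) i) *ᵥ (siteOp z (spin (g + 2) i) *ᵥ ψ)) σ =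
      ((g : ℂ) + 2) * ((g : ℂ) + 4) / 4 * ψ σ := by
    intro z
    simp only [siteOp_mulVec, Function.update_self, Function.update_idem]
    have : ∀ i, ∑ k, spin (g + 2) i (σ z) k * ∑ l, spin (g + 2) i k l * ψ (Function.update σ z l) =
        ∑ l, (∑ k, spin (g + 2) i (σ z) k * spin (g + 2) i k l) * ψ (Function.update σ z l) := by
      intro i
      simp only [Finset.mul_sum, Finset.sum_mul]
      rw [Finset.sum_comm]
      refine Finset.sum_congr rfl fun _ _ => Finset.sum_congr rfl fun _ _ => by ring
    simp only [this]
    rw [Finset.sum_comm]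
    simp only [← Finset.sum_mul, sum_spin_sq, ite_mul, zero_mul, Finset.sum_ite_eq,
      Finset.mem_univ, if_true, Function.update_eq_self]
    push_cast; ring
  have h2 : ∀ i, (siteOp x (spin (g + 2) i) *ᵥ (siteOp y (spin (g + 2) i) *ᵥ ψ)) σ =
      ∑ k, ∑ l, spin (g + 2) i (σ x) k * spin (g + 2) i (σ y) l *
        ψ (Function.update (Function.update σ x k) y l) := by
    intro i
    simp only [siteOp_mulVec, Function.update_of_ne hxy.symm, Finset.mul_sum, mul_assoc]
  have h3 : ∀ i, (siteOp y (spin (g + 2) i) *ᵥ (siteOp x (spin (g + 2) i) *ᵥ ψ)) σ =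
      ∑ k, ∑ l, spin (g + 2) i (σ x) k * spin (g + 2) i (σ y) l *
        ψ (Function.update (Function.update σ x k) y l) := by
    intro i
    simp only [siteOp_mulVec, Function.update_of_ne hxy, Finset.mul_sum]
    rw [Finset.sum_comm]
    refine Finset.sum_congr rfl fun k _ => Finset.sum_congr rfl fun l _ => ?_
    rw [Function.update_comm hxy]; ring
  have h4 : (casimir x y *ᵥ ψ) σ =
      ∑ i, (siteOp x (spin (g + 2) i) *ᵥ (siteOp x (spin (g + 2) i) *ᵥ ψ)) σ +
      ∑ i, (siteOp y (spin (g + 2) i) *ᵥ (siteOp y (spin (g + 2) i) *ᵥ ψ)) σ +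
      ∑ i, (siteOp x (spin (g + 2) i) *ᵥ (siteOp y (spin (g + 2) i) *ᵥ ψ)) σ +
      ∑ i, (siteOp y (spin (g + 2) i) *ᵥ (siteOp x (spin (g + 2) i) *ᵥ ψ)) σ := by
    simp only [← Finset.sum_add_distrib]
    rw [casimir, Matrix.sum_mulVec, Finset.sum_apply]
    refine Finset.sum_congr rfl fun i _ => ?_
    rw [sq, Matrix.add_mul, Matrix.mul_add, Matrix.mul_add]
    simp only [Matrix.add_mulVec, Pi.add_apply, Matrix.mulVec_mulVec]
    ring
  have h5 : ∑ i, ∑ k, ∑ l, spin (g + 2) i (σ x) k * spin (g + 2) i (σ y) l *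
        ψ (Function.update (Function.update σ x k) y l) = ∑ k, ∑ l,
        (∑ i, spin (g + 2) i (σ x) k * spin (g + 2) i (σ y) l) *
          ψ (Function.update (Function.update σ x k) y l) := by
    simp only [Finset.sum_mul]
    rw [Finset.sum_comm]
    refine Finset.sum_congr rfl fun k _ => Finset.sum_comm
  rw [h4, h1, h1, Finset.sum_congr rfl fun i _ => h2 i, Finset.sum_congr rfl fun i _ => h3 i, h5]
  ring

/-- Together with its companion, removes the square roots: after rescaling by the binomial
normalizations, the ladder operators have integer coefficients `d - k` and `k + 1`. -/
theorem raisingCoeff_mul_sqrt_choose {d k : ℕ} (h : k < d) :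
    raisingCoeff d k * ((Real.sqrt (d.choose (k + 1)) : ℝ) : ℂ) =
      ((d : ℂ) - k) * ((Real.sqrt (d.choose k) : ℝ) : ℂ) := by
  have h1 : (0 : ℝ) < d.choose k := by exact_mod_cast Nat.choose_pos h.le
  have h2 : (0 : ℝ) < d.choose (k + 1) := by exact_mod_cast Nat.choose_pos h
  have h3 := sqrt_choose_succ h
  have h4 := Real.sqrt_pos.2 h1
  have h5 := Real.sqrt_pos.2 h2
  rw [← div_eq_mul_one_div, ← div_eq_mul_one_div, div_eq_div_iff h5.ne' h4.ne'] at h3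
  rw [raisingCoeff, ← Complex.ofReal_mul, ← h3]
  push_cast; rfl

theorem raisingCoeff_mul_sqrt_choose' {d k : ℕ} (h : k < d) :
    raisingCoeff d k * ((Real.sqrt (d.choose k) : ℝ) : ℂ) =
      ((k : ℂ) + 1) * ((Real.sqrt (d.choose (k + 1)) : ℝ) : ℂ) := by
  have h1 := raisingCoeff_mul_sqrt_choose h
  have h2 := raisingCoeff_sq h.le
  have h3 : ((d : ℂ) - k) ≠ 0 := by
    rw [← Nat.cast_sub h.le]; exact_mod_cast (Nat.sub_pos_of_lt h).ne'
  apply mul_left_cancel₀ h3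
  linear_combination (-raisingCoeff d k) * h1 +
    ((Real.sqrt (d.choose (k + 1)) : ℝ) : ℂ) * h2

/-- A vector of maximal total spin of two spins `d / 2` is symmetric in all their constituents. -/
theorem eq_of_maximal_spin {d : ℕ} (φ χ : ℕ → ℕ → ℂ)
    (hφ : ∀ k l, k ≤ d → l ≤ d → φ k l =
      ((Real.sqrt (d.choose k) : ℝ) : ℂ) * ((Real.sqrt (d.choose l) : ℝ) : ℂ) * χ k l)
    (h : ∀ k l : Fin (d + 1), ∑ k', ∑ l', (∑ i, spin d i k k' * spin d i l l') * φ k' l' =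
      (d : ℂ) ^ 2 / 4 * φ k l) {k l : ℕ} (hk : k < d) (hl : l < d) :
    χ (k + 1) l = χ k (l + 1) := by
  have h0 : ∀ k l : Fin (d + 1), ∑ k', ∑ l', (∑ i, spin d i k k' * spin d i l l') * φ k' l' =
      (1 / 2 : ℂ) * ((if (k : ℕ) = 0 then 0 else raisingCoeff d (k - 1) *
          (raisingCoeff d l * φ (k - 1) (l + 1))) +
        raisingCoeff d k * (if (l : ℕ) = 0 then 0 else
          raisingCoeff d (l - 1) * φ (k + 1) (l - 1))) +
        ((k : ℂ) - d / 2) * ((l : ℂ) - d / 2) * φ k l := by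
    intro k l
    simp only [spin_mul_spin, add_mul, Finset.sum_add_distrib, mul_assoc, ← Finset.mul_sum, mul_add]
    have e1 : ∀ m : ℕ, ∑ i : Fin (d + 1), raising d i l * φ m i =
        raisingCoeff d l * φ m (l + 1) := fun m => sum_raising_col d l (φ m)
    have e2 : ∀ m : ℕ, ∑ i : Fin (d + 1), raising d l i * φ m i =
        if (l : ℕ) = 0 then 0 else raisingCoeff d (l - 1) * φ m (l - 1) :=
      fun m => sum_raising_row d l (φ m)
    have e3 : ∀ m : ℕ, ∑ i : Fin (d + 1), (if l = i then (l : ℂ) - d / 2 else 0) * φ m i =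
        ((l : ℂ) - d / 2) * φ m l := by
      intro m; simp
    simp only [e1, e2, e3]
    rw [sum_raising_row d k (fun m => raisingCoeff d l * φ m (l + 1)),
      sum_raising_col d k (fun m => if (l : ℕ) = 0 then 0 else
        raisingCoeff d (l - 1) * φ m (l - 1))]
    simp
  have hc : ∀ n, n ≤ d → ((Real.sqrt (d.choose n) : ℝ) : ℂ) ≠ 0 := by
    intro n hn
    have : (0 : ℝ) < d.choose n := by exact_mod_cast Nat.choose_pos hn
    exact_mod_cast (Real.sqrt_pos.2 this).ne'
  -- the eigenvalue equation without the normalization factors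
  have key : ∀ k l, k ≤ d → l ≤ d → (k : ℂ) * ((d : ℂ) - l) * (χ k l - χ (k - 1) (l + 1)) =
      (l : ℂ) * ((d : ℂ) - k) * (χ (k + 1) (l - 1) - χ k l) := by
    intro k l hk hl
    have h1 := h ⟨k, Nat.lt_succ_of_le hk⟩ ⟨l, Nat.lt_succ_of_le hl⟩
    rw [h0] at h1
    simp only at h1
    have t1 : (if k = 0 then 0 else raisingCoeff d (k - 1) *
          (raisingCoeff d l * φ (k - 1) (l + 1))) =
        ((Real.sqrt (d.choose k) : ℝ) : ℂ) * ((Real.sqrt (d.choose l) : ℝ) : ℂ) *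
          ((k : ℂ) * ((d : ℂ) - l) * χ (k - 1) (l + 1)) := by
      rcases Nat.eq_zero_or_pos k with rfl | hk0
      · simp
      · obtain ⟨m, rfl⟩ : ∃ m, k = m + 1 := ⟨k - 1, by omega⟩
        rw [if_neg (by omega), Nat.add_sub_cancel]
        rcases hl.lt_or_eq with hl' | rfl
        · have a1 := raisingCoeff_mul_sqrt_choose' (d := d) (k := m) (by omega)
          have a2 := raisingCoeff_mul_sqrt_choose hl'
          rw [hφ m (l + 1) (by omega) (by omega)]
          push_cast
          linear_combination (raisingCoeff d l * ((Real.sqrt (d.choose (l + 1)) : ℝ) : ℂ) *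
            χ m (l + 1)) * a1 + ((m : ℂ) + 1) * ((Real.sqrt (d.choose (m + 1)) : ℝ) : ℂ) *
            χ m (l + 1) * a2
        · have : raisingCoeff l l = 0 := by simp [raisingCoeff]
          rw [this]; ring
    have t2 : raisingCoeff d k * (if l = 0 then 0 else
          raisingCoeff d (l - 1) * φ (k + 1) (l - 1)) =
        ((Real.sqrt (d.choose k) : ℝ) : ℂ) * ((Real.sqrt (d.choose l) : ℝ) : ℂ) *
          ((l : ℂ) * ((d : ℂ) - k) * χ (k + 1) (l - 1)) := by
      rcases Nat.eq_zero_or_pos l with rfl | hl0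
      · simp
      · obtain ⟨m, rfl⟩ : ∃ m, l = m + 1 := ⟨l - 1, by omega⟩
        rw [if_neg (by omega), Nat.add_sub_cancel]
        rcases hk.lt_or_eq with hk' | rfl
        · have a1 := raisingCoeff_mul_sqrt_choose' (d := d) (k := m) (by omega)
          have a2 := raisingCoeff_mul_sqrt_choose hk'
          rw [hφ (k + 1) m (by omega) (by omega)]
          push_cast
          linear_combination (raisingCoeff d k * ((Real.sqrt (d.choose (k + 1)) : ℝ) : ℂ) *
            χ (k + 1) m) * a1 + ((m : ℂ) + 1) * ((Real.sqrt (d.choose (m + 1)) : ℝ) : ℂ) *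
            χ (k + 1) m * a2
        · have : raisingCoeff k k = 0 := by simp [raisingCoeff]
          rw [this]; ring
    rw [t1, t2, hφ k l hk hl] at h1
    apply mul_left_cancel₀ (mul_ne_zero (hc k hk) (hc l hl))
    linear_combination (-2) * h1
  -- Equation `key` at `(k, l + 1)` relates neighbouring differences along an antidiagonal. Its left
  -- side vanishes for `k = 0`, and later by induction, or through the factor `d - (l + 1)` at the
  -- end of the range.
  have main : ∀ k l, k < d → l < d → χ (k + 1) l = χ k (l + 1) := by
    intro k
    induction k with
    | zero =>
      intro l hk hl
      have h1 := key 0 (l + 1) hk.le hl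
      have h2 : ((l : ℂ) + 1) * (d : ℂ) ≠ 0 :=
        mul_ne_zero (Nat.cast_add_one_ne_zero l) (by exact_mod_cast (by omega : d ≠ 0))
      simp only [Nat.cast_zero, zero_mul, sub_zero, Nat.add_sub_cancel] at h1
      push_cast at h1
      exact sub_eq_zero.1 ((mul_eq_zero.1 h1.symm).resolve_left h2)
    | succ k ih =>
      intro l hk hl
      have h1 := key (k + 1) (l + 1) hk.le hl
      have h2 : ((k : ℂ) + 1) * ((d : ℂ) - (l + 1)) * (χ (k + 1) (l + 1) - χ k (l + 1 + 1)) = 0 := by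
        rcases (Nat.succ_le_of_lt hl).lt_or_eq with hl' | hl'
        · rw [ih (l + 1) (by omega) hl', sub_self, mul_zero]
        · have : (d : ℂ) = l + 1 := by rw [← hl']; push_cast; rfl
          rw [this]; ring
      have h3 : ((l : ℂ) + 1) * ((d : ℂ) - (k + 1)) ≠ 0 := by
        refine mul_ne_zero (Nat.cast_add_one_ne_zero l) ?_
        have : (d : ℂ) - (k + 1) = ((d - (k + 1) : ℕ) : ℂ) := by
          rw [Nat.cast_sub hk.le]; push_cast; rfl
        rw [this]
        exact_mod_cast (by omega : d - (k + 1) ≠ 0)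
      push_cast at h1
      rw [h2] at h1
      exact sub_eq_zero.1 ((mul_eq_zero.1 h1.symm).resolve_left h3)
  exact main k l hk hl


/-! ### Valence-bond states are ground states -/

/-- The contraction of a vector with the intertwiners of all sites. -/
noncomputable def legContract {g : ℕ} {Λ : Finset (Site g)} (ψ : Cfg Λ → ℂ)
    (q : Λ → Leg g → Fin 2) : ℂ := ∑ s, ψ s * ∏ v, symAmp (s v : ℕ) (q v)

/-- The configuration of the numbers of spins up. -/
def upCfg {g : ℕ} {Λ : Finset (Site g)} (q : Λ → Leg g → Fin 2) : Cfg Λ := fun v =>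
  ⟨upCount (q v), Nat.lt_succ_of_le ((upCount_le _).trans (by simp))⟩

theorem legContract_eq {g : ℕ} {Λ : Finset (Site g)} (ψ : Cfg Λ → ℂ) (q : Λ → Leg g → Fin 2) :
    legContract ψ q = ψ (upCfg q) *
      ∏ v, ((Real.sqrt ((g + 2).choose (upCount (q v))) : ℝ) : ℂ)⁻¹ := by
  have hcard : Fintype.card (Leg g) = g + 2 := by simp
  rw [legContract, Finset.sum_eq_single (upCfg q)]
  · congr 1
    refine Finset.prod_congr rfl fun v _ => ?_
    rw [symAmp_eq, if_pos (by rfl), hcard]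
    simp [upCfg]
  · intro s _ hs
    obtain ⟨v, hv⟩ := Function.ne_iff.1 hs
    rw [Finset.prod_eq_zero (Finset.mem_univ v), mul_zero]
    rw [symAmp_eq, if_neg]
    intro h; exact hv (Fin.ext h.symm)
  · simp

/-- Exchanging the values of two legs. -/
def swapLegs {A B X : Type} [DecidableEq A] [DecidableEq B] (a b : A × B) (q : A → B → X) :
    A → B → X := fun v l => Function.uncurry q (Equiv.swap a b (v, l))

theorem swapLegs_swapLegs {A B X : Type} [DecidableEq A] [DecidableEq B] (a b : A × B)
    (q : A → B → X) : swapLegs a b (swapLegs a b q) = q := by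
  funext v l
  simp only [swapLegs, Function.uncurry]
  have : Equiv.swap a b (Equiv.swap a b (v, l)) = (v, l) := Equiv.swap_apply_self _ _ _
  rw [this]

theorem swapLegs_eq {A B X : Type} [DecidableEq A] [DecidableEq B] {x y : A} (hxy : x ≠ y)
    (i j : B) (q : A → B → X) : swapLegs (x, i) (y, j) q =
      Function.update (Function.update q x (Function.update (q x) i (q y j))) y
        (Function.update (q y) j (q x i)) := by
  funext v l
  simp only [swapLegs, Function.uncurry, Equiv.swap_apply_def]
  by_cases h1 : v = x
  · subst h1
    rw [Function.update_of_ne hxy, Function.update_self]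
    by_cases h2 : l = i
    · subst h2; simp
    · simp [h2, hxy]
  · by_cases h3 : v = y
    · subst h3
      rw [Function.update_self]
      by_cases h2 : l = j
      · subst h2; simp [h1]
      · simp [h2, h1]
    · simp [h1, h3]

/-- After division by the normalizations, a vector of maximal spin depends on the ups at `x` and `y`
only through their sum, with the other sites fixed. Exchanging a leg of `x` with a leg of `y`
preserves that sum. -/
theorem legContract_swapLegs {g : ℕ} {Λ : Finset (Site g)} {x y : Λ} (hxy : x ≠ y) (i j : Leg g)
    {ψ : Cfg Λ → ℂ} (hψ : casimir x y *ᵥ ψ = (((g : ℂ) + 2) * ((g : ℂ) + 3)) • ψ)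
    (q : Λ → Leg g → Fin 2) : legContract ψ (swapLegs (x, i) (y, j) q) = legContract ψ q := by
  -- the case of different values on the two legs
  have key : ∀ q : Λ → Leg g → Fin 2, q x i = 0 → q y j = 1 →
      legContract ψ (swapLegs (x, i) (y, j) q) = legContract ψ q := by
    intro q hx hy
    set σ := upCfg q with hσ
    set c : ℕ → ℂ := fun n => ((Real.sqrt ((g + 2).choose n) : ℝ) : ℂ) with hc
    have hc0 : ∀ n, n ≤ g + 2 → c n ≠ 0 := by
      intro n hn
      have : (0 : ℝ) < (g + 2).choose n := by exact_mod_cast Nat.choose_pos hn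
      exact Complex.ofReal_ne_zero.2 (Real.sqrt_pos.2 this).ne'
    -- `Fin.ofNat` reduces modulo `g + 3`; only arguments up to `g + 2`, where this does nothing,
    -- matter below.
    let φ : ℕ → ℕ → ℂ := fun k l =>
      ψ (Function.update (Function.update σ x (Fin.ofNat (g + 3) k)) y (Fin.ofNat (g + 3) l))
    have hφ : ∀ {k l : ℕ}, k < g + 2 → l < g + 2 → φ (k + 1) l * (c (k + 1) * c l)⁻¹ =
        φ k (l + 1) * (c k * c (l + 1))⁻¹ := eq_of_maximal_spin (d := g + 2) φ (fun k l => φ k l * (c k * c l)⁻¹)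
      (fun k l hk hl => by
        have := mul_ne_zero (hc0 k hk) (hc0 l hl)
        show φ k l = c k * c l * (φ k l * (c k * c l)⁻¹)
        rw [mul_comm, mul_assoc, inv_mul_cancel₀ this, mul_one])
      (fun k l => by
        have h1 := congrFun hψ (Function.update (Function.update σ x k) y l)
        rw [casimir_mulVec hxy, Pi.smul_apply, smul_eq_mul] at h1
        simp only [Function.update_self, Function.update_of_ne hxy,
          Function.update_comm hxy.symm, Function.update_idem] at h1
        simp only [φ, Fin.ofNat_val_eq_self]
        push_cast
        linear_combination (1 / 2 : ℂ) * h1)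
    set a := upCount (Function.update (q x) i 1) with ha
    set b := upCount (q y) with hb
    have hqx : upCount (q x) = a + 1 := by
      have := upCount_update (Function.update (q x) i 1) (j := i) (by simp)
      rwa [Function.update_idem, ← hx, Function.update_eq_self] at this
    have hqy : upCount (Function.update (q y) j 0) = b + 1 := upCount_update _ hy
    have hal : a < g + 2 := by
      have h1 := upCount_le (q x)
      have h2 : Fintype.card (Leg g) = g + 2 := by simp
      omega
    have hbl : b < g + 2 := by
      have h1 := upCount_le (Function.update (q y) j 0)
      have h2 : Fintype.card (Leg g) = g + 2 := by simp
      omega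
    set q' := swapLegs (x, i) (y, j) q with hq'
    rw [swapLegs_eq hxy, hx, hy] at hq'
    have hx' : upCount (q' x) = a := by
      rw [hq', Function.update_of_ne hxy, Function.update_self]
    have hy' : upCount (q' y) = b + 1 := by
      rw [hq', Function.update_self, hqy]
    have hv' : ∀ v, v ≠ x → v ≠ y → q' v = q v := by
      intro v h1 h2
      rw [hq', Function.update_of_ne h2, Function.update_of_ne h1]
    have h1 : φ (a + 1) b = ψ (upCfg q) := by
      simp only [φ]
      congr 1
      funext v
      by_cases h2 : v = y
      · subst h2
        rw [Function.update_self]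
        ext
        simp only [Fin.ofNat, upCfg, ← hb]
        exact Nat.mod_eq_of_lt (by omega)
      · rw [Function.update_of_ne h2]
        by_cases h3 : v = x
        · subst h3
          rw [Function.update_self]
          ext
          simp only [Fin.ofNat, upCfg, hqx]
          exact Nat.mod_eq_of_lt (by omega)
        · rw [Function.update_of_ne h3]
    have h2 : φ a (b + 1) = ψ (upCfg q') := by
      simp only [φ]
      congr 1
      funext v
      by_cases h2 : v = y
      · subst h2
        rw [Function.update_self]
        ext
        simp only [Fin.ofNat, upCfg, hy']
        exact Nat.mod_eq_of_lt (by omega)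
      · rw [Function.update_of_ne h2]
        by_cases h3 : v = x
        · subst h3
          rw [Function.update_self]
          ext
          simp only [Fin.ofNat, upCfg, hx']
          exact Nat.mod_eq_of_lt (by omega)
        · rw [Function.update_of_ne h3]
          ext
          simp only [hσ, upCfg, hv' v h3 h2]
    have h3 : ∀ f : Λ → ℂ, ∏ v, f v = f x * (f y * ∏ v ∈ (Finset.univ.erase x).erase y, f v) := by
      intro f
      rw [Finset.mul_prod_erase _ _ (Finset.mem_erase.2 ⟨hxy.symm, Finset.mem_univ y⟩),
        Finset.mul_prod_erase _ _ (Finset.mem_univ x)]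
    have h4 := hφ hal hbl
    rw [h1, h2] at h4
    rw [legContract_eq, legContract_eq, h3, h3, hx', hy', hqx]
    have h5 : ∏ v ∈ (Finset.univ.erase x).erase y,
          ((Real.sqrt ((g + 2).choose (upCount (q' v))) : ℝ) : ℂ)⁻¹ =
        ∏ v ∈ (Finset.univ.erase x).erase y,
          ((Real.sqrt ((g + 2).choose (upCount (q v))) : ℝ) : ℂ)⁻¹ := by
      refine Finset.prod_congr rfl fun v hv => ?_
      rw [Finset.mem_erase, Finset.mem_erase] at hv
      rw [hv' v hv.2.1 hv.1]
    rw [h5]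
    rw [mul_inv, mul_inv] at h4
    simp only [hc] at h4
    linear_combination (-∏ v ∈ (Finset.univ.erase x).erase y,
          ((Real.sqrt ((g + 2).choose (upCount (q v))) : ℝ) : ℂ)⁻¹) * h4
  have hq : ∀ a : Fin 2, a = 0 ∨ a = 1 := by decide
  have hself : q x i = q y j → swapLegs (x, i) (y, j) q = q := by
    intro h
    rw [swapLegs_eq hxy, h, ← h, Function.update_eq_self, h, Function.update_eq_self,
      Function.update_eq_self, Function.update_eq_self]
  rcases hq (q x i) with h1 | h1 <;> rcases hq (q y j) with h2 | h2
  · rw [hself (h1.trans h2.symm)]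
  · exact key q h1 h2
  · have h3 := key (swapLegs (x, i) (y, j) q)
      (by simp [swapLegs, Function.uncurry, h2]) (by simp [swapLegs, Function.uncurry, h1])
    rw [swapLegs_swapLegs] at h3
    exact h3.symm
  · rw [hself (h1.trans h2.symm)]

/-- The factor of the bonds in the valence-bond map. -/
noncomputable def bondFactor {g : ℕ} (n : ℕ) (Q : Site g → Leg g → Fin 2)
    (b : Boundary g n → Pair) : ℂ :=
  (∏ w ∈ ball g n, singlet (Q (w, false) none) (Q (w, true) none)) *
    (∏ w ∈ ball g n with w.length ≠ 0, ∏ layer : Bool,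
      singlet (Q (w.parent, layer) w.1.head?) (Q (w, layer) w.1.head?)) *
    (if (fun w : Boundary g n => (Q (w.1.parent, false) w.1.1.head?,
        Q (w.1.parent, true) w.1.1.head?)) = b then 1 else 0)

theorem vbsMap_eq_bondFactor {g n : ℕ} (s : Cfg (volume g n)) (b : Boundary g n → Pair) :
    vbsMap g n s b = ∑ q, (∏ v, symAmp (s v : ℕ) (q v)) * bondFactor n (extLegs q) b := by
  rw [vbsMap_eq]
  refine Finset.sum_congr rfl fun q _ => ?_
  rw [bulkFactor, bondFactor]
  simp only [mul_assoc]
  rfl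

theorem extLegs_swapLegs {g n : ℕ} {x y : volume g n} (i j : Leg g)
    (q : volume g n → Leg g → Fin 2) :
    extLegs (swapLegs (x, i) (y, j) q) = swapLegs ((x : Site g), i) (y, j) (extLegs q) := by
  funext v l
  by_cases hv : v ∈ volume g n
  · rw [extLegs, dif_pos hv]
    simp only [swapLegs, Function.uncurry, Equiv.swap_apply_def, Prod.mk.injEq]
    have e1 : (⟨v, hv⟩ : volume g n) = x ↔ v = x := Subtype.ext_iff
    have e2 : (⟨v, hv⟩ : volume g n) = y ↔ v = y := Subtype.ext_iff
    simp only [e1, e2]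
    split_ifs
    · simp [extLegs]
    · simp [extLegs]
    · simp [extLegs, hv]
  · have h1 : v ≠ x := fun h => hv (h ▸ x.2)
    have h2 : v ≠ y := fun h => hv (h ▸ y.2)
    rw [extLegs, dif_neg hv]
    simp [swapLegs, Function.uncurry, Equiv.swap_apply_def, h1, h2, extLegs, hv]

theorem singlet_comm (a b : Fin 2) : singlet a b = -singlet b a := by
  fin_cases a <;> fin_cases b <;> simp [singlet]

theorem swapLegs_apply_of_ne {A B X : Type} [DecidableEq A] [DecidableEq B] {a b : A × B}
    {q : A → B → X} {v : A} {l : B} (ha : (v, l) ≠ a) (hb : (v, l) ≠ b) :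
    swapLegs a b q v l = q v l := by
  simp only [swapLegs, Function.uncurry]
  rw [Equiv.swap_apply_of_ne_of_ne ha hb]

theorem swapLegs_left {A B X : Type} [DecidableEq A] [DecidableEq B] (v v' : A) (l l' : B)
    (q : A → B → X) : swapLegs (v, l) (v', l') q v l = q v' l' := by
  simp [swapLegs, Function.uncurry]

theorem swapLegs_right {A B X : Type} [DecidableEq A] [DecidableEq B] (v v' : A) (l l' : B)
    (q : A → B → X) : swapLegs (v, l) (v', l') q v' l' = q v l := by
  simp [swapLegs, Function.uncurry]

theorem prod_eq_neg_of_mem {α : Type} [DecidableEq α] {s : Finset α} {f f' : α → ℂ} {a : α}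
    (ha : a ∈ s) (h1 : f a = -f' a) (h2 : ∀ b ∈ s, b ≠ a → f b = f' b) :
    ∏ b ∈ s, f b = -∏ b ∈ s, f' b := by
  rw [← Finset.mul_prod_erase _ _ ha, ← Finset.mul_prod_erase _ _ ha, h1, neg_mul]
  congr 2
  exact Finset.prod_congr rfl fun b hb =>
    h2 b (Finset.mem_of_mem_erase hb) (Finset.ne_of_mem_erase hb)

/-- The singlet of this rung is antisymmetric, and no other factor reads its two legs: tree bonds
and dangling legs carry a colour, never `none`. -/
theorem bondFactor_swap_rung {g n : ℕ} {w₀ : Word g} (hw₀ : w₀.length ≤ n)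
    (Q : Site g → Leg g → Fin 2) (b : Boundary g n → Pair) :
    bondFactor n (swapLegs ((w₀, false), none) ((w₀, true), none) Q) b = -bondFactor n Q b := by
  have h1 : ∀ v (l : Leg g), l ≠ none →
      swapLegs ((w₀, false), none) ((w₀, true), none) Q v l = Q v l := fun v l hl =>
    swapLegs_apply_of_ne (by simp [hl]) (by simp [hl])
  have h2 : ∀ w : Word g, w.length ≠ 0 → w.1.head? ≠ none := by
    intro w hw; rw [Word.head?_eq hw]; simp
  rw [bondFactor, prod_eq_neg_of_mem (a := w₀) (mem_ball.2 hw₀)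
    (f' := fun w => singlet (Q (w, false) none) (Q (w, true) none)), bondFactor, neg_mul, neg_mul]
  · congr 3
    · refine Finset.prod_congr rfl fun w hw => Finset.prod_congr rfl fun l _ => ?_
      have := h2 w (Finset.mem_filter.1 hw).2
      rw [h1 _ _ this, h1 _ _ this]
    · congr 1
      funext w
      have := h2 w.1 (by rw [w.length_eq]; omega)
      rw [h1 _ _ this, h1 _ _ this]
  · rw [swapLegs_left, swapLegs_right, singlet_comm]
  · intro w _ hw
    rw [swapLegs_apply_of_ne (by simp [hw]) (by simp [hw]),
      swapLegs_apply_of_ne (by simp [hw]) (by simp [hw])]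

theorem Word.eq_of_parent_eq {g : ℕ} {w w' : Word g} (h0 : w.length ≠ 0) (h0' : w'.length ≠ 0)
    (h : w.parent = w'.parent) (h' : w.1.head? = w'.1.head?) : w = w' := by
  obtain ⟨l, hl⟩ := w
  obtain ⟨l', hl'⟩ := w'
  cases l with
  | nil => exact absurd rfl h0
  | cons a l =>
    cases l' with
    | nil => exact absurd rfl h0'
    | cons a' l' =>
      simp only [Word.parent, List.tail_cons, Subtype.mk.injEq] at h
      simp only [List.head?_cons, Option.some.injEq] at h'
      subst h h'
      rfl

theorem Word.head?_ne_of_parent {g : ℕ} {w : Word g} (h0 : w.length ≠ 0) :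
    w.1.head? ≠ w.parent.1.head? := by
  obtain ⟨l, hl⟩ := w
  cases l with
  | nil => exact absurd rfl h0
  | cons a l =>
    cases l with
    | nil => simp [Word.parent]
    | cons a' l =>
      rw [List.isChain_cons_cons] at hl
      simp [Word.parent, hl.1]

/-- Again one singlet changes sign. No other bond uses these legs: a parent and a colour determine
the child, and consecutive letters of a reduced word differ, so the leg to the parent is never a leg
to a child. -/
theorem bondFactor_swap_edge {g n : ℕ} {w₀ : Word g} (hw₀ : w₀.length ≤ n) (h0 : w₀.length ≠ 0)
    (l₀ : Bool) (Q : Site g → Leg g → Fin 2) (b : Boundary g n → Pair) :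
    bondFactor n (swapLegs ((w₀.parent, l₀), w₀.1.head?) ((w₀, l₀), w₀.1.head?) Q) b =
      -bondFactor n Q b := by
  have hsome := Word.head?_eq h0
  set Q' := swapLegs ((w₀.parent, l₀), w₀.1.head?) ((w₀, l₀), w₀.1.head?) Q with hQ'
  have hpar : ∀ (w : Word g) (l : Bool), w.length ≠ 0 → (w = w₀ → l ≠ l₀) →
      Q' (w.parent, l) w.1.head? = Q (w.parent, l) w.1.head? := by
    intro w l hw hne
    refine swapLegs_apply_of_ne ?_ ?_
    · intro h
      simp only [Prod.mk.injEq] at h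
      exact hne (Word.eq_of_parent_eq hw h0 h.1.1 h.2) h.1.2
    · intro h
      simp only [Prod.mk.injEq] at h
      refine Word.head?_ne_of_parent hw ?_
      rw [h.1.1, h.2]
  have hchild : ∀ (w : Word g) (l : Bool), w.length ≠ 0 → (w = w₀ → l ≠ l₀) →
      Q' (w, l) w.1.head? = Q (w, l) w.1.head? := by
    intro w l hw hne
    refine swapLegs_apply_of_ne ?_ ?_
    · intro h
      simp only [Prod.mk.injEq] at h
      refine Word.head?_ne_of_parent h0 ?_
      rw [← h.1.1, h.2]
    · intro h
      simp only [Prod.mk.injEq] at h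
      exact hne h.1.1 h.1.2
  have h1 : ∏ w ∈ ball g n with w.length ≠ 0, ∏ layer : Bool,
      singlet (Q' (w.parent, layer) w.1.head?) (Q' (w, layer) w.1.head?) =
      -∏ w ∈ ball g n with w.length ≠ 0, ∏ layer : Bool,
      singlet (Q (w.parent, layer) w.1.head?) (Q (w, layer) w.1.head?) := by
    refine prod_eq_neg_of_mem (a := w₀) (Finset.mem_filter.2 ⟨mem_ball.2 hw₀, h0⟩) ?_ ?_
    · refine prod_eq_neg_of_mem (a := l₀) (Finset.mem_univ _) ?_ ?_
      · rw [hQ', swapLegs_left, swapLegs_right, singlet_comm]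
      · intro l _ hl
        rw [hpar w₀ l h0 fun _ => hl, hchild w₀ l h0 fun _ => hl]
    · intro w hw hne
      have hw' := (Finset.mem_filter.1 hw).2
      refine Finset.prod_congr rfl fun l _ => ?_
      rw [hpar w l hw' fun h => absurd h hne, hchild w l hw' fun h => absurd h hne]
  have h2 : ∀ v, Q' v none = Q v none := fun v =>
    swapLegs_apply_of_ne
      (fun h => by have h' := congrArg Prod.snd h; rw [hsome] at h'; exact Option.some_ne_none _ h'.symm)
      (fun h => by have h' := congrArg Prod.snd h; rw [hsome] at h'; exact Option.some_ne_none _ h'.symm)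
  have h3 : (fun w : Boundary g n => (Q' (w.1.parent, false) w.1.1.head?,
      Q' (w.1.parent, true) w.1.1.head?)) = fun w => (Q (w.1.parent, false) w.1.1.head?,
      Q (w.1.parent, true) w.1.1.head?) := by
    funext w
    have hl := w.length_eq
    have hne : w.1 ≠ w₀ := by rintro h; rw [h] at hl; omega
    rw [hpar w.1 _ (by omega) fun h => absurd h hne, hpar w.1 _ (by omega) fun h => absurd h hne]
  rw [bondFactor, h1, bondFactor, h3]
  simp only [h2]
  ring


/-- A sum over the legs of a symmetric factor times an antisymmetric one: the substitution
`swapLegs` maps it to its negative. -/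
theorem sum_mul_vbsMap_eq_zero {g n : ℕ} {x y : volume g n} (hxy : x ≠ y) {i j : Leg g}
    (hbond : ∀ (Q : Site g → Leg g → Fin 2) (b : Boundary g n → Pair),
      bondFactor n (swapLegs ((x : Site g), i) (y, j) Q) b = -bondFactor n Q b)
    {ψ : Cfg (volume g n) → ℂ}
    (hψ : casimir x y *ᵥ ψ = (((g : ℂ) + 2) * ((g : ℂ) + 3)) • ψ) (b : Boundary g n → Pair) :
    ∑ s, ψ s * vbsMap g n s b = 0 := by
  have h1 : ∑ s, ψ s * vbsMap g n s b =
      ∑ q, legContract ψ q * bondFactor n (extLegs q) b := by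
    simp only [vbsMap_eq_bondFactor, legContract, Finset.mul_sum, Finset.sum_mul, mul_assoc]
    rw [Finset.sum_comm]
  have h2 : ∑ q, legContract ψ q * bondFactor n (extLegs q) b =
      -∑ q, legContract ψ q * bondFactor n (extLegs q) b := by
    have hinv : Function.Involutive
        (swapLegs (X := Fin 2) (x, i) (y, j)) := swapLegs_swapLegs _ _
    conv_lhs => rw [← Equiv.sum_comp (Function.Involutive.toPerm _ hinv)]
    rw [← Finset.sum_neg_distrib]
    refine Finset.sum_congr rfl fun q _ => ?_
    rw [Function.Involutive.coe_toPerm, legContract_swapLegs hxy i j hψ, extLegs_swapLegs, hbond,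
      mul_neg]
  rw [h1]
  exact self_eq_neg.1 h2

theorem exists_bond_of_adj {g n : ℕ} {x y : volume g n} (h : (bilayerTree g).Adj x y) :
    ∃ i j : Leg g, ∀ (Q : Site g → Leg g → Fin 2) (b : Boundary g n → Pair),
      bondFactor n (swapLegs ((x : Site g), i) (y, j) Q) b = -bondFactor n Q b := by
  have hcomm : ∀ (a b : Site g × Leg g) (Q : Site g → Leg g → Fin 2),
      swapLegs a b Q = swapLegs b a Q := by
    intro a b Q
    funext v l
    simp only [swapLegs, Equiv.swap_comm a b]
  obtain ⟨⟨w, l⟩, hx⟩ := x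
  obtain ⟨⟨w', l'⟩, hy⟩ := y
  have hx' := mem_volume.1 hx
  have hy' := mem_volume.1 hy
  have hedge : ∀ {u v : Word g}, (∃ c, v.1 = c :: u.1) → v.length ≠ 0 ∧ v.parent = u := by
    rintro u v ⟨c, hc⟩
    refine ⟨by simp [Word.length, hc], Subtype.ext ?_⟩
    simp [Word.parent, hc]
  simp only [bilayerTree, SimpleGraph.boxProd_adj, cayleyTree, SimpleGraph.fromRel_adj,
    SimpleGraph.top_adj] at h
  rcases h with ⟨⟨_, h | h⟩, hl⟩ | ⟨hl, hw⟩
  · obtain ⟨h1, h2⟩ := hedge h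
    subst hl
    refine ⟨w'.1.head?, w'.1.head?, fun Q b => ?_⟩
    have := bondFactor_swap_edge hy' h1 l Q b
    rwa [h2] at this
  · obtain ⟨h1, h2⟩ := hedge h
    subst hl
    refine ⟨w.1.head?, w.1.head?, fun Q b => ?_⟩
    have := bondFactor_swap_edge hx' h1 l Q b
    rwa [h2, hcomm] at this
  · subst hw
    refine ⟨none, none, fun Q b => ?_⟩
    have := bondFactor_swap_rung hx' Q b
    cases l <;> cases l'
    · exact absurd rfl hl
    · exact this
    · rwa [hcomm] at this
    · exact absurd rfl hl

theorem star_vbsMap {g n : ℕ} (s : Cfg (volume g n)) (b : Boundary g n → Pair) :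
    star (vbsMap g n s b) = vbsMap g n s b := by
  have h1 : ∀ a b, star (singlet a b) = singlet a b := by
    intro a b; fin_cases a <;> fin_cases b <;> simp [singlet]
  have h2 : ∀ p : Prop, ∀ _ : Decidable p, star (if p then (1 : ℂ) else 0) = if p then 1 else 0 := by
    intro p _; split_ifs <;> simp
  rw [vbsMap_eq_bondFactor]
  simp only [bondFactor, star_sum, star_mul', star_prod, star_symAmp, h1, h2]

theorem edgeProj_mul_vbsMap {g n : ℕ} {x y : volume g n} (h : (bilayerTree g).Adj x y) :
    edgeProj x y * vbsMap g n = 0 := by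
  have hxy : x ≠ y := fun e => h.ne (by rw [e])
  obtain ⟨i, j, hbond⟩ := exists_bond_of_adj h
  set K := Module.End.eigenspace (Matrix.toEuclideanLin (casimir x y))
      (((g : ℂ) + 2) * ((g : ℂ) + 3)) with hK
  ext s b
  -- Each column of the valence-bond map is orthogonal to the maximal-spin eigenspace. Its entries
  -- are real, so conjugating the bilinear identity gives the inner product.
  have hmem : (WithLp.toLp 2 fun s => vbsMap g n s b : EuclideanSpace ℂ (Cfg (volume g n))) ∈ Kᗮ := by
    rw [Submodule.mem_orthogonal]
    intro ψ hψ
    rw [hK, Module.End.mem_eigenspace_iff] at hψ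
    have hψ' := congrArg WithLp.ofLp hψ
    rw [Matrix.ofLp_toLpLin, Matrix.toLin'_apply, WithLp.ofLp_smul] at hψ'
    have h0 := congrArg star (sum_mul_vbsMap_eq_zero hxy hbond hψ' b)
    simp only [star_sum, star_mul', star_vbsMap, star_zero] at h0
    rw [EuclideanSpace.inner_eq_star_dotProduct, dotProduct]
    rw [← h0]
    refine Finset.sum_congr rfl fun s _ => ?_
    rw [Pi.star_apply, mul_comm]
  have hproj := (Submodule.starProjection_apply_eq_zero_iff K).2 hmem
  have h1 : Matrix.toEuclideanLin (edgeProj x y) = K.starProjection.toLinearMap := by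
    rw [edgeProj, LinearEquiv.apply_symm_apply]
  have h2 := Matrix.ofLp_toLpLin 2 2 (edgeProj x y)
    (WithLp.toLp 2 fun s => vbsMap g n s b)
  rw [Matrix.toLin'_apply] at h2
  rw [h1] at h2
  have h3 := congrFun h2 s
  rw [ContinuousLinearMap.coe_coe, hproj] at h3
  exact h3.symm

theorem hamiltonian_mul_vbsMap (g n : ℕ) : hamiltonian (volume g n) * vbsMap g n = 0 := by
  rw [hamiltonian, Matrix.smul_mul, Matrix.sum_mul, Finset.sum_eq_zero, smul_zero]
  intro x _
  rw [Matrix.sum_mul, Finset.sum_eq_zero]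
  intro y _
  split_ifs with h
  · exact edgeProj_mul_vbsMap h
  · exact Matrix.zero_mul _

open scoped MatrixOrder Matrix.Norms.L2Operator in
theorem tensorProd_posSemidef {ι : Type} [Fintype ι] [DecidableEq ι] {M : Matrix Pair Pair ℂ}
    (hM : M.PosSemidef) : (tensorProd fun _ : ι => M).PosSemidef := by
  obtain ⟨C, hC⟩ := CStarAlgebra.nonneg_iff_eq_star_mul_self.mp hM.nonneg
  have hC' : M = Cᴴ * C := hC
  rw [hC', ← tensorProd_mul, ← tensorProd_conjTranspose]
  exact Matrix.posSemidef_conjTranspose_mul_self _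

theorem boundaryState_isFiniteVolumeGroundState {g n : ℕ} {M : Matrix Pair Pair ℂ}
    (hM : M.PosSemidef) (h0 : 0 < expect (1 : Obs (volume g n)) fun _ => M) :
    IsFiniteVolumeGroundState (boundaryState g n (tensorPow (Boundary g n) M)) := by
  have htr : (vbsMap g n * tensorPow (Boundary g n) M * (vbsMap g n)ᴴ).trace =
      expect (1 : Obs (volume g n)) fun _ => M := by
    rw [expect, Matrix.mul_one, tensorPow_eq]
  refine ⟨?_, ?_, ?_⟩
  · rw [boundaryState, htr]
    exact ((tensorProd_posSemidef hM).mul_mul_conjTranspose_same _).smul (inv_nonneg.2 h0.le)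
  · rw [boundaryState, Matrix.trace_smul, htr, smul_eq_mul, inv_mul_cancel₀ h0.ne']
  · rw [boundaryState, Matrix.mul_smul, Matrix.mul_assoc (vbsMap g n),
      ← Matrix.mul_assoc (hamiltonian _), hamiltonian_mul_vbsMap, Matrix.zero_mul, smul_zero]


/-! ### The contraction of a node by counting spins up -/

/-- `1` for spin up and `0` for spin down. -/
def upOne (a : Fin 2) : ℕ := if a = 0 then 1 else 0

/-- The contraction of one leg pair with `M`, on functions of the numbers of legs with spin up
(in each layer, for the ket and for the bra). -/
noncomputable def stepOp (M : Matrix Pair Pair ℂ) (f : ℕ → ℕ → ℕ → ℕ → ℂ) : ℕ → ℕ → ℕ → ℕ → ℂ :=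
  fun m n m' n' => ∑ p : Pair, ∑ p' : Pair, M p p' *
    f (upOne p.1 + m) (upOne p.2 + n) (upOne p'.1 + m') (upOne p'.2 + n')

/-- The contraction of the physical spin of a site, weighted with `φ`. -/
noncomputable def siteKernel (d : ℕ) (φ : ℕ → ℂ) (m m' : ℕ) : ℂ :=
  if m = m' then φ m * ((d.choose m : ℕ) : ℂ)⁻¹ else 0

/-- The contraction of the physical spins and of the rung of a node. -/
noncomputable def nodeKernel (g : ℕ) (φ φ' : ℕ → ℂ) : ℕ → ℕ → ℕ → ℕ → ℂ := fun m n m' n' =>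
  siteKernel (g + 2) φ (1 + m) (1 + m') * siteKernel (g + 2) φ' n n' -
  siteKernel (g + 2) φ (1 + m) m' * siteKernel (g + 2) φ' n (1 + n') -
  siteKernel (g + 2) φ m (1 + m') * siteKernel (g + 2) φ' (1 + n) n' +
  siteKernel (g + 2) φ m m' * siteKernel (g + 2) φ' (1 + n) (1 + n')

/-- The integrand depends on the legs only through four numbers of ups, so the exponentially large
sum is performed one leg pair at a time. The explicit evaluation of the transfer operator rests on
this reduction. -/
theorem sum_tensorProd_upCount (M : Matrix Pair Pair ℂ) (k : ℕ → ℕ → ℕ → ℕ → ℂ) (n : ℕ) :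
    ∀ m₁ m₂ m₁' m₂', ∑ b : Fin n → Pair, ∑ b' : Fin n → Pair, tensorProd (fun _ => M) b b' *
        k (upCount (fun i => (b i).1) + m₁) (upCount (fun i => (b i).2) + m₂)
          (upCount (fun i => (b' i).1) + m₁') (upCount (fun i => (b' i).2) + m₂') =
      (stepOp M)^[n] k m₁ m₂ m₁' m₂' := by
  induction n generalizing k with
  | zero =>
    intro m₁ m₂ m₁' m₂'
    have h : ∀ q : Fin 0 → Fin 2, upCount q = 0 := fun q => by simp [upCount]
    simp [tensorProd_apply, h]
  | succ n ih =>
    intro m₁ m₂ m₁' m₂'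
    have hc : ∀ (p : Pair) (b : Fin n → Pair),
        (fun i => ((Fin.cons p b : Fin (n + 1) → Pair) i).1) =
          (Fin.cons p.1 fun i => (b i).1 : Fin (n + 1) → Fin 2) ∧
        (fun i => ((Fin.cons p b : Fin (n + 1) → Pair) i).2) =
          (Fin.cons p.2 fun i => (b i).2 : Fin (n + 1) → Fin 2) := by
      intro p b
      constructor <;> (funext i; refine Fin.cases ?_ (fun i => ?_) i <;> simp)
    rw [Function.iterate_succ_apply', sum_fin_cons]
    simp only [sum_fin_cons (n := n), (hc _ _).1, (hc _ _).2, upCount_cons, tensorProd_apply,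
      Fin.prod_univ_succ, Fin.cons_zero, Fin.cons_succ]
    rw [stepOp]
    refine Finset.sum_congr rfl fun p _ => ?_
    rw [Finset.sum_comm]
    refine Finset.sum_congr rfl fun p' _ => ?_
    rw [← ih]
    simp only [Finset.mul_sum, tensorProd_apply]
    refine Finset.sum_congr rfl fun b _ => Finset.sum_congr rfl fun b' _ => ?_
    rw [mul_assoc]
    congr 3 <;> simp only [upOne] <;> omega

theorem star_nodeAmp {g : ℕ} (s : NodeCfg g) (b : Fin (g + 1) → Pair) :
    star (nodeAmp g s b) = nodeAmp g s b := by
  have h1 : ∀ a b, star (singlet a b) = singlet a b := by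
    intro a b; fin_cases a <;> fin_cases b <;> simp [singlet]
  simp only [nodeAmp, star_sum, star_mul', star_symAmp, h1]

theorem nodeAmp_apply {g : ℕ} (s : NodeCfg g) (b : Fin (g + 1) → Pair) : nodeAmp g s b =
    symAmp (s.1 : ℕ) (Fin.cons 0 fun i => (b i).1 : Fin (g + 2) → Fin 2) *
      symAmp (s.2 : ℕ) (Fin.cons 1 fun i => (b i).2 : Fin (g + 2) → Fin 2) -
    symAmp (s.1 : ℕ) (Fin.cons 1 fun i => (b i).1 : Fin (g + 2) → Fin 2) *
      symAmp (s.2 : ℕ) (Fin.cons 0 fun i => (b i).2 : Fin (g + 2) → Fin 2) := by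
  rw [nodeAmp, Fintype.sum_prod_type]
  simp [singlet, sub_eq_add_neg]

/-- The rung singlet has two terms in the ket and two in the bra. In each of the four products the
two sites decouple and `sum_symAmp_mul` evaluates them. -/
theorem sum_nodeAmp_mul {g : ℕ} (φ φ' : ℕ → ℂ) (b b' : Fin (g + 1) → Pair) :
    ∑ s : NodeCfg g, φ s.1 * φ' s.2 * (nodeAmp g s b * nodeAmp g s b') =
      nodeKernel g φ φ' (upCount fun i => (b i).1) (upCount fun i => (b i).2)
        (upCount fun i => (b' i).1) (upCount fun i => (b' i).2) := by
  have hs : ∀ (φ : ℕ → ℂ) (q q' : Fin (g + 2) → Fin 2), siteKernel (g + 2) φ (upCount q)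
      (upCount q') = ∑ k : Fin (g + 3), φ k * (symAmp (k : ℕ) q * symAmp (k : ℕ) q') :=
    fun φ q q' => (sum_symAmp_mul (Fintype.card_fin _) φ q q').symm
  have hup : ∀ q : Fin (g + 1) → Fin 2, 1 + upCount q =
      upCount (Fin.cons 0 q : Fin (g + 2) → Fin 2) := fun q => by simp [upCount_cons]
  have hdn : ∀ q : Fin (g + 1) → Fin 2, upCount q =
      upCount (Fin.cons 1 q : Fin (g + 2) → Fin 2) := fun q => by simp [upCount_cons]
  rw [nodeKernel]
  simp only [hup]
  rw [hdn fun i => (b i).1, hdn fun i => (b i).2, hdn fun i => (b' i).1, hdn fun i => (b' i).2]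
  simp only [hs, nodeAmp_apply, Finset.sum_mul_sum]
  rw [Fintype.sum_prod_type]
  simp only [← Finset.sum_sub_distrib, ← Finset.sum_add_distrib]
  refine Finset.sum_congr rfl fun k _ => Finset.sum_congr rfl fun l _ => ?_
  ring

theorem nodeFun_diagonal {g : ℕ} (φ φ' : ℕ → ℂ) (Y M : Matrix Pair Pair ℂ) :
    nodeFun (g := g) (Matrix.diagonal fun s => φ s.1 * φ' s.2) (Fin.cons Y fun _ => M) =
      stepOp Y ((stepOp M)^[g] (nodeKernel g φ φ')) 0 0 0 0 := by
  have hc : ∀ (p : Pair) (b : Fin g → Pair),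
      (fun i => ((Fin.cons p b : Fin (g + 1) → Pair) i).1) =
        (Fin.cons p.1 fun i => (b i).1 : Fin (g + 1) → Fin 2) ∧
      (fun i => ((Fin.cons p b : Fin (g + 1) → Pair) i).2) =
        (Fin.cons p.2 fun i => (b i).2 : Fin (g + 1) → Fin 2) := by
    intro p b
    constructor <;> (funext i; refine Fin.cases ?_ (fun i => ?_) i <;> simp)
  rw [nodeFun, trace_contract]
  simp only [star_nodeAmp, Matrix.diagonal_apply, ite_mul, zero_mul, Finset.sum_ite_eq',
    Finset.mem_univ, if_true, sum_nodeAmp_mul]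
  rw [sum_fin_cons]
  simp only [sum_fin_cons (n := g), (hc _ _).1, (hc _ _).2, upCount_cons, tensorProd_apply,
      Fin.prod_univ_succ, Fin.cons_zero, Fin.cons_succ]
  rw [stepOp]
  refine Finset.sum_congr rfl fun p _ => ?_
  rw [Finset.sum_comm]
  refine Finset.sum_congr rfl fun p' _ => ?_
  rw [← sum_tensorProd_upCount]
  simp only [Finset.mul_sum, tensorProd_apply]
  refine Finset.sum_congr rfl fun b _ => Finset.sum_congr rfl fun b' _ => ?_
  rw [mul_assoc]
  congr 3 <;> simp only [upOne] <;> omega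


/-! ### The transfer operator on matrices that are invariant under rotations about an axis -/

/-- The matrices with the diagonal entries `a, b, c, a` and the only other nonzero entry `d` in the
two places between `↑↓` and `↓↑`. -/
def zMat (a b c d : ℂ) : Matrix Pair Pair ℂ := fun p p' =>
  if p = p' then (if p.1 = p.2 then a else if p.1 = 0 then b else c)
  else if p = p'.swap then d else 0

theorem stepOp_zMat (a b c d : ℂ) (f : ℕ → ℕ → ℕ → ℕ → ℂ) (m n m' n' : ℕ) :
    stepOp (zMat a b c d) f m n m' n' =
      a * f (1 + m) (1 + n) (1 + m') (1 + n') + a * f m n m' n' +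
      b * f (1 + m) n (1 + m') n' + c * f m (1 + n) m' (1 + n') +
      d * f (1 + m) n m' (1 + n') + d * f m (1 + n) (1 + m') n' := by
  simp [stepOp, zMat, Fintype.sum_prod_type, upOne]
  ring

theorem stepOp_zMat_eq_zero {a b c d : ℂ} {f : ℕ → ℕ → ℕ → ℕ → ℂ}
    (hf : ∀ m n m' n', m + n ≠ m' + n' → f m n m' n' = 0) (m n m' n' : ℕ)
    (h : m + n ≠ m' + n') : stepOp (zMat a b c d) f m n m' n' = 0 := by
  rw [stepOp_zMat]
  rw [hf, hf, hf, hf, hf, hf] <;> first | omega | ring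

/-- Conservation of the third spin component: the rung singlet adds exactly one up to the ket and
one to the bra, and diagonal weights do not change the counts. -/
theorem nodeKernel_eq_zero {g : ℕ} {φ φ' : ℕ → ℂ} (m n m' n' : ℕ) (h : m + n ≠ m' + n') :
    nodeKernel g φ φ' m n m' n' = 0 := by
  have hs : ∀ (p q p' q' : ℕ), p + q ≠ p' + q' →
      siteKernel (g + 2) φ p p' * siteKernel (g + 2) φ' q q' = 0 := by
    intro p q p' q' hne
    simp only [siteKernel]
    split_ifs <;> first | omega | simp
  rw [nodeKernel, hs _ _ _ _ (by omega), hs _ _ _ _ (by omega), hs _ _ _ _ (by omega),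
    hs _ _ _ _ (by omega)]
  simp

theorem iterate_stepOp_zMat_eq_zero {g : ℕ} {φ φ' : ℕ → ℂ} {a b c d : ℂ} (k : ℕ) (m n m' n' : ℕ)
    (h : m + n ≠ m' + n') : (stepOp (zMat a b c d))^[k] (nodeKernel g φ φ') m n m' n' = 0 := by
  induction k generalizing m n m' n' with
  | zero => exact nodeKernel_eq_zero _ _ _ _ h
  | succ k ih =>
    rw [Function.iterate_succ_apply']
    exact stepOp_zMat_eq_zero ih _ _ _ _ h

theorem pairing_zMat (Y : Matrix Pair Pair ℂ) (a b c d : ℂ) : pairing Y (zMat a b c d) =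
    Y (0, 0) (0, 0) * a + Y (1, 1) (1, 1) * a + Y (0, 1) (0, 1) * c + Y (1, 0) (1, 0) * b +
      Y (0, 1) (1, 0) * d + Y (1, 0) (0, 1) * d := by
  simp [pairing, trace_mul_eq_sum, pairSinglet, singlet, Matrix.mul_apply, Fintype.sum_prod_type,
    zMat]
  ring

theorem nodeFun_const_zMat (φ : ℕ → ℂ) (Y : Matrix Pair Pair ℂ) (a b c d : ℂ) :
    nodeFun (g := 3) (Matrix.diagonal fun s => φ s.1 * 1) (Fin.cons Y fun _ => zMat a b c d) =
      Y (0, 0) (0, 0) * (stepOp (zMat a b c d))^[3] (nodeKernel 3 φ fun _ => 1) 1 1 1 1 +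
      Y (1, 1) (1, 1) * (stepOp (zMat a b c d))^[3] (nodeKernel 3 φ fun _ => 1) 0 0 0 0 +
      Y (0, 1) (0, 1) * (stepOp (zMat a b c d))^[3] (nodeKernel 3 φ fun _ => 1) 1 0 1 0 +
      Y (1, 0) (1, 0) * (stepOp (zMat a b c d))^[3] (nodeKernel 3 φ fun _ => 1) 0 1 0 1 +
      Y (0, 1) (1, 0) * (stepOp (zMat a b c d))^[3] (nodeKernel 3 φ fun _ => 1) 1 0 0 1 +
      Y (1, 0) (0, 1) * (stepOp (zMat a b c d))^[3] (nodeKernel 3 φ fun _ => 1) 0 1 1 0 := by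
  have h0 : ∀ m n m' n', m + n ≠ m' + n' →
      (stepOp (zMat a b c d))^[3] (nodeKernel 3 φ fun _ => 1) m n m' n' = 0 :=
    fun m n m' n' h => iterate_stepOp_zMat_eq_zero 3 m n m' n' h
  rw [nodeFun_diagonal φ (fun _ => 1), stepOp]
  generalize (stepOp (zMat a b c d))^[3] (nodeKernel 3 φ fun _ => 1) = f at h0 ⊢
  simp [Fintype.sum_prod_type, upOne, h0]
  ring

/-- Tested against an arbitrary `Y`, conservation leaves six contractions. Each is a finite
computation with counts, and the coincidences among them show that the form `zMat` is preserved. -/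
theorem transferOp_zMat (a b c d : ℂ) :
    transferOp (g := 3) 1 (fun _ => zMat a b c d) = zMat
      ((31*a^3+69/2*a^2*b+69/2*a^2*c-21*a^2*d+51/2*a*b^2+18*a*b*c-18*a*b*d+51/2*a*c^2-18*a*c*d
        +18*a*d^2+11*b^3+9/2*b^2*c-6*b^2*d+9/2*b*c^2-6*b*c*d+9*b*d^2+11*c^3-6*c^2*d+9*c*d^2
        -3*d^3)/50)
      ((23*a^3+18*a^2*b+51*a^2*c-18*a^2*d+9*a*b^2+18*a*b*c-12*a*b*d+66*a*c^2-24*a*c*d+18*a*d^2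
        +5/2*b^3+3*b^2*c-3*b^2*d+15/2*b*c^2-6*b*c*d+6*b*d^2+52*c^3-12*c^2*d+15*c*d^2-3*d^3)/50)
      ((23*a^3+18*a^2*c+51*a^2*b-18*a^2*d+9*a*c^2+18*a*b*c-12*a*c*d+66*a*b^2-24*a*b*d+18*a*d^2
        +5/2*c^3+3*c^2*b-3*c^2*d+15/2*c*b^2-6*b*c*d+6*c*d^2+52*b^3-12*b^2*d+15*b*d^2-3*d^3)/50)
      ((-7*a^3-9*a^2*b-9*a^2*c+18*a^2*d-6*a*b^2-6*a*b*c+18*a*b*d-6*a*c^2+18*a*c*d-9*a*d^2-2*b^3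
        -3/2*b^2*c+15/2*b^2*d-3/2*b*c^2+6*b*c*d-9/2*b*d^2-2*c^3+15/2*c^2*d-9/2*c*d^2+3*d^3)/50) := by
  refine eq_of_pairing_eq fun Y => ?_
  have h1 : (1 : Matrix (NodeCfg 3) (NodeCfg 3) ℂ) = Matrix.diagonal fun s =>
      (fun _ : ℕ => (1 : ℂ)) s.1 * 1 := by simp
  rw [← nodeFun_cons, h1]
  refine (nodeFun_const_zMat (fun _ => 1) Y a b c d).trans ?_
  rw [pairing_zMat]
  -- Separates the six polynomial identities, so that each is expanded on its own.
  have key : ∀ {y₁ y₂ y₃ y₄ y₅ y₆ f₁ f₂ f₃ f₄ f₅ f₆ e₁ e₃ e₄ e₅ : ℂ}, f₁ = e₁ → f₂ = e₁ → f₃ = e₃ →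
      f₄ = e₄ → f₅ = e₅ → f₆ = e₅ → y₁ * f₁ + y₂ * f₂ + y₃ * f₃ + y₄ * f₄ + y₅ * f₅ + y₆ * f₆ =
        y₁ * e₁ + y₂ * e₁ + y₃ * e₃ + y₄ * e₄ + y₅ * e₅ + y₆ * e₅ := by
    rintro _ _ _ _ _ _ _ _ _ _ _ _ _ _ _ _ rfl rfl rfl rfl h₅ h₆
    rw [h₅, h₆]
  apply key <;>
  · simp only [Function.iterate_succ, Function.iterate_zero, Function.comp, id, stepOp_zMat,
      nodeKernel, siteKernel]
    norm_num [Nat.choose]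
    ring

theorem nodeFun_spin_zMat (t p q : ℂ) :
    nodeFun (g := 3) (Matrix.diagonal fun s => (((s.1 : ℕ) : ℂ) - 5 / 2) * 1) (fun _ =>
      zMat (1 - q - 2 * p) (1 + 2 * t + q + 2 * p) (1 - 2 * t + q + 2 * p) (-2 * (q - p))) =
    t * (20736*t^2*p+12096*t^2*q+20160*t^2+14208*p^3+19008*p^2*q+33600*p^2+10080*p*q^2+25536*p*q
      +23520*p+3360*q^3+13440*q^2+16800*q+11200)/100 := by
  have h := nodeFun_const_zMat (fun k => (k : ℂ) - 5 / 2)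
    (zMat (1 - q - 2 * p) (1 + 2 * t + q + 2 * p) (1 - 2 * t + q + 2 * p) (-2 * (q - p)))
    (1 - q - 2 * p) (1 + 2 * t + q + 2 * p) (1 - 2 * t + q + 2 * p) (-2 * (q - p))
  have hc : ∀ M : Matrix Pair Pair ℂ, (Fin.cons M fun _ => M : Fin 4 → Matrix Pair Pair ℂ) =
      fun _ => M := by
    intro M; funext i; refine Fin.cases ?_ (fun i => ?_) i <;> simp
  rw [hc] at h
  rw [h]
  -- The contraction is expanded in four free entries first; substituting their expressions only
  -- afterwards keeps the polynomial small.
  generalize ha : 1 - q - 2 * p = a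
  generalize hb : 1 + 2 * t + q + 2 * p = b
  generalize hc : 1 - 2 * t + q + 2 * p = c
  generalize hd : -2 * (q - p) = d
  simp only [Function.iterate_succ, Function.iterate_zero, Function.comp, id, stepOp_zMat,
      nodeKernel, siteKernel]
  norm_num [Nat.choose, zMat]
  subst ha hb hc hd
  ring


/-! ### Existence of the alternating boundary condition -/

/-- The polynomials whose common zeros `(3 x₁², x₂, x₃)` are the boundary conditions that are
swapped by the transfer operator. -/
def swapPoly : ℝ × ℝ × ℝ → ℝ × ℝ × ℝ := fun x =>
  (840*x.1*x.2.1 + 600*x.1*x.2.2 + 840*x.1 + 72*x.2.1^3 + 324*x.2.1^2*x.2.2 + 300*x.2.1^2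
      + 90*x.2.2^3 + 210*x.2.2^2 - 150*x.2.2 - 150 - 456*x.2.1*x.2.2 - 840*x.2.1,
    48*x.1*x.2.2 + 168*x.1*x.2.1 + 1332*x.2.1^2*x.2.2 + 1032*x.2.1^3 + 828*x.2.1*x.2.2^2
      + 1824*x.2.1*x.2.2 + 1500*x.2.1^2 + 210*x.2.2^3 + 510*x.2.2^2 + 450*x.2.2 + 900*x.2.1
      - 480*x.1 - 50,
    276*x.1*x.2.2 - 312*x.1*x.2.1 + 72*x.2.1^2*x.2.2 - 552*x.2.1^3 + 270*x.2.1*x.2.2^2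
      + 348*x.2.1*x.2.2 - 912*x.2.1^2 + 210*x.2.2^3 + 510*x.2.2^2 + 450*x.2.2 - 450*x.2.1
      - 60*x.1 - 50)

/-- The Newton map of `swapPoly` with a fixed approximate inverse of the Jacobian. -/
noncomputable def newtonMap : ℝ × ℝ × ℝ → ℝ × ℝ × ℝ := fun x =>
  (x.1 - (1190*(swapPoly x).1 + 388*(swapPoly x).2.1 - 462*(swapPoly x).2.2)/1000000,
    x.2.1 - (250*(swapPoly x).1 + 574*(swapPoly x).2.1 - 620*(swapPoly x).2.2)/1000000,
    x.2.2 - (258*(swapPoly x).1 + 477*(swapPoly x).2.1 + 899*(swapPoly x).2.2)/1000000)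

theorem mul_bounds {x y a b c d : ℝ} (ha : 0 ≤ a) (hc : 0 ≤ c) (hx : a ≤ x ∧ x ≤ b)
    (hy : c ≤ y ∧ y ≤ d) : a * c ≤ x * y ∧ x * y ≤ b * d :=
  ⟨mul_le_mul hx.1 hy.1 hc (ha.trans hx.1),
    mul_le_mul hx.2 hy.2 (hc.trans hy.1) (ha.trans (hx.1.trans hx.2))⟩

/-- The box around the zero of `swapPoly`. -/
def swapBox : Set (ℝ × ℝ × ℝ) := {x | (0.22128 ≤ x.1 ∧ x.1 ≤ 0.22129) ∧
  (0.054628 ≤ x.2.1 ∧ x.2.1 ≤ 0.054638) ∧ (0.153383 ≤ x.2.2 ∧ x.2.2 ≤ 0.153393)}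

/-- Exact divided differences take the place of a derivative and the mean value theorem: the
coordinates are changed from `x` to `y` one after the other. The coefficients are near the entries
of the Jacobian and are bounded by interval arithmetic. -/
theorem swapPoly_sub {x y : ℝ × ℝ × ℝ} (hx : x ∈ swapBox) (hy : y ∈ swapBox) :
    ∃ a₁ a₂ a₃ b₁ b₂ b₃ c₁ c₂ c₃ : ℝ,
      (swapPoly x).1 - (swapPoly y).1 =
        a₁ * (x.1 - y.1) + a₂ * (x.2.1 - y.2.1) + a₃ * (x.2.2 - y.2.2) ∧
      (swapPoly x).2.1 - (swapPoly y).2.1 =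
        b₁ * (x.1 - y.1) + b₂ * (x.2.1 - y.2.1) + b₃ * (x.2.2 - y.2.2) ∧
      (swapPoly x).2.2 - (swapPoly y).2.2 =
        c₁ * (x.1 - y.1) + c₂ * (x.2.1 - y.2.1) + c₃ * (x.2.2 - y.2.2) ∧
      ((976 ≤ a₁ ∧ a₁ ≤ 980) ∧ (-687 ≤ a₂ ∧ a₂ ≤ -683) ∧ (28 ≤ a₃ ∧ a₃ ≤ 32)) ∧
      ((-465 ≤ b₁ ∧ b₁ ≤ -461) ∧ (1430 ≤ b₂ ∧ b₂ ≤ 1434) ∧ (748 ≤ b₃ ∧ b₃ ≤ 752)) ∧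
      ((-36 ≤ c₁ ∧ c₁ ≤ -33) ∧ (-565 ≤ c₂ ∧ c₂ ≤ -561) ∧ (704 ≤ c₃ ∧ c₃ ≤ 708)) := by
  obtain ⟨u, p, q⟩ := x
  obtain ⟨u', p', q'⟩ := y
  obtain ⟨-, hp, hq⟩ := hx
  obtain ⟨hu, hp', hq'⟩ := hy
  simp only at hu hp hq hp' hq'
  have h1 := mul_bounds (by norm_num) (by norm_num) hp hp
  have h2 := mul_bounds (by norm_num) (by norm_num) hp hp'
  have h3 := mul_bounds (by norm_num) (by norm_num) hp' hp'
  have h4 := mul_bounds (by norm_num) (by norm_num) hp hq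
  have h5 := mul_bounds (by norm_num) (by norm_num) hq hp'
  have h6 := mul_bounds (by norm_num) (by norm_num) hp' hq'
  have h7 := mul_bounds (by norm_num) (by norm_num) hq hq
  have h8 := mul_bounds (by norm_num) (by norm_num) hq hq'
  have h9 := mul_bounds (by norm_num) (by norm_num) hq' hq'
  norm_num at h1 h2 h3 h4 h5 h6 h7 h8 h9
  refine ⟨840 + 600*q + 840*p,
    -840 + 300*p' + 72*(p'*p') + 840*u' - 456*q + 324*(q*p') + 300*p + 72*(p*p') + 324*(p*q)
      + 72*(p*p),
    -150 + 210*q' + 90*(q'*q') - 456*p' + 324*(p'*p') + 600*u' + 210*q + 90*(q*q') + 90*(q*q),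
    -480 + 48*q + 168*p,
    900 + 1500*p' + 1032*(p'*p') + 168*u' + 1824*q + 1332*(q*p') + 828*(q*q) + 1500*p
      + 1032*(p*p') + 1332*(p*q) + 1032*(p*p),
    450 + 510*q' + 210*(q'*q') + 1824*p' + 828*(p'*q') + 1332*(p'*p') + 48*u' + 510*q
      + 210*(q*q') + 828*(q*p') + 210*(q*q),
    -60 + 276*q - 312*p,
    -450 - 912*p' - 552*(p'*p') - 312*u' + 348*q + 72*(q*p') + 270*(q*q) - 912*p - 552*(p*p')
      + 72*(p*q) - 552*(p*p),
    450 + 510*q' + 210*(q'*q') + 348*p' + 270*(p'*q') + 72*(p'*p') + 276*u' + 510*q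
      + 210*(q*q') + 270*(q*p') + 210*(q*q), ?_, ?_, ?_, ?_, ?_, ?_⟩
  · simp only [swapPoly]; ring
  · simp only [swapPoly]; ring
  · simp only [swapPoly]; ring
  · refine ⟨⟨?_, ?_⟩, ⟨?_, ?_⟩, ⟨?_, ?_⟩⟩ <;> linarith
  · refine ⟨⟨?_, ?_⟩, ⟨?_, ?_⟩, ⟨?_, ?_⟩⟩ <;> linarith
  · refine ⟨⟨?_, ?_⟩, ⟨?_, ?_⟩, ⟨?_, ?_⟩⟩ <;> linarith

theorem abs_linear_le {a b c x y z D : ℝ} (ha : |a| ≤ 1 / 6) (hb : |b| ≤ 1 / 6) (hc : |c| ≤ 1 / 6)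
    (hx : |x| ≤ D) (hy : |y| ≤ D) (hz : |z| ≤ D) : |a * x + b * y + c * z| ≤ D / 2 := by
  have h : ∀ {a x : ℝ}, |a| ≤ 1 / 6 → |x| ≤ D → |a * x| ≤ 1 / 6 * D := fun ha hx => by
    rw [abs_mul]; exact mul_le_mul ha hx (abs_nonneg _) (by norm_num)
  calc |a * x + b * y + c * z| ≤ |a * x| + |b * y| + |c * z| := abs_add_three _ _ _
    _ ≤ 1 / 6 * D + 1 / 6 * D + 1 / 6 * D := add_le_add (add_le_add (h ha hx) (h hb hy)) (h hc hz)
    _ = D / 2 := by ring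

/-- The approximate inverse times the matrix of divided differences is close to the identity: every
entry of the error is at most `1 / 6`, so its three-term rows give the factor `1 / 2` in the maximum
norm. -/
theorem newtonMap_sub {x y : ℝ × ℝ × ℝ} (hx : x ∈ swapBox) (hy : y ∈ swapBox) :
    dist (newtonMap x) (newtonMap y) ≤ dist x y / 2 := by
  obtain ⟨a₁, a₂, a₃, b₁, b₂, b₃, c₁, c₂, c₃, hf, hg, hh, ⟨ha₁, ha₂, ha₃⟩, ⟨hb₁, hb₂, hb₃⟩,
    hc₁, hc₂, hc₃⟩ := swapPoly_sub hx hy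
  have hD : |x.1 - y.1| ≤ dist x y ∧ |x.2.1 - y.2.1| ≤ dist x y ∧ |x.2.2 - y.2.2| ≤ dist x y := by
    simp only [Prod.dist_eq, Real.dist_eq]
    exact ⟨le_max_left _ _, (le_max_left _ _).trans (le_max_right _ _),
      (le_max_right _ _).trans (le_max_right _ _)⟩
  obtain ⟨hd₁, hd₂, hd₃⟩ := hD
  rw [Prod.dist_eq, Prod.dist_eq, Real.dist_eq, Real.dist_eq, Real.dist_eq]
  refine max_le ?_ (max_le ?_ ?_)
  · have : (newtonMap x).1 - (newtonMap y).1 =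
        (1 - (1190*a₁ + 388*b₁ - 462*c₁)/1000000) * (x.1 - y.1)
        + (-(1190*a₂ + 388*b₂ - 462*c₂)/1000000) * (x.2.1 - y.2.1)
        + (-(1190*a₃ + 388*b₃ - 462*c₃)/1000000) * (x.2.2 - y.2.2) := by
      simp only [newtonMap]
      linear_combination (-1190 * hf - 388 * hg + 462 * hh) / 1000000
    rw [this]
    refine abs_linear_le ?_ ?_ ?_ hd₁ hd₂ hd₃ <;> rw [abs_le] <;> constructor <;> linarith
  · have : (newtonMap x).2.1 - (newtonMap y).2.1 =
        (-(250*a₁ + 574*b₁ - 620*c₁)/1000000) * (x.1 - y.1)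
        + (1 - (250*a₂ + 574*b₂ - 620*c₂)/1000000) * (x.2.1 - y.2.1)
        + (-(250*a₃ + 574*b₃ - 620*c₃)/1000000) * (x.2.2 - y.2.2) := by
      simp only [newtonMap]
      linear_combination (-250 * hf - 574 * hg + 620 * hh) / 1000000
    rw [this]
    refine abs_linear_le ?_ ?_ ?_ hd₁ hd₂ hd₃ <;> rw [abs_le] <;> constructor <;> linarith
  · have : (newtonMap x).2.2 - (newtonMap y).2.2 =
        (-(258*a₁ + 477*b₁ + 899*c₁)/1000000) * (x.1 - y.1)
        + (-(258*a₂ + 477*b₂ + 899*c₂)/1000000) * (x.2.1 - y.2.1)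
        + (1 - (258*a₃ + 477*b₃ + 899*c₃)/1000000) * (x.2.2 - y.2.2) := by
      simp only [newtonMap]
      linear_combination (-258 * hf - 477 * hg - 899 * hh) / 1000000
    rw [this]
    refine abs_linear_le ?_ ?_ ?_ hd₁ hd₂ hd₃ <;> rw [abs_le] <;> constructor <;> linarith

theorem swapBox_eq : swapBox = Metric.closedBall (0.221285, 0.054633, 0.153388) 0.000005 := by
  ext x
  simp only [swapBox, Set.mem_ofPred_eq, Metric.mem_closedBall, Prod.dist_eq, Real.dist_eq,
    max_le_iff, abs_le]
  constructor
  · rintro ⟨⟨h1, h2⟩, ⟨h3, h4⟩, h5, h6⟩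
    refine ⟨⟨?_, ?_⟩, ⟨?_, ?_⟩, ?_, ?_⟩ <;> linarith
  · rintro ⟨⟨h1, h2⟩, ⟨h3, h4⟩, h5, h6⟩
    refine ⟨⟨?_, ?_⟩, ⟨?_, ?_⟩, ?_, ?_⟩ <;> linarith

/-- The centre moves by at most half the radius, and the contraction leaves the other half for the
remaining points. -/
theorem newtonMap_mapsTo : Set.MapsTo newtonMap swapBox swapBox := by
  intro x hx
  set c : ℝ × ℝ × ℝ := (0.221285, 0.054633, 0.153388) with hc
  have hcs : c ∈ swapBox := by
    rw [swapBox_eq]; exact Metric.mem_closedBall_self (by norm_num)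
  have h1 := newtonMap_sub hx hcs
  have h2 : dist (newtonMap c) c ≤ 0.0000025 := by
    simp only [Prod.dist_eq, Real.dist_eq, max_le_iff, abs_le, newtonMap, swapPoly, hc]
    norm_num
  rw [swapBox_eq, ← hc, Metric.mem_closedBall] at hx ⊢
  calc dist (newtonMap x) c ≤ dist (newtonMap x) (newtonMap c) + dist (newtonMap c) c :=
        dist_triangle _ _ _
    _ ≤ 0.000005 := by linarith

theorem exists_swapPoly_eq_zero : ∃ x ∈ swapBox, swapPoly x = 0 := by
  have hcomplete : IsComplete swapBox := by
    rw [swapBox_eq]; exact Metric.isClosed_closedBall.isComplete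
  have hcontr : ContractingWith (1 / 2)
      (newtonMap_mapsTo.restrict newtonMap swapBox swapBox) := by
    refine ⟨by norm_num [NNReal.coe_lt_coe], LipschitzWith.of_dist_le_mul fun x y => ?_⟩
    have := newtonMap_sub x.2 y.2
    rw [Subtype.dist_eq, Subtype.dist_eq]
    simpa [div_eq_inv_mul] using this
  obtain ⟨x, hx, hfix, -⟩ := hcontr.exists_fixedPoint' hcomplete newtonMap_mapsTo
    (x := (0.221285, 0.054633, 0.153388))
    (by rw [swapBox_eq]; exact Metric.mem_closedBall_self (by norm_num)) (edist_ne_top _ _)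
  refine ⟨x, hx, ?_⟩
  have hfix' : newtonMap x = x := hfix
  have h1 := congrArg (fun y : ℝ × ℝ × ℝ => y.1) hfix'
  have h2 := congrArg (fun y : ℝ × ℝ × ℝ => y.2.1) hfix'
  have h3 := congrArg (fun y : ℝ × ℝ × ℝ => y.2.2) hfix'
  simp only [newtonMap] at h1 h2 h3
  -- At a fixed point the approximate inverse annihilates `swapPoly x`; this linear system is
  -- nonsingular.
  refine Prod.ext ?_ (Prod.ext ?_ ?_) <;> simp only [Prod.fst_zero, Prod.snd_zero] <;> linarith


/-! ### The boundary condition in the frame of the Néel vector -/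

/-- The boundary condition with the Néel vector along the third axis. -/
def zBoundary (t p q : ℂ) : Matrix Pair Pair ℂ :=
  zMat (1 - q - 2 * p) (1 + 2 * t + q + 2 * p) (1 - 2 * t + q + 2 * p) (-2 * (q - p))

/-- The growth factor is read off from the Néel component: the output coefficient of `t` is minus
this factor times `t`, identically. The hypotheses express that the identity component (`h1`), the
`σ₃ ⊗ σ₃` component of the diagonal (`h2`) and the off-diagonal entry (`h3`) are multiplied by the
same factor. -/
theorem transferOp_zBoundary {t p q : ℂ}
    (h1 : 840*t^2*p + 600*t^2*q + 840*t^2 + 72*p^3 + 324*p^2*q + 300*p^2 + 90*q^3 + 210*q^2 - 150*q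
      - 150 - 456*p*q - 840*p = 0)
    (h2 : 48*t^2*q + 168*t^2*p + 1332*p^2*q + 1032*p^3 + 828*p*q^2 + 1824*p*q + 1500*p^2 + 210*q^3
      + 510*q^2 + 450*q + 900*p - 480*t^2 - 50 = 0)
    (h3 : 276*t^2*q - 312*t^2*p + 72*p^2*q - 552*p^3 + 270*p*q^2 + 348*p*q - 912*p^2 + 210*q^3
      + 510*q^2 + 450*q - 450*p - 60*t^2 - 50 = 0) :
    transferOp (g := 3) 1 (fun _ => zBoundary t p q) =
      ((360*t^2+600*p^2+456*p*q+840*p+240*q^2+600*q+600)/100) • zBoundary (-t) p q := by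
  have hs : ∀ k a b c d : ℂ, k • zMat a b c d = zMat (k * a) (k * b) (k * c) (k * d) := by
    intro k a b c d
    ext p p'
    simp only [zMat, Matrix.smul_apply, smul_eq_mul]
    split_ifs <;> simp
  rw [zBoundary, transferOp_zMat, zBoundary, hs]
  congr 1
  · linear_combination (h1 + h2) / 100
  · linear_combination (h1 - h2) / 100
  · linear_combination (h1 - h2) / 100
  · linear_combination 2 * h3 / 100

/-- The exchange of the two layers. -/
def layerSwap : Matrix Pair Pair ℂ := fun p p' => if p = p'.swap then 1 else 0

/-- Makes the rotation invariance of the isotropic term visible, since exchanging the layers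
commutes with `U ⊗ U`. -/
theorem sum_pauli_kronecker_pauli :
    ∑ i, pauli i ⊗ₖ pauli i = (2 : ℂ) • layerSwap - 1 := by
  ext ⟨a, b⟩ ⟨c, d⟩
  fin_cases a <;> fin_cases b <;> fin_cases c <;> fin_cases d <;>
    simp [Fin.sum_univ_three, pauli, layerSwap] <;> norm_num

theorem pairMat_mul_layerSwap (U : Matrix (Fin 2) (Fin 2) ℂ) :
    pairMat U * layerSwap = layerSwap * pairMat U := by
  ext ⟨a, b⟩ ⟨c, d⟩
  fin_cases a <;> fin_cases b <;> fin_cases c <;> fin_cases d <;>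
    simp [pairMat, layerSwap, Matrix.mul_apply, Fintype.sum_prod_type] <;> ring

theorem zBoundary_eq (t p q : ℂ) : zBoundary t p q = 1 + t • (pauli 2 ⊗ₖ 1 - 1 ⊗ₖ pauli 2)
    - (3 * p) • (pauli 2 ⊗ₖ pauli 2) - (q - p) • ((2 : ℂ) • layerSwap - 1) := by
  ext ⟨a, b⟩ ⟨c, d⟩
  fin_cases a <;> fin_cases b <;> fin_cases c <;> fin_cases d <;>
    simp [pauli, layerSwap, zBoundary, zMat] <;> ring

theorem kronecker_neg (A B : Matrix (Fin 2) (Fin 2) ℂ) : A ⊗ₖ (-B) = -(A ⊗ₖ B) := by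
  rw [← neg_one_smul ℂ B, Matrix.kronecker_smul, neg_one_smul]

theorem boundaryOp_eq (x₁ x₂ x₃ : ℝ) : boundaryOp x₁ x₂ x₃ =
    1 + (x₁ : ℂ) • ((∑ i, pauli i) ⊗ₖ 1 - 1 ⊗ₖ ∑ i, pauli i)
    - (x₂ : ℂ) • ((∑ i, pauli i) ⊗ₖ ∑ i, pauli i)
    - ((x₃ : ℂ) - x₂) • ((2 : ℂ) • layerSwap - 1) := by
  rw [← sum_pauli_kronecker_pauli, boundaryOp]
  simp only [kronecker_neg, Fin.sum_univ_three, Matrix.add_kronecker, Matrix.kronecker_add]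
  simp
  module

/-- The first coefficient of the rotation that takes the third axis to the diagonal. -/
noncomputable def axisScale : ℝ := Real.sqrt ((3 + Real.sqrt 3) / 6)

/-- The rotation that takes the third axis to the diagonal. -/
noncomputable def axisRot : Matrix (Fin 2) (Fin 2) ℂ :=
  -- The diagonal has polar angle `θ` with `cos θ = 1/√3` and azimuth `π/4`. The scale is `cos
  -- (θ/2)`, and the lower left entry is `tan (θ/2) e^{iπ/4}`.
  (axisScale : ℂ) • !![1, -((1 - Complex.I) * ((Real.sqrt 3 - 1) / 2));
    (1 + Complex.I) * ((Real.sqrt 3 - 1) / 2), 1]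

theorem sqrt_three_sq : ((Real.sqrt 3 : ℝ) : ℂ) ^ 2 = 3 := by
  rw [← Complex.ofReal_pow, Real.sq_sqrt (by norm_num)]; norm_num

theorem axisScale_sq : (axisScale : ℂ) ^ 2 = (3 + Real.sqrt 3) / 6 := by
  rw [← Complex.ofReal_pow, axisScale, Real.sq_sqrt (by positivity)]; push_cast; ring

theorem axisRot_conjTranspose : axisRotᴴ = (axisScale : ℂ) • !![1,
    (1 - Complex.I) * ((Real.sqrt 3 - 1) / 2); -((1 + Complex.I) * ((Real.sqrt 3 - 1) / 2)), 1] := by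
  ext a b
  fin_cases a <;> fin_cases b <;>
    simp [axisRot, Matrix.conjTranspose_apply, sub_eq_add_neg]

theorem axisRot_singlet : axisRot * singlet * axisRotᵀ = singlet := by
  have hr := sqrt_three_sq
  have hα := axisScale_sq
  have hI := Complex.I_sq
  ext a b
  fin_cases a <;> fin_cases b <;>
    simp [axisRot, singlet, Matrix.mul_apply, Fin.sum_univ_two]
  · ring
  · linear_combination (-(axisScale : ℂ)^2 * ((Real.sqrt 3 - 1)/2)^2) * hI
      + ((axisScale : ℂ)^2/2 - 1/6) * hr + (3 - (Real.sqrt 3 : ℂ)) * hα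
  · linear_combination ((axisScale : ℂ)^2 * ((Real.sqrt 3 - 1)/2)^2) * hI
      - ((axisScale : ℂ)^2/2 - 1/6) * hr - (3 - (Real.sqrt 3 : ℂ)) * hα
  · ring

theorem axisRot_conjTranspose_mul : axisRotᴴ * axisRot = 1 := by
  have hr := sqrt_three_sq
  have hα := axisScale_sq
  have hI := Complex.I_sq
  rw [axisRot_conjTranspose]
  ext a b
  fin_cases a <;> fin_cases b <;>
    simp [axisRot, Matrix.mul_apply, Fin.sum_univ_two]
  · linear_combination (-(axisScale : ℂ)^2 * ((Real.sqrt 3 - 1)/2)^2) * hI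
      + ((axisScale : ℂ)^2/2 - 1/6) * hr + (3 - (Real.sqrt 3 : ℂ)) * hα
  · ring
  · ring
  · linear_combination (-(axisScale : ℂ)^2 * ((Real.sqrt 3 - 1)/2)^2) * hI
      + ((axisScale : ℂ)^2/2 - 1/6) * hr + (3 - (Real.sqrt 3 : ℂ)) * hα

theorem axisRot_pauli :
    (Real.sqrt 3 : ℂ) • (axisRot * pauli 2 * axisRotᴴ) = ∑ i, pauli i := by
  have hr := sqrt_three_sq
  have hα := axisScale_sq
  have hI := Complex.I_sq
  rw [axisRot_conjTranspose, Fin.sum_univ_three]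
  ext a b
  fin_cases a <;> fin_cases b <;>
    simp [axisRot, pauli]
  · linear_combination ((Real.sqrt 3 : ℂ)*(axisScale : ℂ)^2 * ((Real.sqrt 3 - 1)/2)^2) * hI
      + ((axisScale : ℂ)^2 - (Real.sqrt 3 : ℂ)*(axisScale : ℂ)^2/2 - 1/6) * hr
      + (3 - (Real.sqrt 3 : ℂ)) * hα
  · linear_combination (1 - Complex.I) * (((axisScale : ℂ)^2 - 1/6) * hr
      + (3 - (Real.sqrt 3 : ℂ)) * hα)
  · linear_combination (1 + Complex.I) * (((axisScale : ℂ)^2 - 1/6) * hr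
      + (3 - (Real.sqrt 3 : ℂ)) * hα)
  · linear_combination (-(Real.sqrt 3 : ℂ)*(axisScale : ℂ)^2 * ((Real.sqrt 3 - 1)/2)^2) * hI
      - ((axisScale : ℂ)^2 - (Real.sqrt 3 : ℂ)*(axisScale : ℂ)^2/2 - 1/6) * hr
      - (3 - (Real.sqrt 3 : ℂ)) * hα

/-- All three coordinate axes have the same component `1/√3` along the diagonal. The transverse rest
need not be known, because `nodeFun_layerOp_off_diagonal` removes it. -/
theorem exists_axisRot_conj (i : Fin 3) : ∃ x y : ℂ, axisRotᴴ * pauli i * axisRot =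
    ((Real.sqrt 3 : ℂ) / 3) • pauli 2 + !![0, x; y, 0] := by
  have hr := sqrt_three_sq
  have hα := axisScale_sq
  have hI := Complex.I_sq
  refine ⟨(axisRotᴴ * pauli i * axisRot) 0 1, (axisRotᴴ * pauli i * axisRot) 1 0, ?_⟩
  ext a b
  fin_cases a <;> fin_cases b
  · rw [axisRot_conjTranspose]
    fin_cases i <;> simp [axisRot, pauli, Matrix.mul_apply, Fin.sum_univ_two]
    · linear_combination ((Real.sqrt 3 : ℂ) - 1) * hα + hr / 6
    · linear_combination ((Real.sqrt 3 : ℂ) - 1) * hα + hr / 6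
        + (axisScale : ℂ)^2 * (1 - Real.sqrt 3) * hI
    · linear_combination ((Real.sqrt 3 : ℂ) - 1) * hα + hr / 6
        + (axisScale : ℂ)^2 * ((Real.sqrt 3 - 1)/2)^2 * hI - (axisScale : ℂ)^2 / 2 * hr
  · simp [pauli]
  · simp [pauli]
  · rw [axisRot_conjTranspose]
    fin_cases i <;> simp [axisRot, pauli, Matrix.mul_apply, Fin.sum_univ_two]
    · linear_combination -((Real.sqrt 3 : ℂ) - 1) * hα - hr / 6
    · linear_combination -((Real.sqrt 3 : ℂ) - 1) * hα - hr / 6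
        - (axisScale : ℂ)^2 * (1 - Real.sqrt 3) * hI
    · linear_combination -((Real.sqrt 3 : ℂ) - 1) * hα - hr / 6
        - (axisScale : ℂ)^2 * ((Real.sqrt 3 - 1)/2)^2 * hI + (axisScale : ℂ)^2 / 2 * hr

/-- The sum of the Pauli matrices is `√3` times the one along the diagonal. This gives the factor
`√3` on `x₁`, and the factor `3` on the anisotropic term already contained in `zBoundary`. -/
theorem boundaryOp_eq_conj (x₁ x₂ x₃ : ℝ) : boundaryOp x₁ x₂ x₃ =
    pairMat axisRot * zBoundary (Real.sqrt 3 * x₁) x₂ x₃ * (pairMat axisRot)ᴴ := by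
  have hU : axisRot * axisRotᴴ = 1 := mul_eq_one_comm.1 axisRot_conjTranspose_mul
  have hone : pairMat axisRot * (pairMat axisRot)ᴴ = 1 := by
    rw [pairMat_conjTranspose, pairMat_mul, hU, pairMat_one]
  have hk : ∀ A B : Matrix (Fin 2) (Fin 2) ℂ, pairMat axisRot * (A ⊗ₖ B) * (pairMat axisRot)ᴴ =
      (axisRot * A * axisRotᴴ) ⊗ₖ (axisRot * B * axisRotᴴ) := by
    intro A B
    rw [pairMat_conjTranspose, pairMat, pairMat, ← Matrix.mul_kronecker_mul,
      ← Matrix.mul_kronecker_mul]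
  have hsw : pairMat axisRot * layerSwap * (pairMat axisRot)ᴴ = layerSwap := by
    rw [pairMat_mul_layerSwap, Matrix.mul_assoc, hone, Matrix.mul_one]
  have hr := sqrt_three_sq
  rw [boundaryOp_eq, zBoundary_eq, ← axisRot_pauli]
  simp only [Matrix.mul_add, Matrix.mul_sub, Matrix.add_mul, Matrix.sub_mul, Matrix.mul_smul,
    Matrix.smul_mul, hk, hsw, Matrix.mul_one, hone, hU, Matrix.smul_kronecker,
    Matrix.kronecker_smul, smul_smul]
  have h3 : (3 : ℂ) * x₂ = x₂ * (Real.sqrt 3 * Real.sqrt 3) := by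
    rw [← sq, hr]; ring
  rw [h3]
  module


/-! ### The alternating boundary condition at a node -/

/-- The off-diagonal entry is absorbed into a nonnegative multiple of the rank-one projection onto
the singlet direction; the hypotheses make the remaining diagonal nonnegative. -/
theorem zBoundary_posSemidef {t p q : ℝ} (h1 : q + 2 * p ≤ 1) (h2 : p ≤ q)
    (h3 : 2 * |t| ≤ 1 - q + 4 * p) : (zBoundary t p q).PosSemidef := by
  have h4 := neg_abs_le t
  have h5 := le_abs_self t
  have hd : zBoundary t p q = Matrix.diagonal (fun x : Pair => if x.1 = x.2 then
      ((1 - q - 2 * p : ℝ) : ℂ) else if x.1 = 0 then ((1 + 2 * t - q + 4 * p : ℝ) : ℂ) else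
        ((1 - 2 * t - q + 4 * p : ℝ) : ℂ)) +
      ((2 * (q - p) : ℝ) : ℂ) • Matrix.vecMulVec
        (fun x : Pair => if x.1 = x.2 then (0 : ℂ) else if x.1 = 0 then 1 else -1)
        (star fun x : Pair => if x.1 = x.2 then (0 : ℂ) else if x.1 = 0 then 1 else -1) := by
    ext ⟨a, b⟩ ⟨c, d⟩
    fin_cases a <;> fin_cases b <;> fin_cases c <;> fin_cases d <;>
      simp [zBoundary, zMat, Matrix.vecMulVec_apply] <;> ring
  rw [hd]
  refine Matrix.PosSemidef.add (Matrix.PosSemidef.diagonal fun x => ?_)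
    ((Matrix.posSemidef_vecMulVec_self_star _).smul ?_)
  · dsimp only
    split_ifs <;> (simp only [Pi.zero_apply]; rw [Complex.zero_le_real]; linarith)
  · rw [Complex.zero_le_real]; linarith

theorem boundaryOp_posSemidef {x₁ x₂ x₃ : ℝ} (h1 : x₃ + 2 * x₂ ≤ 1) (h2 : x₂ ≤ x₃)
    (h3 : 2 * |Real.sqrt 3 * x₁| ≤ 1 - x₃ + 4 * x₂) : (boundaryOp x₁ x₂ x₃).PosSemidef := by
  rw [boundaryOp_eq_conj, ← Complex.ofReal_mul]
  exact (zBoundary_posSemidef h1 h2 h3).mul_mul_conjTranspose_same _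

/-- The growth factor of the alternating boundary condition. -/
noncomputable def growth (x₁ x₂ x₃ : ℝ) : ℝ :=
  (1080*x₁^2+600*x₂^2+456*x₂*x₃+840*x₂+240*x₃^2+600*x₃+600)/100

theorem transferOp_boundaryOp {x₁ x₂ x₃ : ℝ} (h : swapPoly (3 * x₁ ^ 2, x₂, x₃) = 0) :
    transferOp (g := 3) 1 (fun _ => boundaryOp x₁ x₂ x₃) =
      (growth x₁ x₂ x₃ : ℂ) • boundaryOp (-x₁) x₂ x₃ := by
  have ht : (Real.sqrt 3 * x₁ : ℂ) ^ 2 = ((3 * x₁ ^ 2 : ℝ) : ℂ) := by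
    rw [mul_pow, sqrt_three_sq]; push_cast; ring
  have h1 := congrArg (fun y : ℝ × ℝ × ℝ => (y.1 : ℂ)) h
  have h2 := congrArg (fun y : ℝ × ℝ × ℝ => (y.2.1 : ℂ)) h
  have h3 := congrArg (fun y : ℝ × ℝ × ℝ => (y.2.2 : ℂ)) h
  simp only [swapPoly, Prod.fst_zero, Prod.snd_zero, Complex.ofReal_zero] at h1 h2 h3
  simp only [boundaryOp_eq_conj]
  rw [transferOp_one_conj axisRot_singlet axisRot_conjTranspose_mul, transferOp_zBoundary,
    Matrix.mul_smul, Matrix.smul_mul, ht]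
  · congr 1
    · rw [growth]; push_cast; ring
    · push_cast; rw [mul_neg]
  · rw [ht, ← h1]; push_cast; ring
  · rw [ht, ← h2]; push_cast; ring
  · rw [ht, ← h3]; push_cast; ring

theorem trace_boundaryOp (x₁ x₂ x₃ : ℝ) : (boundaryOp x₁ x₂ x₃).trace = 4 := by
  have hU : pairMat axisRotᴴ * pairMat axisRot = 1 := by
    rw [pairMat_mul, axisRot_conjTranspose_mul, pairMat_one]
  rw [boundaryOp_eq_conj, Matrix.trace_mul_comm, ← Matrix.mul_assoc, pairMat_conjTranspose, hU,
    Matrix.one_mul]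
  simp [Matrix.trace, Fintype.sum_prod_type, zBoundary, zMat]
  ring

theorem transfer_boundaryOp {x₁ x₂ x₃ : ℝ} (h : swapPoly (3 * x₁ ^ 2, x₂, x₃) = 0)
    (h0 : growth x₁ x₂ x₃ ≠ 0) :
    transfer 3 (tensorPow (Fin 3) (boundaryOp x₁ x₂ x₃)) = boundaryOp (-x₁) x₂ x₃ := by
  have h0' : (growth x₁ x₂ x₃ : ℂ) ≠ 0 := Complex.ofReal_ne_zero.2 h0
  rw [transfer, tensorPow_eq, transferUnnormalized_tensorProd, transferOp_boundaryOp h,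
    Matrix.trace_smul, trace_boundaryOp, smul_smul, smul_eq_mul]
  have : (4 / (growth x₁ x₂ x₃ * 4) * growth x₁ x₂ x₃ : ℂ) = 1 := by field_simp
  rw [this, one_smul]

theorem nodeFun_boundaryOp (D : Matrix (NodeCfg 3) (NodeCfg 3) ℂ) (x₁ x₂ x₃ : ℝ) :
    nodeFun D (fun _ => boundaryOp x₁ x₂ x₃) =
      nodeFun ((nodeRep 3 axisRot)ᴴ * D * nodeRep 3 axisRot)
        (fun _ => zBoundary (Real.sqrt 3 * x₁) x₂ x₃) := by
  simp only [boundaryOp_eq_conj]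
  exact nodeFun_conj axisRot_singlet D fun _ => zBoundary (Real.sqrt 3 * x₁) x₂ x₃

theorem const_eq_cons {n : ℕ} {α : Type} (M : α) :
    (fun _ => M : Fin (n + 1) → α) = Fin.cons M fun _ => M := by
  funext i; refine Fin.cases ?_ (fun i => ?_) i <;> simp

/-- The contraction of the two alternating boundary conditions. -/
noncomputable def boundaryNorm (x₁ x₂ x₃ : ℝ) : ℝ :=
  4 + 4 * (x₃ + 2 * x₂) ^ 2 + 24 * x₁ ^ 2 + 8 * (x₃ - x₂) ^ 2

theorem boundaryNorm_pos (x₁ x₂ x₃ : ℝ) : 0 < boundaryNorm x₁ x₂ x₃ := by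
  rw [boundaryNorm]; positivity

theorem pairing_conj {U : Matrix (Fin 2) (Fin 2) ℂ} (hU : U * singlet * Uᵀ = singlet)
    (hU' : Uᴴ * U = 1) (Z Z' : Matrix Pair Pair ℂ) :
    pairing (pairMat U * Z * (pairMat U)ᴴ) (pairMat U * Z' * (pairMat U)ᴴ) = pairing Z Z' := by
  have h1 : pairMat U * pairSinglet * (pairMat U)ᵀ = pairSinglet := by
    rw [pairMat_transpose, pairMat, pairSinglet, pairMat, ← Matrix.mul_kronecker_mul,
      ← Matrix.mul_kronecker_mul, hU]
  have h2 : (pairMat U)ᴴ * pairMat U = 1 := by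
    rw [pairMat_conjTranspose, pairMat_mul, hU', pairMat_one]
  rw [pairing, pairing]
  generalize pairMat U = P at h1 h2 ⊢
  generalize Pᴴ = Q at h2 ⊢
  have h3 : Pᵀ * Qᵀ = 1 := by rw [← Matrix.transpose_mul, h2, Matrix.transpose_one]
  have h4 : Q * (pairSinglet * Qᵀ) = pairSinglet := by
    calc Q * (pairSinglet * Qᵀ) = Q * (P * pairSinglet * Pᵀ * Qᵀ) := by rw [h1]
      _ = (Q * P) * pairSinglet * (Pᵀ * Qᵀ) := by simp only [Matrix.mul_assoc]
      _ = pairSinglet := by rw [h2, h3, Matrix.one_mul, Matrix.mul_one]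
  have h5 : Pᵀ * (pairSinglet * P) = pairSinglet := by
    have h6 : P * (pairSinglet * Pᵀ * pairSinglet) = 1 := by
      rw [← Matrix.mul_assoc, ← Matrix.mul_assoc, h1, pairSinglet_mul_self]
    have h7 := congrArg (fun M => pairSinglet * M) (mul_eq_one_comm.1 h6)
    simpa only [← Matrix.mul_assoc, pairSinglet_mul_self, Matrix.one_mul, Matrix.mul_one] using h7
  calc (P * Z * Q * (pairSinglet * (P * Z' * Q)ᵀ * pairSinglet)).trace
      = (P * (Z * (Q * (pairSinglet * Qᵀ)) * (Z'ᵀ * (Pᵀ * pairSinglet)))).trace := by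
        simp only [Matrix.transpose_mul, Matrix.mul_assoc]
    _ = (Z * (Q * (pairSinglet * Qᵀ)) * (Z'ᵀ * (Pᵀ * (pairSinglet * P)))).trace := by
        rw [Matrix.trace_mul_comm]; simp only [Matrix.mul_assoc]
    _ = (Z * (pairSinglet * Z'ᵀ * pairSinglet)).trace := by
        rw [h4, h5]; simp only [Matrix.mul_assoc]

theorem pairing_boundaryOp (x₁ x₂ x₃ : ℝ) :
    pairing (boundaryOp x₁ x₂ x₃) (boundaryOp (-x₁) x₂ x₃) = (boundaryNorm x₁ x₂ x₃ : ℂ) := by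
  rw [boundaryOp_eq_conj, boundaryOp_eq_conj,
    pairing_conj axisRot_singlet axisRot_conjTranspose_mul, zBoundary, zBoundary, pairing_zMat]
  simp [zMat, boundaryNorm]
  linear_combination (8 * (x₁ : ℂ) ^ 2) * sqrt_three_sq

theorem layerOp_conj {U : Matrix (Fin 2) (Fin 2) ℂ} (hU : Uᴴ * U = 1) (g : ℕ) (l : Bool)
    (A : Matrix (Fin 2) (Fin 2) ℂ) :
    (nodeRep g U)ᴴ * layerOp l (symDeriv (g + 2) A) * nodeRep g U =
      layerOp l (symDeriv (g + 2) (Uᴴ * A * U)) := by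
  have h1 : (symRep (g + 2) U)ᴴ * symRep (g + 2) U = 1 := by
    rw [symRep_conjTranspose, symRep_mul, hU, symRep_one]
  have h2 : (nodeRep g U)ᴴ = (symRep (g + 2) U)ᴴ ⊗ₖ (symRep (g + 2) U)ᴴ := by
    rw [nodeRep]; exact Matrix.conjTranspose_kronecker _ _
  rw [h2, nodeRep]
  cases l <;> simp only [layerOp, cond_true, cond_false] <;>
    rw [← Matrix.mul_kronecker_mul, ← Matrix.mul_kronecker_mul, Matrix.mul_one, h1,
      symRep_mul_symDeriv_mul _ hU]

theorem layerOp_smul_add {g : ℕ} (l : Bool) (a b : ℂ) (A B : Matrix (Fin (g + 3)) (Fin (g + 3)) ℂ) :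
    layerOp l (a • A + b • B) = a • layerOp l A + b • layerOp l B := by
  cases l <;> simp [layerOp, Matrix.add_kronecker, Matrix.kronecker_add, Matrix.smul_kronecker,
    Matrix.kronecker_smul]

/-- The rotation by a half turn about the third axis. -/
noncomputable def halfTurn : Matrix (Fin 2) (Fin 2) ℂ := !![Complex.I, 0; 0, -Complex.I]

/-- A half turn about the third axis leaves the boundary matrices invariant and reverses the
transverse spin components, whose expectation thus equals its own negative. -/
theorem nodeFun_layerOp_off_diagonal (l : Bool) (x y a b c d : ℂ) :
    nodeFun (layerOp l (symDeriv (3 + 2) !![0, x; y, 0])) (fun _ => zMat a b c d) = 0 := by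
  have hS : halfTurn * singlet * halfTurnᵀ = singlet := by
    ext a b; fin_cases a <;> fin_cases b <;> simp [halfTurn, singlet, Matrix.mul_apply]
  have hU : halfTurnᴴ * halfTurn = 1 := by
    ext a b; fin_cases a <;> fin_cases b <;> simp [halfTurn, Matrix.mul_apply]
  have hZ : pairMat halfTurn * zMat a b c d * (pairMat halfTurn)ᴴ = zMat a b c d := by
    ext ⟨a, b⟩ ⟨c, d⟩
    fin_cases a <;> fin_cases b <;> fin_cases c <;> fin_cases d <;>
      simp [pairMat, halfTurn, zMat, Matrix.mul_apply, Fintype.sum_prod_type]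
  have hA : halfTurnᴴ * !![0, x; y, 0] * halfTurn = (-1 : ℂ) • !![0, x; y, 0] := by
    ext a b
    fin_cases a <;> fin_cases b <;> simp [halfTurn, Matrix.mul_apply]
    · linear_combination x * Complex.I_sq
    · linear_combination y * Complex.I_sq
  have h := nodeFun_conj hS (layerOp l (symDeriv (3 + 2) !![0, x; y, 0]))
    (fun _ => zMat a b c d)
  have h2 := layerOp_smul_add (g := 3) l (-1) 0 (symDeriv (3 + 2) !![0, x; y, 0]) 0
  rw [smul_zero, add_zero, zero_smul, add_zero] at h2
  have h3 := nodeFun_smul_add (-1) 0 (layerOp l (symDeriv (3 + 2) !![0, x; y, 0])) 0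
    (fun _ => zMat a b c d)
  rw [smul_zero, add_zero, zero_mul, add_zero] at h3
  rw [hZ, layerOp_conj hU, hA, symDeriv_smul, h2, h3, neg_one_mul] at h
  exact self_eq_neg.1 h

/-- The factor of the spin expectation that is even in `x₁`. -/
noncomputable def spinPoly (x₁ x₂ x₃ : ℝ) : ℝ :=
  (62208*x₁^2*x₂+36288*x₁^2*x₃+60480*x₁^2+14208*x₂^3+19008*x₂^2*x₃+33600*x₂^2+10080*x₂*x₃^2
    +25536*x₂*x₃+23520*x₂+3360*x₃^3+13440*x₃^2+16800*x₃+11200)/100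

theorem zBoundary_submatrix_swap (t p q : ℂ) :
    (zBoundary t p q).submatrix Prod.swap Prod.swap = zBoundary (-t) p q := by
  ext ⟨a, b⟩ ⟨c, d⟩
  fin_cases a <;> fin_cases b <;> fin_cases c <;> fin_cases d <;>
    simp [zBoundary, zMat]
  all_goals ring

/-- The first layer is the explicit evaluation. Exchanging the layers reverses `t`, and the value is
odd in `t`, which gives the opposite sign in the second layer. -/
theorem nodeFun_layerOp_spin_two (l : Bool) (x₁ x₂ x₃ : ℝ) :
    nodeFun (layerOp l (spin (3 + 2) 2)) (fun _ => zBoundary (Real.sqrt 3 * x₁) x₂ x₃) =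
      (bif l then -1 else 1) * (Real.sqrt 3 * x₁ * spinPoly x₁ x₂ x₃) := by
  have h0 : ∀ x₁ : ℝ, nodeFun (layerOp false (spin (3 + 2) 2))
      (fun _ => zBoundary (Real.sqrt 3 * x₁) x₂ x₃) =
        Real.sqrt 3 * x₁ * spinPoly x₁ x₂ x₃ := by
    intro x₁
    have hD : layerOp (g := 3) false (spin (3 + 2) 2) =
        Matrix.diagonal fun s => (((s.1 : ℕ) : ℂ) - 5 / 2) * 1 := by
      simp only [layerOp, cond_false, spin]
      have h1 : (1 : Matrix (Fin (3 + 3)) (Fin (3 + 3)) ℂ) = Matrix.diagonal fun _ => 1 := by simp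
      rw [h1]
      simp only [Matrix.cons_val]
      rw [Matrix.diagonal_kronecker_diagonal]
      norm_num
    have h2 := nodeFun_spin_zMat (Real.sqrt 3 * x₁) x₂ x₃
    rw [hD, zBoundary, h2, spinPoly, mul_pow, sqrt_three_sq]
    push_cast
    ring
  cases l
  · rw [h0]; simp
  · have h1 := nodeFun_swap (layerOp false (spin (3 + 2) 2))
      (fun _ => zBoundary (Real.sqrt 3 * x₁) x₂ x₃)
    have h2 : (layerOp (g := 3) false (spin (3 + 2) 2)).submatrix Prod.swap Prod.swap =
        layerOp true (spin (3 + 2) 2) := by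
      ext ⟨a, b⟩ ⟨c, d⟩
      simp [layerOp, Matrix.kroneckerMap_apply, mul_comm]
    simp only [zBoundary_submatrix_swap, h2] at h1
    have h3 := h0 (-x₁)
    push_cast at h3
    rw [← h1, ← mul_neg, h3, spinPoly, spinPoly]
    push_cast
    simp

/-- Rotated to the third axis, each component contributes its projection `√3 / 3`, which combines
with `t = √3 x₁` to the same value for all `i`. -/
theorem nodeFun_layerOp_spin (l : Bool) (i : Fin 3) (x₁ x₂ x₃ : ℝ) :
    nodeFun (layerOp l (spin (3 + 2) i)) (fun _ => boundaryOp x₁ x₂ x₃) =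
      (bif l then -1 else 1) * (x₁ * spinPoly x₁ x₂ x₃) := by
  obtain ⟨x, y, hxy⟩ := exists_axisRot_conj i
  have h1 : layerOp (g := 3) l (symDeriv (3 + 2) (axisRotᴴ * ((1 / 2 : ℂ) • pauli i) * axisRot)) =
      ((Real.sqrt 3 : ℂ) / 3) • layerOp l (spin (3 + 2) 2) +
        (1 / 2 : ℂ) • layerOp l (symDeriv (3 + 2) !![0, x; y, 0]) := by
    rw [Matrix.mul_smul, Matrix.smul_mul, hxy, smul_add, smul_comm, symDeriv_add, symDeriv_smul,
      ← spin_eq_symDeriv, symDeriv_smul, layerOp_smul_add]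
  rw [nodeFun_boundaryOp, spin_eq_symDeriv, layerOp_conj axisRot_conjTranspose_mul, h1,
    nodeFun_smul_add, nodeFun_layerOp_spin_two, zBoundary, nodeFun_layerOp_off_diagonal]
  linear_combination ((bif l then -1 else 1) * (x₁ * spinPoly x₁ x₂ x₃) / 3 : ℂ) * sqrt_three_sq

theorem nodeFun_one_boundaryOp {x₁ x₂ x₃ : ℝ} (h : swapPoly (3 * x₁ ^ 2, x₂, x₃) = 0) :
    nodeFun (g := 3) 1 (fun _ => boundaryOp x₁ x₂ x₃) =
      ((growth x₁ x₂ x₃ * boundaryNorm x₁ x₂ x₃ : ℝ) : ℂ) := by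
  rw [const_eq_cons, nodeFun_cons, transferOp_boundaryOp h, pairing_smul_right,
    pairing_boundaryOp, Complex.ofReal_mul]


/-! ### Alternating boundary conditions on the tree -/

/-- The product boundary conditions `β n` of `T_n` are mapped into each other by the transfer
operator. -/
structure IsAlternating {g : ℕ} (κ N : ℝ) (β : ℕ → Matrix Pair Pair ℂ) : Prop where
  growth_pos : 0 < κ
  norm_pos : 0 < N
  transferOp_succ : ∀ n, transferOp (g := g) 1 (fun _ => β (n + 1)) = (κ : ℂ) • β n
  -- The previous relation contracts the tree towards the root; this one describes the rest of the
  -- tree as seen from an open leg. Both can hold because the sequence has period two.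
  transferOp_self : ∀ n, transferOp (g := g) 1 (fun _ => β n) = (κ : ℂ) • β (n + 1)
  nodeFun_one : ∀ n, nodeFun (g := g) 1 (fun _ => β n) = (N : ℂ)

theorem one_rootEquiv {g : ℕ} (s s' : NodeCfg g) :
    (1 : Obs (volume g 0)) (rootEquiv g _ s) (rootEquiv g _ s') =
      (1 : Matrix (NodeCfg g) (NodeCfg g) ℂ) s s' := by
  simp only [Matrix.one_apply, (rootEquiv g (Fin (g + 3))).injective.eq_iff]

theorem expect_extend {g : ℕ} {κ N : ℝ} {β : ℕ → Matrix Pair Pair ℂ}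
    (hβ : IsAlternating (g := g) κ N β) {n : ℕ} (A : Obs (volume g n)) :
    expect (extend (volume_subset n.le_succ) A) (fun _ => β (n + 1)) =
      (∏ _w : Boundary g n, (κ : ℂ)) * expect A fun _ => β n := by
  rw [expect_succ (D := fun _ => 1) (fun s t s' t' => extend_glue A s s' t t'), ← expect_smul]
  simp only [hβ.transferOp_succ]

theorem expect_one_pos {g : ℕ} {κ N : ℝ} {β : ℕ → Matrix Pair Pair ℂ}
    (hβ : IsAlternating (g := g) κ N β) (n : ℕ) :
    0 < expect (1 : Obs (volume g n)) fun _ => β n := by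
  induction n with
  | zero =>
    rw [expect_zero (D := 1) one_rootEquiv, hβ.nodeFun_one]
    exact Complex.zero_lt_real.2 hβ.norm_pos
  | succ n ih =>
    rw [← extend_one (volume_subset n.le_succ), expect_extend hβ]
    exact mul_pos (Finset.prod_pos fun _ _ => Complex.zero_lt_real.2 hβ.growth_pos) ih

theorem nodeFun_update {g : ℕ} (D : Matrix (NodeCfg g) (NodeCfg g) ℂ) (M Y : Matrix Pair Pair ℂ)
    (c : Fin (g + 1)) : nodeFun D (Function.update (fun _ => M) c Y) =
      pairing Y (transferOp D fun _ => M) := by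
  rw [← nodeFun_cons, ← nodeFun_comp D (Fin.cons Y fun _ => M) (Equiv.swap 0 c)]
  congr 1
  funext i
  by_cases hi : i = c
  · subst hi
    simp
  · rw [Function.update_of_ne hi]
    by_cases h0 : i = 0
    · subst h0
      obtain ⟨j, rfl⟩ := Fin.exists_succ_eq.2 (Ne.symm hi)
      simp
    · obtain ⟨j, rfl⟩ := Fin.exists_succ_eq.2 h0
      rw [Equiv.swap_apply_of_ne_of_ne h0 hi, Fin.cons_succ]

/-- Both sides are the contraction of one node with `Y` on a single leg and `M` on all others, and
the choice of that leg does not matter. It transports an open ingoing leg through a node. -/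
theorem pairing_transferOp_update {g : ℕ} (M Y : Matrix Pair Pair ℂ) (i : Fin g) :
    pairing M (transferOp 1 (Function.update (fun _ => M) i Y)) =
      pairing Y (transferOp (g := g) 1 fun _ => M) := by
  rw [← nodeFun_cons, Fin.cons_update, ← const_eq_cons, nodeFun_update]

/-- All legs but one of the tree can be contracted. -/
theorem exists_expect_update {g : ℕ} {κ N : ℝ} {β : ℕ → Matrix Pair Pair ℂ}
    (hβ : IsAlternating (g := g) κ N β) (n : ℕ) (w : Boundary g n) : ∃ c : ℂ, ∀ Y,
      expect (1 : Obs (volume g n)) (Function.update (fun _ => β n) w Y) =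
        c * pairing Y (β (n + 1)) := by
  induction n with
  | zero =>
    obtain ⟨i, rfl⟩ := (Boundary.letterEquiv g).surjective w
    refine ⟨κ, fun Y => ?_⟩
    rw [← pairing_smul_right, ← hβ.transferOp_self, ← nodeFun_update 1 (β 0) Y i,
      expect_zero (D := 1) one_rootEquiv]
    congr 1
    funext j
    simp only [Function.update_apply]
    congr 1
    exact propext (Boundary.letterEquiv g).injective.eq_iff
  | succ n ih =>
    obtain ⟨⟨w₀, i⟩, rfl⟩ := (Boundary.childEquiv g n).surjective w
    obtain ⟨c, hc⟩ := ih w₀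
    -- Every outermost node other than `w₀` contributes `κ`; moving the open leg through `w₀` gives
    -- the last `κ` and turns `β (n + 1)` into `β (n + 2)`.
    refine ⟨(∏ w : Boundary g n, if w = w₀ then (1 : ℂ) else κ) * (c * κ), fun Y => ?_⟩
    rw [expect_succ (A := 1) (D := fun _ => 1) fun s t s' t' => one_glue_apply s s' t t']
    have h : (fun w : Boundary g n => transferOp (g := g) 1 fun j =>
        Function.update (fun _ => β (n + 1)) (Boundary.childEquiv g n (w₀, i)) Y (w.child j)) =
        fun w => (if w = w₀ then (1 : ℂ) else κ) • Function.update (fun _ => β n) w₀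
          (transferOp 1 (Function.update (fun _ => β (n + 1)) i Y)) w := by
      funext w
      have hch : ∀ j, w.child j = Boundary.childEquiv g n (w, j) := fun j => rfl
      simp only [hch, Function.update_apply, (Boundary.childEquiv g n).injective.eq_iff,
        Prod.mk.injEq]
      by_cases hw : w = w₀
      · simp only [hw, true_and, if_true, one_smul]
        congr 1
        funext j
        rw [Function.update_apply]
      · simp only [hw, false_and, if_false]
        exact hβ.transferOp_succ n
    rw [h, expect_smul, hc, pairing_comm, pairing_transferOp_update, hβ.transferOp_self,
      pairing_smul_right]
    ring

/-- The node of an outermost site sees the boundary matrix `β n` on its outer legs and, by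
`exists_expect_update`, a multiple of the same matrix from inside. The unknown constant cancels
against the expectation of the identity. -/
theorem expect_siteOp {g : ℕ} {κ N : ℝ} {β : ℕ → Matrix Pair Pair ℂ}
    (hβ : IsAlternating (g := g) κ N β) {n : ℕ} (v : volume g n) (hv : v.1.1.length = n)
    (A : Matrix (Fin (g + 3)) (Fin (g + 3)) ℂ) :
    expect (siteOp v A) (fun _ => β n) * N =
      expect (1 : Obs (volume g n)) (fun _ => β n) *
        nodeFun (layerOp v.1.2 A) fun _ => β n := by
  obtain ⟨⟨w, l⟩, hwl⟩ := v
  cases n with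
  | zero =>
    obtain rfl := Word.eq_root_of_length hv
    have h : expect (siteOp ⟨(⟨[], List.isChain_nil⟩, l), hwl⟩ A) (fun _ => β 0) =
        nodeFun (layerOp l A) fun _ => β 0 := expect_zero (siteOp_root l A) _
    rw [expect_zero (D := 1) one_rootEquiv, hβ.nodeFun_one, h, mul_comm]
  | succ n =>
    obtain ⟨c, hc⟩ := exists_expect_update hβ n ⟨w, mem_sphere.2 hv⟩
    have key : ∀ (D : Matrix (NodeCfg g) (NodeCfg g) ℂ) (A' : Obs (volume g (n + 1))),
        (∀ s t s' t', A' (glue s t) (glue s' t') = (1 : Obs (volume g n)) s s' *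
          ∏ u, (if u = ⟨w, mem_sphere.2 hv⟩ then D else 1) (t u) (t' u)) →
        expect A' (fun _ => β (n + 1)) = (∏ u : Boundary g n,
          if u = ⟨w, mem_sphere.2 hv⟩ then (1 : ℂ) else κ) * c *
            nodeFun D fun _ => β (n + 1) := by
      intro D A' hA'
      rw [expect_succ hA']
      have h : (fun u : Boundary g n => transferOp (g := g)
          (if u = ⟨w, mem_sphere.2 hv⟩ then D else 1) fun _ => β (n + 1)) =
          fun u => (if u = ⟨w, mem_sphere.2 hv⟩ then (1 : ℂ) else κ) •
            Function.update (fun _ => β n) ⟨w, mem_sphere.2 hv⟩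
              (transferOp D fun _ => β (n + 1)) u := by
        funext u
        by_cases hu : u = ⟨w, mem_sphere.2 hv⟩
        · simp [hu]
        · simp only [hu, if_false, Function.update_of_ne hu]
          exact hβ.transferOp_succ n
      rw [h, expect_smul, hc, pairing_comm, ← nodeFun_cons, ← const_eq_cons]
      ring
    have h1 := key 1 1 fun s t s' t' => by simp only [ite_self]; exact one_glue_apply s s' t t'
    rw [key (layerOp l A) _ fun s t s' t' =>
      siteOp_glue ⟨w, mem_sphere.2 hv⟩ l A s s' t t', h1, hβ.nodeFun_one]
    ring

/-! ### Weak limits -/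

theorem trace_boundaryState_mul {g n : ℕ} (M : Matrix Pair Pair ℂ) (A : Obs (volume g n)) :
    (boundaryState g n (tensorPow (Boundary g n) M) * A).trace =
      (expect (1 : Obs (volume g n)) fun _ => M)⁻¹ * expect A fun _ => M := by
  rw [boundaryState, Matrix.smul_mul, Matrix.trace_smul, smul_eq_mul, tensorPow_eq, expect,
    Matrix.mul_one, expect]

theorem subset_volume_iff {g n : ℕ} {Λ : Finset (Site g)} :
    Λ ⊆ volume g n ↔ (Λ.sup fun v => v.1.length) ≤ n := by
  simp only [Finset.sup_le_iff, Finset.subset_iff, mem_volume]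

/-- A further layer multiplies the expectation and its normalization by the same power of `κ`. -/
theorem trace_boundaryState_extend {g : ℕ} {κ N : ℝ} {β : ℕ → Matrix Pair Pair ℂ}
    (hβ : IsAlternating (g := g) κ N β) {Λ : Finset (Site g)} (A : Obs Λ) {m n : ℕ} (hmn : m ≤ n)
    (hm : Λ ⊆ volume g m) (hn : Λ ⊆ volume g n) :
    (boundaryState g n (tensorPow (Boundary g n) (β n)) * extend hn A).trace =
      (boundaryState g m (tensorPow (Boundary g m) (β m)) * extend hm A).trace := by
  induction n, hmn using Nat.le_induction with
  | base => rfl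
  | succ n hmn ih =>
    have h := hm.trans (volume_subset hmn)
    have hκ : (∏ _w : Boundary g n, (κ : ℂ)) ≠ 0 :=
      Finset.prod_ne_zero_iff.2 fun _ _ => Complex.ofReal_ne_zero.2 hβ.growth_pos.ne'
    rw [← ih h, trace_boundaryState_mul, trace_boundaryState_mul,
      ← extend_extend h (volume_subset n.le_succ), expect_extend hβ,
      ← extend_one (volume_subset n.le_succ), expect_extend hβ, mul_inv]
    field_simp

/-- The limit of the states with alternating boundary conditions. -/
noncomputable def limitState (g : ℕ) (β : ℕ → Matrix Pair Pair ℂ) : InfState g := fun Λ A =>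
  (boundaryState g (Λ.sup fun v => v.1.length) (tensorPow _ (β (Λ.sup fun v => v.1.length))) *
    extend (subset_volume_iff.2 le_rfl) A).trace

theorem limitState_eq {g : ℕ} {κ N : ℝ} {β : ℕ → Matrix Pair Pair ℂ}
    (hβ : IsAlternating (g := g) κ N β) {Λ : Finset (Site g)} (A : Obs Λ) {n : ℕ}
    (hn : Λ ⊆ volume g n) : limitState g β Λ A =
      (boundaryState g n (tensorPow (Boundary g n) (β n)) * extend hn A).trace :=
  (trace_boundaryState_extend hβ A (subset_volume_iff.1 hn) _ hn).symm

theorem isWeakLimit_limitState {g : ℕ} {κ N : ℝ} {β : ℕ → Matrix Pair Pair ℂ}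
    (hβ : IsAlternating (g := g) κ N β) :
    IsWeakLimit (fun n => boundaryState g n (tensorPow (Boundary g n) (β n)))
      (limitState g β) := by
  intro Λ A
  refine tendsto_const_nhds.congr' ?_
  filter_upwards [eventually_ge_atTop (Λ.sup fun v => v.1.length)] with n hn
  rw [dif_pos (subset_volume_iff.2 hn), limitState_eq hβ]

/-- The limit may be evaluated in any volume that contains `v`; the smallest one puts `v` in the
outermost layer. -/
theorem magnetization_limitState {g : ℕ} {κ N : ℝ} {β : ℕ → Matrix Pair Pair ℂ}
    (hβ : IsAlternating (g := g) κ N β) (v : Site g) (i : Fin 3) :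
    magnetization (limitState g β) v i =
      nodeFun (layerOp v.2 (spin (g + 2) i)) (fun _ => β v.1.length) / N := by
  have hv : v ∈ volume g v.1.length := mem_volume.2 le_rfl
  have hN : (N : ℂ) ≠ 0 := Complex.ofReal_ne_zero.2 hβ.norm_pos.ne'
  have h1 := expect_siteOp hβ ⟨v, hv⟩ rfl (spin (g + 2) i)
  have h0 := (expect_one_pos hβ v.1.length).ne'
  rw [magnetization, limitState_eq hβ _ (Finset.singleton_subset_iff.2 hv), extend_siteOp,
    trace_boundaryState_mul, eq_div_iff hN, mul_assoc, h1, inv_mul_cancel_left₀ h0]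


/-! ### The alternating boundary conditions for `g = 3` -/

theorem isAlternating_boundaryOp {y x₂ x₃ : ℝ} (h : swapPoly (3 * y ^ 2, x₂, x₃) = 0)
    (h0 : 0 < growth y x₂ x₃) : IsAlternating (g := 3) (growth y x₂ x₃)
      (growth y x₂ x₃ * boundaryNorm y x₂ x₃) fun n => boundaryOp ((-1) ^ n * y) x₂ x₃ := by
  have hsq : ∀ n : ℕ, ((-1) ^ n * y) ^ 2 = y ^ 2 := fun n => by
    rw [mul_pow, ← pow_mul, mul_comm n 2, pow_mul, neg_one_sq, one_pow, one_mul]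
  have hg : ∀ n : ℕ, growth ((-1) ^ n * y) x₂ x₃ = growth y x₂ x₃ := fun n => by
    simp only [growth, hsq]
  have hb : ∀ n : ℕ, boundaryNorm ((-1) ^ n * y) x₂ x₃ = boundaryNorm y x₂ x₃ := fun n => by
    simp only [boundaryNorm, hsq]
  have hT : ∀ n : ℕ, transferOp (g := 3) 1 (fun _ => boundaryOp ((-1) ^ n * y) x₂ x₃) =
      (growth y x₂ x₃ : ℂ) • boundaryOp (-((-1) ^ n * y)) x₂ x₃ := fun n => by
    rw [transferOp_boundaryOp (by rw [hsq, h]), hg]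
  refine ⟨h0, mul_pos h0 (boundaryNorm_pos _ _ _), fun n => ?_, fun n => ?_, fun n => ?_⟩
  · rw [hT, pow_succ]; congr 2; ring
  · rw [hT, pow_succ]; congr 2; ring
  · rw [nodeFun_one_boundaryOp (by rw [hsq, h]), hg, hb]

theorem boundaryState_boundaryOp_isFiniteVolumeGroundState {y x₂ x₃ : ℝ}
    (h : swapPoly (3 * y ^ 2, x₂, x₃) = 0) (h0 : 0 < growth y x₂ x₃)
    (hpos : (boundaryOp y x₂ x₃).PosSemidef) (n : ℕ) :
    IsFiniteVolumeGroundState (boundaryState 3 n (tensorPow (Boundary 3 n)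
      (boundaryOp y x₂ x₃))) := by
  refine boundaryState_isFiniteVolumeGroundState hpos ?_
  have hsq : ((-1) ^ n * y) ^ 2 = y ^ 2 := by
    rw [mul_pow, ← pow_mul, mul_comm n 2, pow_mul, neg_one_sq, one_pow, one_mul]
  -- The starting sign is chosen such that the alternating sequence takes the value `boundaryOp y x₂
  -- x₃` at the given `n`.
  have h1 := expect_one_pos (isAlternating_boundaryOp (y := (-1) ^ n * y) (by rw [hsq, h])
    (by simpa only [growth, hsq] using h0)) n
  have h2 : (-1 : ℝ) ^ n * ((-1) ^ n * y) = y := by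
    rw [← mul_assoc, ← mul_pow]; norm_num
  rwa [h2] at h1

theorem magnetization_boundaryOp {y x₂ x₃ : ℝ} (h : swapPoly (3 * y ^ 2, x₂, x₃) = 0)
    (h0 : 0 < growth y x₂ x₃) (v : Site 3) (i : Fin 3) :
    magnetization (limitState 3 fun n => boundaryOp ((-1) ^ n * y) x₂ x₃) v i =
      ((sublatticeSign v * (y * spinPoly y x₂ x₃ / (growth y x₂ x₃ * boundaryNorm y x₂ x₃)) : ℝ) :
        ℂ) := by
  have hsp : spinPoly ((-1) ^ v.1.length * y) x₂ x₃ = spinPoly y x₂ x₃ := by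
    have hsq : ((-1) ^ v.1.length * y) ^ 2 = y ^ 2 := by
      rw [mul_pow, ← pow_mul, mul_comm _ 2, pow_mul, neg_one_sq, one_pow, one_mul]
    simp only [spinPoly, hsq]
  rw [magnetization_limitState (isAlternating_boundaryOp h h0), nodeFun_layerOp_spin, hsp,
    sublatticeSign, pow_add]
  obtain ⟨w, l⟩ := v
  cases l <;> simp <;> ring

end AKLT

/-! ### Proof of the theorem -/

theorem mainTheorem7 :
    ∃ x₁ x₂ x₃ : ℝ,
      |x₁ - 0.2716| < 0.00005 ∧ |x₂ - 0.0546| < 0.00005 ∧ |x₃ - 0.1534| < 0.00005 ∧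
      -- the two boundary conditions are swapped by the transfer operator
      AKLT.transfer 3 (AKLT.tensorPow (Fin 3) (AKLT.boundaryOp x₁ x₂ x₃)) =
        AKLT.boundaryOp (-x₁) x₂ x₃ ∧
      AKLT.transfer 3 (AKLT.tensorPow (Fin 3) (AKLT.boundaryOp (-x₁) x₂ x₃)) =
        AKLT.boundaryOp x₁ x₂ x₃ ∧
      -- they are boundary conditions of finite-volume ground states
      (∀ n, AKLT.IsFiniteVolumeGroundState (AKLT.boundaryState 3 n
          (AKLT.tensorPow (AKLT.Boundary 3 n) (AKLT.boundaryOp x₁ x₂ x₃)))) ∧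
      (∀ n, AKLT.IsFiniteVolumeGroundState (AKLT.boundaryState 3 n
          (AKLT.tensorPow (AKLT.Boundary 3 n) (AKLT.boundaryOp (-x₁) x₂ x₃)))) ∧
      -- alternating them with the layer gives two Néel-ordered infinite-volume ground states
      (∃ ωp ωm : AKLT.InfState 3, ∃ s : ℝ, 0 < s ∧
        AKLT.IsWeakLimit (fun n => AKLT.boundaryState 3 n (AKLT.tensorPow (AKLT.Boundary 3 n)
          (AKLT.boundaryOp ((-1) ^ n * x₁) x₂ x₃))) ωp ∧
        AKLT.IsWeakLimit (fun n => AKLT.boundaryState 3 n (AKLT.tensorPow (AKLT.Boundary 3 n)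
          (AKLT.boundaryOp (-((-1) ^ n * x₁)) x₂ x₃))) ωm ∧
        AKLT.IsGroundState ωp ∧ AKLT.IsGroundState ωm ∧
        (∀ v i, AKLT.magnetization ωp v i = ((AKLT.sublatticeSign v * s : ℝ) : ℂ)) ∧
        (∀ v i, AKLT.magnetization ωm v i = ((-(AKLT.sublatticeSign v * s) : ℝ) : ℂ))) ∧
      ¬ AKLT.HasUniqueGroundState 3 := by
  obtain ⟨⟨u, x₂, x₃⟩, ⟨hu, hp, hq⟩, hzero⟩ := AKLT.exists_swapPoly_eq_zero
  simp only at hu hp hq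
  obtain ⟨x₁, hx₁, hx₁u⟩ : ∃ x₁ : ℝ, 0 < x₁ ∧ 3 * x₁ ^ 2 = u := by
    refine ⟨Real.sqrt (u / 3), Real.sqrt_pos.2 (by linarith), ?_⟩
    rw [Real.sq_sqrt (by linarith)]; ring
  subst hx₁u
  -- The box confines `3 x₁²` to `[0.22128, 0.22129]`, and squaring the two bounds shows that it
  -- lies strictly between them.
  have hlo : 0.27158 < x₁ := by
    by_contra hc
    nlinarith [not_lt.1 hc]
  have hhi : x₁ < 0.2716 := by
    by_contra hc
    nlinarith [not_lt.1 hc]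
  have hzero' : AKLT.swapPoly (3 * (-x₁) ^ 2, x₂, x₃) = 0 := by rw [neg_sq]; exact hzero
  have hgrow : 0 < AKLT.growth x₁ x₂ x₃ := by
    have h₂ : 0 < x₂ := by linarith
    have h₃ : 0 < x₃ := by linarith
    rw [AKLT.growth]; positivity
  have hgrow' : 0 < AKLT.growth (-x₁) x₂ x₃ := by
    simpa only [AKLT.growth, neg_sq] using hgrow
  have habs : 2 * |Real.sqrt 3 * x₁| ≤ 1 - x₃ + 4 * x₂ := by
    have h3 : Real.sqrt 3 ≤ 1.8 := by
      rw [Real.sqrt_le_left (by norm_num)]; norm_num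
    rw [abs_of_nonneg (by positivity)]
    nlinarith [Real.sqrt_nonneg 3]
  have hpos : (AKLT.boundaryOp x₁ x₂ x₃).PosSemidef :=
    AKLT.boundaryOp_posSemidef (by linarith) (by linarith) habs
  have hpos' : (AKLT.boundaryOp (-x₁) x₂ x₃).PosSemidef :=
    AKLT.boundaryOp_posSemidef (by linarith) (by linarith) (by rwa [mul_neg, abs_neg])
  have hfin := AKLT.boundaryState_boundaryOp_isFiniteVolumeGroundState hzero hgrow hpos
  have hfin' := AKLT.boundaryState_boundaryOp_isFiniteVolumeGroundState hzero' hgrow' hpos'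
  have halt : ∀ n k : ℕ, AKLT.IsFiniteVolumeGroundState (AKLT.boundaryState 3 n
      (AKLT.tensorPow (AKLT.Boundary 3 n) (AKLT.boundaryOp ((-1) ^ k * x₁) x₂ x₃))) := by
    intro n k
    rcases neg_one_pow_eq_or ℝ k with h | h <;> rw [h]
    · rw [one_mul]; exact hfin n
    · rw [neg_one_mul]; exact hfin' n
  have hneg : ∀ n : ℕ, (-1 : ℝ) ^ n * -x₁ = -((-1) ^ n * x₁) := fun n => mul_neg _ _
  have halt' : ∀ n : ℕ, AKLT.IsFiniteVolumeGroundState (AKLT.boundaryState 3 n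
      (AKLT.tensorPow (AKLT.Boundary 3 n) (AKLT.boundaryOp (-((-1) ^ n * x₁)) x₂ x₃))) := by
    intro n
    have := halt n (n + 1)
    rwa [pow_succ, mul_neg_one, neg_mul] at this
  have hweak := AKLT.isWeakLimit_limitState (AKLT.isAlternating_boundaryOp hzero hgrow)
  have hweak' := AKLT.isWeakLimit_limitState (AKLT.isAlternating_boundaryOp hzero' hgrow')
  have hmag := AKLT.magnetization_boundaryOp hzero hgrow
  have hmag' := AKLT.magnetization_boundaryOp hzero' hgrow'
  simp only [hneg] at hweak' hmag'
  set ωp := AKLT.limitState 3 fun n => AKLT.boundaryOp ((-1) ^ n * x₁) x₂ x₃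
  set ωm := AKLT.limitState 3 fun n => AKLT.boundaryOp (-((-1) ^ n * x₁)) x₂ x₃
  have hs : 0 < x₁ * AKLT.spinPoly x₁ x₂ x₃ /
      (AKLT.growth x₁ x₂ x₃ * AKLT.boundaryNorm x₁ x₂ x₃) := by
    have h₂ : 0 < x₂ := by linarith
    have h₃ : 0 < x₃ := by linarith
    refine div_pos (mul_pos hx₁ ?_) (mul_pos hgrow (AKLT.boundaryNorm_pos _ _ _))
    rw [AKLT.spinPoly]; positivity
  -- All three factors are even in `x₁`, so reversing `x₁` reverses the order parameter.
  have hodd : -x₁ * AKLT.spinPoly (-x₁) x₂ x₃ /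
      (AKLT.growth (-x₁) x₂ x₃ * AKLT.boundaryNorm (-x₁) x₂ x₃) =
      -(x₁ * AKLT.spinPoly x₁ x₂ x₃ / (AKLT.growth x₁ x₂ x₃ * AKLT.boundaryNorm x₁ x₂ x₃)) := by
    simp only [AKLT.spinPoly, AKLT.growth, AKLT.boundaryNorm, neg_sq]
    rw [neg_mul, neg_div]
  rw [hodd] at hmag'
  generalize x₁ * AKLT.spinPoly x₁ x₂ x₃ /
    (AKLT.growth x₁ x₂ x₃ * AKLT.boundaryNorm x₁ x₂ x₃) = s at hs hmag hmag'
  have hgp : AKLT.IsGroundState ωp := ⟨_, fun n => halt n n, hweak⟩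
  have hgm : AKLT.IsGroundState ωm := ⟨_, halt', hweak'⟩
  refine ⟨x₁, x₂, x₃, ?_, ?_, ?_, AKLT.transfer_boundaryOp hzero hgrow.ne', ?_, hfin, hfin',
    ⟨ωp, ωm, s, hs, hweak, hweak', hgp, hgm, hmag, fun v i => ?_⟩, fun hunique => ?_⟩
  · rw [abs_lt]; constructor <;> linarith
  · rw [abs_lt]; constructor <;> linarith
  · rw [abs_lt]; constructor <;> linarith
  · have := AKLT.transfer_boundaryOp hzero' hgrow'.ne'
    rwa [neg_neg] at this
  · rw [hmag', mul_neg]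
  -- Equality would make the magnetization of the first-layer root both `s` and `-s`.
  · have heq : ωp = ωm := hunique.unique hgp hgm
    have h := hmag (⟨[], List.isChain_nil⟩, false) 0
    rw [heq, hmag'] at h
    have h' := Complex.ofReal_injective h
    simp only [AKLT.sublatticeSign, AKLT.Word.length, List.length_nil, Bool.toNat_false, add_zero,
      pow_zero, one_mul] at h'
    linarith
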